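/- Let $n\ge 2$ and $s>\frac{n+5}{2}$. Let $\{Y_{lm}\}_{1\le m\le d_l}$ be, for each $l\ge 0$, a real-valued basis, orthonormal in $L^2(\mathbb S^{n-1},dS)$, of the space of spherical harmonics of degree $l$ on $\mathbb S^{n-1}\subset\mathbb R^n$, where $dS$ is the (unnormalized) area measure. Let $f=\sum_{l\ge0}\sum_{m=1}^{d_l} f_{lm}Y_{lm}\in H^s(\mathbb S^{n-1})$, the series converging in $L^2(\mathbb S^{n-1},dS)$, where $$f_{lm}=i^l a_{lm},\quad a_{lm}\in\mathbb R,\qquad \|f\|_{H^s}^2:=\sum_{l,m}(1+l)^{2s}|f_{lm}|^2<\infty .$$ Set $$f_R:=\sum_{l\ \mathrm{even}}\sum_{m}(-1)^{l/2}a_{lm}Y_{lm},\qquad f_I:=\sum_{l\ \mathrm{odd}}\sum_m(-1)^{(l-1)/2}a_{lm}Y_{lm}.$$ These series converge pointwise to real-valued differentiable functions on $\mathbb S^{n-1}$, and $f=f_R+if_I$ almost everywhere. The Fourier transform $$u(x):=\widehat{f\,dS}(x)=\int_{\mathbb S^{n-1}}e^{-ix\cdot\xi}f(\xi)\,dS(\xi)$$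 is real-valued and differentiable on $\mathbb R^n$. For $x\ne0$ write $r:=|x|$, $\theta:=x/|x|$, $\partial_ru:=\frac{x}{|x|}\cdot\nabla u$, $\nabla^{\mathrm{ang}} u:=\nabla u-\frac{x\cdot\nabla u}{|x|^2}x$, let $\nabla_{\mathbb S}$ be the gradient on the unit sphere (as a tangent vector in $\mathbb R^n$), and let $r_0:=\frac{\pi}{4}(n-1)$. Then for all $x\neq0$ \begin{align*} u(x)&=\frac{2(2\pi)^{\frac{n-1}2}}{r^{\frac{n-1}2}}\big[f_R(\theta)\cos(r-r_0)+f_I(\theta)\sin(r-r_0)+\mathcal E_1(x)\big],\\ \partial_ru(x)&=\frac{2(2\pi)^{\frac{n-1}2}}{r^{\frac{n-1}2}}\big[-f_R(\theta)\sin(r-r_0)+f_I(\theta)\cos(r-r_0)+\mathcal E_2(x)\big],\\ \nabla^{\mathrm{ang}} u(x)&=\frac{2(2\pi)^{\frac{n-1}2}}{r^{\frac{n+1}2}}\big[\nabla_{\mathbb S}f_R(\theta)\cos(r-r_0)+\nabla_{\mathbb S}f_I(\theta)\sin(r-r_0)+\mathcal E_3(x)\big], \end{align*} where $\mathcal E_1,\mathcal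 E_2$ are real-valued, $\mathcal E_3$ is $\mathbb R^n$-valued, $\mathcal E_1$ is differentiable on $\mathbb R^n\setminus\{0\}$, and $$|\mathcal E_1(x)|+|\nabla\mathcal E_1(x)|+|\mathcal E_2(x)|+|\mathcal E_3(x)|\le\frac{C\|f\|_{H^s(\mathbb S^{n-1})}}{r}\qquad(x\ne0),$$ with a constant $C>0$ depending only on $n$ and $s$. -/

import Mathlib

open MeasureTheory Filter Topology

noncomputable section

/-- The unit sphere of the Euclidean space `ℝⁿ`. -/
abbrev USphere (n : ℕ) : Type := Metric.sphere (0 : EuclideanSpace ℝ (Fin n)) 1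

/-- The (unnormalized) area measure `dS` of the unit sphere. -/
def areaMeasure (n : ℕ) : Measure (USphere n) :=
  (volume : Measure (EuclideanSpace ℝ (Fin n))).toSphere

/-- The real spherical harmonics of degree `l`: restrictions to the unit sphere of the harmonic
homogeneous polynomials of degree `l` with real coefficients. -/
def sphericalHarmonics (n l : ℕ) : Submodule ℝ (USphere n → ℝ) where
  carrier := {Y | ∃ p : MvPolynomial (Fin n) ℝ, p.IsHomogeneous l ∧
    ∑ i, MvPolynomial.pderiv i (MvPolynomial.pderiv i p) = 0 ∧
    ∀ ξ : USphere n, Y ξ = MvPolynomial.eval (fun i => (ξ : EuclideanSpace ℝ (Fin n)) i) p}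
  add_mem' := by
    rintro Y Z ⟨p, hp, hp', hpY⟩ ⟨q, hq, hq', hqZ⟩
    exact ⟨p + q, hp.add hq, by simp [Finset.sum_add_distrib, hp', hq'],
      fun ξ => by simp [hpY, hqZ]⟩
  zero_mem' := ⟨0, MvPolynomial.isHomogeneous_zero _ _ _, by simp, by simp⟩
  smul_mem' := by
    rintro c Y ⟨p, hp, hp', hpY⟩
    refine ⟨c • p, (MvPolynomial.homogeneousSubmodule (Fin n) ℝ l).smul_mem c hp, ?_,
      fun ξ => by simp [hpY, MvPolynomial.smul_eval]⟩
    simp only [Derivation.map_smul, ← Finset.smul_sum, hp', smul_zero]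

/-- A real-valued orthonormal basis `Y l m` of spherical harmonics: for each degree `l`, the
functions `Y l m`, where `m` ranges over `d l` indices, are a basis of the space of spherical
harmonics of degree `l` that is orthonormal in `L²(dS)`. -/
structure SphericalHarmonicBasis (n : ℕ) where
  d : ℕ → ℕ
  Y : (l : ℕ) → Fin (d l) → USphere n → ℝ
  orthonormal : ∀ (l : ℕ) (m m' : Fin (d l)),
    ∫ ξ, Y l m ξ * Y l m' ξ ∂(areaMeasure n) = if m = m' then 1 else 0
  span_eq : ∀ l : ℕ, Submodule.span ℝ (Set.range (Y l)) = sphericalHarmonics n l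

namespace SphericalHarmonicBasis

variable {n : ℕ} (B : SphericalHarmonicBasis n)

/-- `f = ∑ₗ ∑ₘ c l m • Y l m`, as a series converging in `L²(dS)`. -/
def IsExpansion (f : USphere n → ℂ) (c : (l : ℕ) → Fin (B.d l) → ℂ) : Prop :=
  MemLp f 2 (areaMeasure n) ∧
  Tendsto (fun L : ℕ => eLpNorm
    (fun ξ => f ξ - ∑ l ∈ Finset.range L, ∑ m, c l m * (B.Y l m ξ : ℂ)) 2 (areaMeasure n))
    atTop (𝓝 0)

/-- The terms `(1 + l)^{2s} ∑ₘ |c l m|²` of the square of the `H^s` norm. -/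
def sobolevTerm (s : ℝ) (c : (l : ℕ) → Fin (B.d l) → ℂ) (l : ℕ) : ℝ :=
  (1 + (l : ℝ)) ^ (2 * s) * ∑ m, ‖c l m‖ ^ 2

/-- The function with spherical harmonic coefficients `c` is in `H^s`. -/
def MemSobolev (s : ℝ) (c : (l : ℕ) → Fin (B.d l) → ℂ) : Prop :=
  Summable (B.sobolevTerm s c)

/-- The `H^s` norm of the function with spherical harmonic coefficients `c`. -/
def sobolevNorm (s : ℝ) (c : (l : ℕ) → Fin (B.d l) → ℂ) : ℝ :=
  Real.sqrt (∑' l, B.sobolevTerm s c l)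

/-- The term of degree `l = 2k` of the series of `f_R`. -/
def evenTerm (a : (l : ℕ) → Fin (B.d l) → ℝ) (ξ : USphere n) (k : ℕ) : ℝ :=
  ∑ m, (-1) ^ k * a (2 * k) m * B.Y (2 * k) m ξ

/-- The term of degree `l = 2k + 1` of the series of `f_I`. -/
def oddTerm (a : (l : ℕ) → Fin (B.d l) → ℝ) (ξ : USphere n) (k : ℕ) : ℝ :=
  ∑ m, (-1) ^ k * a (2 * k + 1) m * B.Y (2 * k + 1) m ξ

/-- `f_R = ∑_{l even} (-1)^{l/2} ∑ₘ a l m • Y l m`. -/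
def evenPart (a : (l : ℕ) → Fin (B.d l) → ℝ) (ξ : USphere n) : ℝ := ∑' k, B.evenTerm a ξ k

/-- `f_I = ∑_{l odd} (-1)^{(l-1)/2} ∑ₘ a l m • Y l m`. -/
def oddPart (a : (l : ℕ) → Fin (B.d l) → ℝ) (ξ : USphere n) : ℝ := ∑' k, B.oddTerm a ξ k

end SphericalHarmonicBasis

/-- The Fourier transform of the measure `f dS`, `x ↦ ∫ e^{-i x·ξ} f(ξ) dS(ξ)`. -/
def fourierSphere {n : ℕ} (f : USphere n → ℂ) (x : EuclideanSpace ℝ (Fin n)) : ℂ :=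
  ∫ ξ : USphere n, Complex.exp (-Complex.I * ((inner ℝ x (ξ : EuclideanSpace ℝ (Fin n)) : ℝ) : ℂ))
    * f ξ ∂(areaMeasure n)

/-- The angular variable `θ = x / |x|` of a nonzero point. -/
def angle {n : ℕ} (x : EuclideanSpace ℝ (Fin n)) (hx : x ≠ 0) : USphere n :=
  ⟨‖x‖⁻¹ • x, by
    rw [mem_sphere_zero_iff_norm, norm_smul, norm_inv, norm_norm,
      inv_mul_cancel₀ (norm_ne_zero_iff.mpr hx)]⟩

open Classical in
/-- The extension `x ↦ g (x / |x|)` of a function on the sphere, homogeneous of degree `0`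
(with value `0` at the origin). -/
def homExt {n : ℕ} (g : USphere n → ℝ) (x : EuclideanSpace ℝ (Fin n)) : ℝ :=
  if hx : x = 0 then 0 else g (angle x hx)

/-- The covariant (spherical) gradient, as a vector of `ℝⁿ` tangent to the sphere: the gradient at
`θ` of the extension of `g` that is constant along rays. -/
def sphereGradient {n : ℕ} (g : USphere n → ℝ) (θ : USphere n) : EuclideanSpace ℝ (Fin n) :=
  gradient (homExt g) (θ : EuclideanSpace ℝ (Fin n))

/-- The radial derivative `(x / |x|) · ∇u`. -/
def radialDeriv {n : ℕ} (u : EuclideanSpace ℝ (Fin n) → ℝ) (x : EuclideanSpace ℝ (Fin n)) : ℝ :=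
  inner ℝ (‖x‖⁻¹ • x) (gradient u x)

/-- The angular gradient `∇u - ((x · ∇u) / |x|²) x`. -/
def angularGradient {n : ℕ} (u : EuclideanSpace ℝ (Fin n) → ℝ) (x : EuclideanSpace ℝ (Fin n)) :
    EuclideanSpace ℝ (Fin n) :=
  gradient u x - (inner ℝ x (gradient u x) / ‖x‖ ^ 2) • x

end

noncomputable section

/-! ### The Bessel–Clifford functions -/

/-! Expanding `e^{-ix·ξ}` and computing the moments of `(x·ξ)^m` against a solid harmonic `p` of
degree `l` shows that the Fourier transform of `p dS` is `(-i)^l` times a real radial function times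
`p`; the radial function is a Bessel function of order `ν = l + n/2 - 1`
(`integral_cexp_mul_harmonic`). The factor `i^l` in the coefficients of `f` cancels `(-i)^l`. Hence
`u` is real and equals `2(2π)^{(n-1)/2} r^{-(n-1)/2} ∑ₗ w_l(r) Q_l(θ)`, where `w_l = √(πr/2) J_ν(r)`
and `Q_l = ∑ₘ a_{lm} Y_{lm}`. Since `w_l(r)` is close to `cos(r - r₀ - lπ/2)`, the addition formula
sends even degrees to `f_R cos(r - r₀)` and odd degrees to `f_I sin(r - r₀)`.

The analytic core is a remainder bound of size `(1+l)²/r` for `w_l` and its derivative, valid for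
every `r > 0` and uniform in `l` (`exists_besselWave_bound`). Apart from the order `ν = 0`, it
follows from the equation `w'' = (μ/r² - 1)w`, `μ = ν² - 1/4`, from the vanishing of `w` and `w w'`
at the origin, and from asymptotics at infinity without any rate: a monotone energy gives `|w'| ≤ 1`
and `|w| ≤ r`, and variation of constants then gives the rate. The asymptotics climb from `ν` to `ν
+ 1` by a ladder relation, starting from `ν = 1/2`, where `w` is the sine, and from `ν = 0`, where
the integral for `J₀` reduces to a Fresnel integral.

The series is summed with the addition theorem on the diagonal, its Laplacian (which controls
gradients), and the bound `d_l ≤ 2(1+l)^{n-2}` (`exists_harmonic_bounds`). Thus `Q_l` costs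
`(1+l)^{(n-2)/2}`, its gradient one power more and the Bessel remainder two more. Cauchy–Schwarz
against the `H^s` norm then needs `∑ (1+l)^{n+4-2s} < ∞`, which is the condition `s > (n+5)/2`
(`exists_angularFamily`). -/

/-- The coefficients `(-1)^k / (k! Γ(ν+k+1))`. -/
def besselCoeff (ν : ℝ) (k : ℕ) : ℝ := (-1) ^ k / (k.factorial * Real.Gamma (ν + k + 1))

/-- The entire function `∑ₖ (-1)^k z^k / (k! Γ(ν+k+1))`, so that
`J_ν(r) = (r/2)^ν besselClifford ν (r²/4)`. -/
def besselClifford (ν z : ℝ) : ℝ := ∑' k : ℕ, besselCoeff ν k * z ^ k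

lemma gamma_shift_pos {ν : ℝ} (hν : 0 ≤ ν) (k : ℕ) : 0 < Real.Gamma (ν + k + 1) :=
  Real.Gamma_pos_of_pos (by positivity)

lemma gamma_shift_succ {ν : ℝ} (hν : 0 ≤ ν) (k : ℕ) :
    Real.Gamma (ν + (k + 1 : ℕ) + 1) = (ν + k + 1) * Real.Gamma (ν + k + 1) := by
  have h : ν + k + 1 ≠ 0 := by positivity
  rw [← Real.Gamma_add_one h]; push_cast; ring_nf

lemma gamma_shift_ge {ν : ℝ} (hν : 0 ≤ ν) (k : ℕ) :
    Real.Gamma (ν + 1) ≤ Real.Gamma (ν + k + 1) := by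
  induction k with
  | zero => simp
  | succ k ih =>
    rw [gamma_shift_succ hν]
    have h1 := gamma_shift_pos hν k
    have h2 : (1 : ℝ) ≤ ν + k + 1 := by
      have : (0 : ℝ) ≤ k := by positivity
      linarith
    nlinarith

lemma abs_besselCoeff_le {ν : ℝ} (hν : 0 ≤ ν) (k : ℕ) :
    |besselCoeff ν k| ≤ (Real.Gamma (ν + 1))⁻¹ / k.factorial := by
  have h0 : 0 < Real.Gamma (ν + 1) := Real.Gamma_pos_of_pos (by positivity)
  have h1 := gamma_shift_pos hν k
  have h3 : (0 : ℝ) < k.factorial := by positivity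
  rw [besselCoeff, abs_div, abs_pow, abs_neg, abs_one, one_pow, abs_of_pos (by positivity),
    inv_eq_one_div, div_div, mul_comm]
  gcongr
  exact gamma_shift_ge hν k

lemma besselCoeff_succ_mul {ν : ℝ} (hν : 0 ≤ ν) (k : ℕ) :
    besselCoeff ν (k + 1) * (k + 1 : ℕ) = -besselCoeff (ν + 1) k := by
  have h1 := gamma_shift_pos hν k
  have h4 := gamma_shift_pos hν (k + 1)
  have h5 : ν + 1 + k + 1 = ν + (k + 1 : ℕ) + 1 := by push_cast; ring
  have h3 : (0 : ℝ) < k.factorial := by positivity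
  rw [besselCoeff, besselCoeff, h5, Nat.factorial_succ]
  push_cast at h4 ⊢
  field_simp
  ring

lemma summable_besselClifford {ν : ℝ} (hν : 0 ≤ ν) (z : ℝ) :
    Summable fun k => besselCoeff ν k * z ^ k := by
  refine Summable.of_norm_bounded
    ((Real.summable_pow_div_factorial |z|).mul_left (Real.Gamma (ν + 1))⁻¹) fun k => ?_
  rw [norm_mul, norm_pow, Real.norm_eq_abs, Real.norm_eq_abs]
  calc _ ≤ (Real.Gamma (ν + 1))⁻¹ / k.factorial * |z| ^ k := by
        gcongr; exact abs_besselCoeff_le hν k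
    _ = _ := by ring

/-- Termwise differentiation on the ball of radius `|z| + 1`, where the derivatives are dominated by
a multiple of a shifted exponential series. -/
lemma hasDerivAt_besselClifford {ν : ℝ} (hν : 0 ≤ ν) (z : ℝ) :
    HasDerivAt (besselClifford ν) (-besselClifford (ν + 1) z) z := by
  set R : ℝ := |z| + 1 with hR
  have hR0 : 0 < R := by positivity
  set G : ℝ := (Real.Gamma (ν + 1))⁻¹ with hG
  have hGpos : 0 < G := inv_pos.2 (Real.Gamma_pos_of_pos (by positivity))
  have hterm : ∀ k : ℕ, ((k + 1 : ℕ) : ℝ) * R ^ k / (k + 1).factorial = R ^ k / k.factorial := by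
    intro k
    rw [Nat.factorial_succ]; push_cast
    field_simp
  have hu : Summable fun k : ℕ => G * ((k : ℝ) * R ^ (k - 1) / k.factorial) := by
    refine Summable.mul_left _ ?_
    rw [← summable_nat_add_iff 1]
    simp only [add_tsub_cancel_right, hterm]
    exact Real.summable_pow_div_factorial R
  have key := hasDerivAt_tsum_of_isPreconnected
    (g := fun (k : ℕ) (y : ℝ) => besselCoeff ν k * y ^ k)
    (g' := fun (k : ℕ) (y : ℝ) => besselCoeff ν k * (k * y ^ (k - 1)))
    (t := Metric.ball 0 R) (y₀ := 0) (y := z) hu Metric.isOpen_ball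
    (convex_ball 0 R).isPreconnected ?_ ?_ (by simp [hR0]) ?_ (by simp [hR])
  · refine key.congr_deriv ?_
    rw [Summable.tsum_eq_zero_add]
    · rw [besselClifford, ← tsum_neg]
      simp only [Nat.cast_zero, zero_mul, mul_zero, zero_add, add_tsub_cancel_right]
      refine tsum_congr fun k => ?_
      rw [← mul_assoc, besselCoeff_succ_mul hν]; ring
    · rw [← summable_nat_add_iff 1]
      simp only [add_tsub_cancel_right]
      refine (summable_besselClifford (ν := ν + 1) (by positivity) z).neg.congr fun k => ?_
      rw [← mul_assoc, besselCoeff_succ_mul hν]; ring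
  · intro k y _
    exact (hasDerivAt_pow k y).const_mul _
  · intro k y hy
    have hy' : |y| ≤ R := by simpa using (le_of_lt hy : dist y 0 ≤ R)
    rw [norm_mul, norm_mul, norm_pow, Real.norm_eq_abs, Real.norm_eq_abs, Real.norm_eq_abs,
      Nat.abs_cast]
    calc |besselCoeff ν k| * (k * |y| ^ (k - 1)) ≤ G / k.factorial * (k * R ^ (k - 1)) := by
          gcongr; exact abs_besselCoeff_le hν k
      _ = _ := by ring
  · exact summable_besselClifford hν 0

lemma continuous_besselClifford {ν : ℝ} (hν : 0 ≤ ν) : Continuous (besselClifford ν) :=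
  continuous_iff_continuousAt.2 fun z => (hasDerivAt_besselClifford hν z).continuousAt

/-- This is the three-term relation between `J_ν`, `J_{ν+1}` and `J_{ν+2}`. The factor `z` shifts
the index of the last series by one, and the coefficients then cancel by the functional equation of
`Γ`. -/
lemma besselClifford_recurrence {ν : ℝ} (hν : 0 ≤ ν) (z : ℝ) :
    besselClifford ν z - (ν + 1) * besselClifford (ν + 1) z + z * besselClifford (ν + 2) z = 0 := by
  have h0 := summable_besselClifford hν z
  have h1 := summable_besselClifford (ν := ν + 1) (by positivity) z
  have h2 := summable_besselClifford (ν := ν + 2) (by positivity) z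
  have e2 : z * besselClifford (ν + 2) z = ∑' k : ℕ, -(besselCoeff (ν + 1) k * k * z ^ k) := by
    rw [Summable.tsum_eq_zero_add]
    · simp only [Nat.cast_zero, mul_zero, zero_mul, neg_zero, zero_add]
      rw [besselClifford, ← tsum_mul_left]
      refine tsum_congr fun k => ?_
      rw [besselCoeff_succ_mul (by positivity), show ν + 1 + 1 = ν + 2 by ring]; ring
    · rw [← summable_nat_add_iff 1]
      refine (h2.mul_left z).congr fun k => ?_
      rw [besselCoeff_succ_mul (by positivity), show ν + 1 + 1 = ν + 2 by ring]; ring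
  have s2 : Summable fun k : ℕ => -(besselCoeff (ν + 1) k * k * z ^ k) := by
    rw [← summable_nat_add_iff 1]
    refine (h2.mul_left z).congr fun k => ?_
    rw [besselCoeff_succ_mul (by positivity), show ν + 1 + 1 = ν + 2 by ring]; ring
  rw [e2, besselClifford, besselClifford, ← tsum_mul_left, ← h0.tsum_sub (h1.mul_left _),
    ← (h0.sub (h1.mul_left _)).tsum_add s2]
  convert tsum_zero with k
  have g1 := gamma_shift_pos hν k
  have g4 := gamma_shift_pos hν (k + 1)
  have g5 : ν + 1 + k + 1 = ν + (k + 1 : ℕ) + 1 := by push_cast; ring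
  rw [besselCoeff, besselCoeff, g5, gamma_shift_succ hν]
  field_simp
  ring

/-! ### The normalized Bessel functions -/

/-- `√(π r / 2) J_ν(r)`. -/
def besselWave (ν r : ℝ) : ℝ :=
  √Real.pi * (r / 2) ^ (ν + 1 / 2) * besselClifford ν (r ^ 2 / 4)

/-- The derivative of `besselWave ν` on the positive half line. -/
def besselWaveDeriv (ν r : ℝ) : ℝ := (ν + 1 / 2) / r * besselWave ν r - besselWave (ν + 1) r

lemma hasDerivAt_besselWave {ν r : ℝ} (hν : 0 ≤ ν) (hr : 0 < r) :
    HasDerivAt (besselWave ν) (besselWaveDeriv ν r) r := by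
  have h1 : HasDerivAt (fun r : ℝ => (r / 2) ^ (ν + 1 / 2))
      (1 / 2 * (ν + 1 / 2) * (r / 2) ^ (ν + 1 / 2 - 1)) r :=
    ((hasDerivAt_id r).div_const 2).rpow_const (Or.inl (by simp; positivity))
  have h2 : HasDerivAt (fun r : ℝ => r ^ 2 / 4) (2 * r / 4) r := by
    simpa using ((hasDerivAt_pow 2 r).div_const 4)
  have h3 := (hasDerivAt_besselClifford hν (r ^ 2 / 4)).comp r h2
  refine ((h1.const_mul √Real.pi).mul h3).congr_deriv ?_
  rw [besselWaveDeriv, besselWave, besselWave, Function.comp_apply,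
    show ν + 1 + 1 / 2 = ν + 1 / 2 + 1 by ring, Real.rpow_sub_one (by positivity),
    Real.rpow_add_one (by positivity)]
  field_simp
  ring

lemma besselWave_add_two {ν r : ℝ} (hν : 0 ≤ ν) (hr : 0 < r) :
    besselWave (ν + 2) r = (2 * ν + 2) / r * besselWave (ν + 1) r - besselWave ν r := by
  have h := besselClifford_recurrence hν (r ^ 2 / 4)
  have h' : besselClifford ν (r ^ 2 / 4) = (ν + 1) * besselClifford (ν + 1) (r ^ 2 / 4)
    - r ^ 2 / 4 * besselClifford (ν + 2) (r ^ 2 / 4) := by linarith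
  rw [besselWave, besselWave, besselWave, h', show ν + 1 + 1 / 2 = ν + 1 / 2 + 1 by ring,
    show ν + 2 + 1 / 2 = ν + 1 / 2 + 1 + 1 by ring,
    Real.rpow_add_one (by positivity), Real.rpow_add_one (by positivity)]
  field_simp
  ring

lemma besselWaveDeriv_add_one {ν r : ℝ} (hν : 0 ≤ ν) (hr : 0 < r) :
    besselWaveDeriv (ν + 1) r = besselWave ν r - (ν + 1 / 2) / r * besselWave (ν + 1) r := by
  rw [besselWaveDeriv, show ν + 1 + 1 = ν + 2 by ring, besselWave_add_two hν hr]
  field_simp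
  ring

/-- Composing the first-order relations that raise and lower the order gives Bessel's equation; the
factor `√r` in the normalization has removed its first-order term. -/
lemma hasDerivAt_besselWaveDeriv {ν r : ℝ} (hν : 0 ≤ ν) (hr : 0 < r) :
    HasDerivAt (besselWaveDeriv ν) (((ν ^ 2 - 1 / 4) / r ^ 2 - 1) * besselWave ν r) r := by
  have h0 : HasDerivAt (fun r : ℝ => (ν + 1 / 2) / r) (-(ν + 1 / 2) / r ^ 2) r := by
    refine ((hasDerivAt_inv hr.ne').const_mul (ν + 1 / 2)).congr_deriv ?_
    ring
  refine ((h0.mul (hasDerivAt_besselWave hν hr)).sub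
    (hasDerivAt_besselWave (ν := ν + 1) (by positivity) hr)).congr_deriv ?_
  rw [besselWaveDeriv_add_one hν hr, besselWaveDeriv]
  field_simp
  ring

/-- The phase of `besselWave ν` at infinity. -/
def besselPhase (ν : ℝ) : ℝ := ν * Real.pi / 2 + Real.pi / 4

/-- `besselWave ν` is asymptotic to a cosine at infinity, together with its derivative. -/
def BesselAsymptotic (ν : ℝ) : Prop :=
  Tendsto (fun r => besselWave ν r - Real.cos (r - besselPhase ν)) atTop (𝓝 0) ∧
  Tendsto (fun r => besselWaveDeriv ν r + Real.sin (r - besselPhase ν)) atTop (𝓝 0)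

lemma tendsto_const_div_mul_of_bounded {w : ℝ → ℝ} {φ : ℝ}
    (h : Tendsto (fun r => w r - Real.cos (r - φ)) atTop (𝓝 0)) (c : ℝ) :
    Tendsto (fun r => c / r * w r) atTop (𝓝 0) := by
  have h1 : Tendsto (fun r : ℝ => c / r) atTop (𝓝 0) := tendsto_const_nhds.div_atTop tendsto_id
  have h2 : Tendsto (fun r : ℝ => c / r * Real.cos (r - φ)) atTop (𝓝 0) :=
    h1.zero_mul_isBoundedUnder_le (isBoundedUnder_of ⟨1, fun r => Real.abs_cos_le_one _⟩)
  have := (h1.mul h).add h2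
  simp only [mul_zero, add_zero] at this
  refine this.congr fun r => by ring

/-- Up to terms of size `1/r`, the ladder relations read `w_{ν+1} ≈ -w_ν'` and `w_{ν+1}' ≈ w_ν`,
which is a phase shift by `π/2`. Only one base case is needed for each class of orders modulo `1`.
-/
lemma BesselAsymptotic.add_one {ν : ℝ} (hν : 0 ≤ ν) (h : BesselAsymptotic ν) :
    BesselAsymptotic (ν + 1) := by
  have hph : besselPhase (ν + 1) = besselPhase ν + Real.pi / 2 := by
    simp only [besselPhase]; ring
  have hc : ∀ r, Real.cos (r - besselPhase (ν + 1)) = Real.sin (r - besselPhase ν) := fun r => by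
    rw [hph, ← sub_sub, Real.cos_sub_pi_div_two]
  have hs : ∀ r, Real.sin (r - besselPhase (ν + 1)) = -Real.cos (r - besselPhase ν) := fun r => by
    rw [hph, ← sub_sub, Real.sin_sub_pi_div_two]
  have A : Tendsto (fun r => besselWave (ν + 1) r - Real.cos (r - besselPhase (ν + 1)))
      atTop (𝓝 0) := by
    have h1 := (tendsto_const_div_mul_of_bounded h.1 (ν + 1 / 2)).sub h.2
    simp only [sub_zero] at h1
    refine h1.congr fun r => ?_
    rw [hc, besselWaveDeriv]; ring
  refine ⟨A, ?_⟩
  have h1 := h.1.sub (tendsto_const_div_mul_of_bounded A (ν + 1 / 2))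
  simp only [sub_zero] at h1
  refine h1.congr' ?_
  filter_upwards [eventually_gt_atTop 0] with r hr
  rw [hs, besselWaveDeriv_add_one hν hr]; ring

end

noncomputable section

/-! ### The Fresnel integral -/

lemma norm_cexp_neg_mul_sq_le {b : ℂ} (hb : 0 ≤ b.re) (x : ℝ) :
    ‖Complex.exp (-b * (x : ℂ) ^ 2)‖ ≤ 1 := by
  rw [Complex.norm_exp, Real.exp_le_one_iff]
  have : (-b * (x : ℂ) ^ 2).re = -(b.re * x ^ 2) := by
    rw [← Complex.ofReal_pow, Complex.re_mul_ofReal, Complex.neg_re]; ring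
  rw [this]
  have := mul_nonneg hb (sq_nonneg x)
  linarith

/-- Integration by parts against `1/x` uses the oscillation, so the bound does not degenerate as `b`
approaches the imaginary axis. -/
lemma norm_integral_cexp_neg_mul_sq_le {b : ℂ} (hb : 0 ≤ b.re) (hb0 : b ≠ 0) {S T : ℝ}
    (hS : 0 < S) (hST : S ≤ T) :
    ‖∫ x in S..T, Complex.exp (-b * (x : ℂ) ^ 2)‖ ≤ 1 / (‖b‖ * S) := by
  set f : ℝ → ℂ := fun x => Complex.exp (-b * (x : ℂ) ^ 2) with hf
  have hT : 0 < T := hS.trans_le hST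
  have hnb : 0 < ‖b‖ := norm_pos_iff.2 hb0
  have hpos : ∀ x ∈ Set.uIcc S T, 0 < x := fun x hx => by
    rw [Set.uIcc_of_le hST] at hx; exact hS.trans_le hx.1
  have hfc : Continuous f := by rw [hf]; fun_prop
  have hder : ∀ x ∈ Set.uIcc S T, HasDerivAt (fun x : ℝ => -(1 / (2 * b)) * ((x : ℂ)⁻¹ * f x))
      (f x + 1 / (2 * b) * (((x : ℂ) ^ 2)⁻¹ * f x)) x := by
    intro x hx
    have hx0 : (x : ℂ) ≠ 0 := by exact_mod_cast (hpos x hx).ne'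
    have h1 : HasDerivAt f (f x * (-b * (2 * x))) x := by
      have h := ((hasDerivAt_id (x : ℂ)).pow 2).const_mul (-b)
      have h2 := (h.cexp).comp_ofReal
      refine h2.congr_deriv ?_
      simp [hf]
    have h2 : HasDerivAt (fun x : ℝ => (x : ℂ)⁻¹) (-((x : ℂ) ^ 2)⁻¹) x :=
      (hasDerivAt_inv hx0).comp_ofReal
    refine ((h2.mul h1).const_mul _).congr_deriv ?_
    field_simp
    ring
  have hcinv : ContinuousOn (fun x : ℝ => ((x : ℂ) ^ 2)⁻¹ * f x) (Set.uIcc S T) := by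
    refine ContinuousOn.mul (ContinuousOn.inv₀ (by fun_prop) fun x hx => ?_) hfc.continuousOn
    have := (hpos x hx).ne'
    exact pow_ne_zero 2 (by exact_mod_cast this)
  have hint1 : IntervalIntegrable f volume S T := hfc.intervalIntegrable _ _
  have hint2 : IntervalIntegrable (fun x : ℝ => 1 / (2 * b) * (((x : ℂ) ^ 2)⁻¹ * f x))
      volume S T := (hcinv.intervalIntegrable).const_mul _
  have hFTC := intervalIntegral.integral_eq_sub_of_hasDerivAt hder (hint1.add hint2)
  rw [intervalIntegral.integral_add hint1 hint2] at hFTC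
  have hreal : ∫ x in S..T, 1 / (2 * ‖b‖) * (x ^ 2)⁻¹ = 1 / (2 * ‖b‖) * (S⁻¹ - T⁻¹) := by
    rw [intervalIntegral.integral_eq_sub_of_hasDerivAt
      (f := fun x => 1 / (2 * ‖b‖) * (-x⁻¹)) (fun x hx => ?_)]
    · ring
    · refine (ContinuousOn.intervalIntegrable ?_)
      refine ContinuousOn.mul continuousOn_const (ContinuousOn.inv₀ (by fun_prop) fun x hx => ?_)
      exact pow_ne_zero 2 (hpos x hx).ne'
    · have := ((hasDerivAt_inv (hpos x hx).ne').neg).const_mul (1 / (2 * ‖b‖))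
      simpa using this
  have hb2 : ‖∫ x in S..T, 1 / (2 * b) * (((x : ℂ) ^ 2)⁻¹ * f x)‖
      ≤ 1 / (2 * ‖b‖) * (S⁻¹ - T⁻¹) := by
    rw [← hreal]
    refine intervalIntegral.norm_integral_le_of_norm_le hST (ae_of_all _ fun x hx => ?_) ?_
    · have hx0 : 0 < x := hS.trans hx.1
      rw [norm_mul, norm_mul, norm_inv, norm_pow, norm_div, norm_mul, Complex.norm_real,
        Real.norm_of_nonneg hx0.le, norm_one, Complex.norm_two]
      have := norm_cexp_neg_mul_sq_le hb x
      calc 1 / (2 * ‖b‖) * ((x ^ 2)⁻¹ * ‖f x‖) ≤ 1 / (2 * ‖b‖) * ((x ^ 2)⁻¹ * 1) := by gcongr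
        _ = _ := by ring
    · refine (ContinuousOn.intervalIntegrable ?_)
      refine ContinuousOn.mul continuousOn_const (ContinuousOn.inv₀ (by fun_prop) fun x hx => ?_)
      exact pow_ne_zero 2 (hpos x hx).ne'
  have hG : ∀ x : ℝ, 0 < x → ‖-(1 / (2 * b)) * ((x : ℂ)⁻¹ * f x)‖ ≤ 1 / (2 * ‖b‖) * x⁻¹ := by
    intro x hx
    rw [norm_mul, norm_mul, norm_neg, norm_inv, norm_div, norm_mul, Complex.norm_real,
      Real.norm_of_nonneg hx.le, norm_one, Complex.norm_two]
    have := norm_cexp_neg_mul_sq_le hb x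
    calc 1 / (2 * ‖b‖) * (x⁻¹ * ‖f x‖) ≤ 1 / (2 * ‖b‖) * (x⁻¹ * 1) := by gcongr
      _ = _ := by ring
  have hkey := eq_sub_of_add_eq hFTC
  rw [hkey]
  -- The boundary term at `T` cancels against the `-T⁻¹` of the integral bound, so the result does
  -- not depend on `T`.
  refine (norm_sub_le _ _).trans ((add_le_add ((norm_sub_le _ _).trans
    (add_le_add (hG T hT) (hG S hS))) hb2).trans (le_of_eq ?_))
  field_simp
  ring

lemma norm_integral_cexp_neg_mul_sq_sub_le {b : ℂ} (hb : 0 < b.re) {S : ℝ} (hS : 0 < S) :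
    ‖(∫ x in (0 : ℝ)..S, Complex.exp (-b * (x : ℂ) ^ 2)) - (Real.pi / b) ^ (1 / 2 : ℂ) / 2‖
      ≤ 1 / (‖b‖ * S) := by
  have hb0 : b ≠ 0 := by rintro rfl; simp at hb
  have hc : Continuous fun x : ℝ => Complex.exp (-b * (x : ℂ) ^ 2) := by fun_prop
  have h := intervalIntegral_tendsto_integral_Ioi 0
    (integrable_cexp_neg_mul_sq hb).integrableOn tendsto_id
  rw [integral_gaussian_complex_Ioi hb] at h
  have h2 := (h.const_sub (∫ x in (0 : ℝ)..S, Complex.exp (-b * (x : ℂ) ^ 2))).norm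
  refine le_of_tendsto h2 ?_
  filter_upwards [eventually_ge_atTop S] with T hT
  rw [id, norm_sub_rev, intervalIntegral.integral_interval_sub_left
    (hc.intervalIntegrable _ _) (hc.intervalIntegrable _ _)]
  exact norm_integral_cexp_neg_mul_sq_le hb.le hb0 hS hT

lemma pi_div_I_cpow_half : ((Real.pi : ℂ) / Complex.I) ^ (1 / 2 : ℂ)
    = √Real.pi * Complex.exp (-(Real.pi / 4 : ℝ) * Complex.I) := by
  have hp := Real.pi_pos
  rw [show (Real.pi : ℂ) / Complex.I = (Real.pi : ℂ) * -Complex.I by simp [div_eq_mul_inv],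
    Complex.cpow_def_of_ne_zero (by simp [hp.ne']), Complex.log_ofReal_mul hp (by simp),
    Complex.log_neg_I, Real.sqrt_eq_rpow, Real.rpow_def_of_pos hp, Complex.ofReal_exp,
    ← Complex.exp_add]
  congr 1
  push_cast
  ring

/-- The Gaussian integral is explicit for `b = ε + i` with `ε > 0`. Its truncation error at `S` is
at most `1/S` uniformly in `ε`, so `ε → 0` may be taken at fixed `S`, before `S → ∞`. -/
lemma tendsto_fresnel :
    Tendsto (fun S : ℝ => ∫ x in (0 : ℝ)..S, Complex.exp (-Complex.I * (x : ℂ) ^ 2)) atTop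
      (𝓝 (√Real.pi * Complex.exp (-(Real.pi / 4 : ℝ) * Complex.I) / 2)) := by
  rw [← pi_div_I_cpow_half]
  refine tendsto_iff_norm_sub_tendsto_zero.2 ?_
  have hinv : Tendsto (fun S : ℝ => 1 / S) atTop (𝓝 0) := tendsto_const_nhds.div_atTop tendsto_id
  refine squeeze_zero' (Eventually.of_forall fun _ => norm_nonneg _) ?_ hinv
  filter_upwards [eventually_gt_atTop 0] with S hS
  have hb : Tendsto (fun ε : ℝ => (ε : ℂ) + Complex.I) (𝓝[>] 0) (𝓝 Complex.I) := by
    have : Continuous fun ε : ℝ => (ε : ℂ) + Complex.I := by fun_prop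
    simpa using (this.tendsto 0).mono_left nhdsWithin_le_nhds
  have h1 : Continuous fun b : ℂ => ∫ x in (0 : ℝ)..S, Complex.exp (-b * (x : ℂ) ^ 2) :=
    intervalIntegral.continuous_parametric_intervalIntegral_of_continuous' (by fun_prop) _ _
  have h2 : ContinuousAt (fun b : ℂ => ((Real.pi : ℂ) / b) ^ (1 / 2 : ℂ) / 2) Complex.I := by
    refine ContinuousAt.div_const (ContinuousAt.cpow ?_ continuousAt_const ?_) _
    · exact continuousAt_const.div continuousAt_id Complex.I_ne_zero
    · right; simp [Complex.div_I, Real.pi_ne_zero]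
  have hL := (((h1.tendsto Complex.I).sub h2.tendsto).norm).comp hb
  refine le_of_tendsto hL ?_
  filter_upwards [self_mem_nhdsWithin] with ε hε
  have hε : (0 : ℝ) < ε := hε
  refine (norm_integral_cexp_neg_mul_sq_sub_le (b := ε + Complex.I) (by simpa using hε) hS).trans ?_
  have : 1 ≤ ‖(ε : ℂ) + Complex.I‖ := by
    have := Complex.abs_im_le_norm ((ε : ℂ) + Complex.I)
    simpa using this
  gcongr
  nlinarith

/-! ### The Bessel functions of order `1/2` -/

/-- The duplication formula for `Γ` at half-integers, by induction on `k`; it produces the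
coefficients of the sine series. -/
lemma besselCoeff_half (k : ℕ) :
    besselCoeff (1 / 2) k = (-1) ^ k * 2 ^ (2 * k + 1) / (√Real.pi * (2 * k + 1).factorial) := by
  have h : ∀ k : ℕ, (k.factorial : ℝ) * Real.Gamma (1 / 2 + k + 1) * 2 ^ (2 * k + 1)
      = √Real.pi * (2 * k + 1).factorial := by
    intro k
    induction k with
    | zero =>
      have := Real.Gamma_add_one (s := 1 / 2) (by norm_num)
      rw [Real.Gamma_one_half_eq] at this
      simp only [Nat.factorial_zero, Nat.cast_one, CharP.cast_eq_zero, add_zero, this]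
      norm_num
      ring
    | succ k ih =>
      rw [gamma_shift_succ (by norm_num), show 2 * (k + 1) + 1 = 2 * k + 1 + 1 + 1 by ring,
        Nat.factorial_succ, Nat.factorial_succ (2 * k + 1 + 1), Nat.factorial_succ (2 * k + 1),
        pow_succ, pow_succ]
      push_cast
      linear_combination (2 * (k : ℝ) + 2) * (2 * k + 3) * ih
  have hg := gamma_shift_pos (ν := 1 / 2) (by norm_num) k
  have h3 : (0 : ℝ) < k.factorial := by positivity
  have hp := Real.pi_pos
  rw [besselCoeff, div_eq_div_iff (by positivity) (by positivity), ← h]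
  ring

lemma besselWave_half {r : ℝ} (hr : 0 < r) : besselWave (1 / 2) r = Real.sin r := by
  have h := Real.hasSum_sin r
  rw [← h.tsum_eq, besselWave, besselClifford, ← tsum_mul_left]
  refine tsum_congr fun k => ?_
  have hp := Real.pi_pos
  have hs := Real.sqrt_pos.2 hp
  rw [besselCoeff_half, show (1 / 2 + 1 / 2 : ℝ) = 1 by norm_num, Real.rpow_one, div_pow, ← pow_mul,
    show (4 : ℝ) = 2 ^ 2 by norm_num, ← pow_mul, pow_succ, pow_succ r]
  field_simp

lemma besselAsymptotic_half : BesselAsymptotic (1 / 2) := by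
  have hph : besselPhase (1 / 2) = Real.pi / 2 := by rw [besselPhase]; ring
  constructor
  · refine tendsto_const_nhds.congr' ?_
    filter_upwards [eventually_gt_atTop 0] with r hr
    rw [besselWave_half hr, hph, Real.cos_sub_pi_div_two, sub_self]
  · refine tendsto_const_nhds.congr' ?_
    filter_upwards [eventually_gt_atTop 0] with r hr
    have h1 := hasDerivAt_besselWave (ν := 1 / 2) (by norm_num) hr
    have h2 : besselWave (1 / 2) =ᶠ[𝓝 r] Real.sin := by
      filter_upwards [lt_mem_nhds hr] with x hx using besselWave_half hx
    rw [(h1.congr_of_eventuallyEq h2.symm).unique (Real.hasDerivAt_sin r), hph,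
      Real.sin_sub_pi_div_two, add_neg_cancel]

end

noncomputable section

/-! ### The Bessel function of order `0` -/

/-- Wallis' integrals match the power series of `π J₀(r)` with the termwise integral of the Taylor
series of `cos (r sin t)`. -/
lemma besselCoeff_zero (k : ℕ) : besselCoeff 0 k * (1 / 4) ^ k * Real.pi
    = (-1) ^ k / (2 * k).factorial * ∫ x in (0 : ℝ)..Real.pi, Real.sin x ^ (2 * k) := by
  have h : ∀ k : ℕ, ((2 * k).factorial : ℝ)
      = 4 ^ k * k.factorial * k.factorial
        * ∏ i ∈ Finset.range k, (2 * (i : ℝ) + 1) / (2 * i + 2) := by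
    intro k
    induction k with
    | zero => simp
    | succ k ih =>
      rw [show 2 * (k + 1) = 2 * k + 1 + 1 by ring, Nat.factorial_succ, Nat.factorial_succ,
        Finset.prod_range_succ, Nat.factorial_succ k]
      push_cast
      rw [ih, pow_succ]
      field_simp
      ring
  have hpos : (0 : ℝ) < (2 * k).factorial := by positivity
  have h3 : (0 : ℝ) < k.factorial := by positivity
  rw [integral_sin_pow_even, besselCoeff, zero_add, Real.Gamma_nat_eq_factorial, one_div_pow,
    div_mul_eq_mul_div, div_mul_eq_mul_div, div_mul_eq_mul_div, div_eq_div_iff (by positivity)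
    (by positivity)]
  rw [h k]
  field_simp

lemma pi_mul_besselClifford_zero (r : ℝ) : Real.pi * besselClifford 0 (r ^ 2 / 4)
    = ∫ t in (0 : ℝ)..Real.pi, Real.cos (r * Real.sin t) := by
  have hsum := intervalIntegral.hasSum_integral_of_dominated_convergence
    (μ := volume) (a := 0) (b := Real.pi)
    (F := fun (k : ℕ) (t : ℝ) => (-1) ^ k * (r * Real.sin t) ^ (2 * k) / (2 * k).factorial)
    (f := fun t => Real.cos (r * Real.sin t))
    (fun k _ => |r| ^ (2 * k) / (2 * k).factorial)
    (fun k => (by fun_prop : Continuous _).aestronglyMeasurable)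
    (fun k => ae_of_all _ fun t _ => ?_) (ae_of_all _ fun t _ => ?_) ?_
    (ae_of_all _ fun t _ => Real.hasSum_cos _)
  · rw [← hsum.tsum_eq, besselClifford, ← tsum_mul_left]
    refine tsum_congr fun k => ?_
    have := besselCoeff_zero k
    simp_rw [mul_pow, mul_div_assoc, ← mul_assoc]
    have e : ∀ t : ℝ, (-1 : ℝ) ^ k * r ^ (2 * k) * (Real.sin t ^ (2 * k) / (2 * k).factorial)
      = r ^ (2 * k) * ((-1) ^ k / (2 * k).factorial) * Real.sin t ^ (2 * k) := fun t => by ring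
    simp_rw [e, intervalIntegral.integral_const_mul]
    rw [mul_assoc (r ^ (2 * k)), ← this, div_eq_mul_one_div, mul_pow, ← pow_mul]
    ring
  · rw [norm_div, norm_mul, norm_pow, norm_neg, norm_one, one_pow, one_mul, norm_pow, norm_mul,
      Real.norm_eq_abs, Real.norm_eq_abs, Real.norm_of_nonneg (by positivity : (0 : ℝ) ≤ (2 * k).factorial)]
    gcongr
    exact mul_le_of_le_one_right (abs_nonneg _) (Real.abs_sin_le_one t)
  · exact (Real.summable_pow_div_factorial |r|).comp_injective
      (mul_right_injective₀ two_ne_zero)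
  · exact intervalIntegrable_const

/-- On `[0, π/2]` the phase `r cos t` has a single critical point, at the endpoint `t = 0`. -/
lemma pi_mul_besselClifford_zero' (r : ℝ) : Real.pi * besselClifford 0 (r ^ 2 / 4)
    = 2 * ∫ t in (0 : ℝ)..Real.pi / 2, Real.cos (r * Real.cos t) := by
  have hc : Continuous fun t : ℝ => Real.cos (r * Real.cos t) := by fun_prop
  rw [pi_mul_besselClifford_zero]
  have h1 : ∫ t in (0 : ℝ)..Real.pi, Real.cos (r * Real.sin t)
      = ∫ t in -(Real.pi / 2)..Real.pi / 2, Real.cos (r * Real.cos t) := by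
    have := intervalIntegral.integral_comp_sub_left (a := 0) (b := Real.pi)
      (fun t : ℝ => Real.cos (r * Real.cos t)) (Real.pi / 2)
    simp only [Real.cos_pi_div_two_sub] at this
    rw [this]; congr 1 <;> ring
  have h2 : ∫ t in -(Real.pi / 2)..0, Real.cos (r * Real.cos t)
      = ∫ t in (0 : ℝ)..Real.pi / 2, Real.cos (r * Real.cos t) := by
    have := intervalIntegral.integral_comp_neg (a := -(Real.pi / 2)) (b := 0)
      (fun t : ℝ => Real.cos (r * Real.cos t))
    simp only [Real.cos_neg, neg_zero, neg_neg] at this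
    exact this
  rw [h1, ← intervalIntegral.integral_add_adjacent_intervals (b := 0)
    (hc.intervalIntegrable _ _) (hc.intervalIntegrable _ _), h2]
  ring

/-- The phase factor of the integral representation of `J_0`. -/
def phaseFactor (r t : ℝ) : ℂ := Complex.exp (-(2 * r : ℝ) * Complex.I * (Real.sin (t / 2) : ℂ) ^ 2)

lemma norm_phaseFactor (r t : ℝ) : ‖phaseFactor r t‖ = 1 := by
  rw [phaseFactor, show -((2 * r : ℝ) : ℂ) * Complex.I * (Real.sin (t / 2) : ℂ) ^ 2
    = ((-(2 * r) * Real.sin (t / 2) ^ 2 : ℝ) : ℂ) * Complex.I by push_cast; ring,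
    Complex.norm_exp_ofReal_mul_I]

lemma continuous_phaseFactor (r : ℝ) : Continuous (phaseFactor r) := by
  unfold phaseFactor; fun_prop

lemma hasDerivAt_phaseFactor (r t : ℝ) : HasDerivAt (phaseFactor r)
    (-(2 * r : ℝ) * Complex.I * (Real.sin (t / 2) * Real.cos (t / 2) : ℝ) * phaseFactor r t) t := by
  have h1 : HasDerivAt (fun t : ℝ => Real.sin (t / 2) ^ 2)
      (Real.sin (t / 2) * Real.cos (t / 2)) t := by
    refine ((((hasDerivAt_id t).div_const 2).sin).pow 2).congr_deriv ?_
    simp only [id]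
    ring
  have h2 := (h1.ofReal_comp.const_mul (-((2 * r : ℝ) : ℂ) * Complex.I)).cexp
  unfold phaseFactor
  simp only [Complex.ofReal_pow] at h2
  refine h2.congr_deriv ?_
  ring

lemma cos_mul_cos_eq (r t : ℝ) :
    Real.cos (r * Real.cos t) = (Complex.exp (r * Complex.I) * phaseFactor r t).re := by
  rw [phaseFactor, ← Complex.exp_add, ← Complex.exp_ofReal_mul_I_re]
  congr 2
  have : Real.cos t = 1 - 2 * Real.sin (t / 2) ^ 2 := by
    rw [← Real.cos_two_mul_eq_one_sub, mul_div_cancel₀ t two_ne_zero]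
  rw [this]; push_cast; ring

lemma sqrt_two_mul_mul_sqrt_two_div {r : ℝ} (hr : 0 < r) : √(2 * r) * √(2 / r) = 2 := by
  rw [← Real.sqrt_mul (by positivity), show 2 * r * (2 / r) = 2 ^ 2 by field_simp,
    Real.sqrt_sq (by norm_num)]

/-- The weight `cos (t/2)` is, up to a constant, the Jacobian of `x = √(2r) sin (t/2)`, so this part
of the integral is exactly a truncated Fresnel integral; `t = π/2` corresponds to `x = √r`. -/
lemma integral_phaseFactor_mul_cos {r : ℝ} (hr : 0 < r) :
    ∫ t in (0 : ℝ)..Real.pi / 2, phaseFactor r t * (Real.cos (t / 2) : ℂ)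
      = √(2 / r) * ∫ x in (0 : ℝ)..√r, Complex.exp (-Complex.I * (x : ℂ) ^ 2) := by
  have h := intervalIntegral.integral_deriv_smul_comp (a := 0) (b := Real.pi / 2)
    (f := fun t => √(2 * r) * Real.sin (t / 2)) (f' := fun t => √(2 * r) * (Real.cos (t / 2) / 2))
    (g := fun x : ℝ => Complex.exp (-Complex.I * (x : ℂ) ^ 2)) (fun t _ => ?_)
    (by fun_prop) (by fun_prop)
  · have e1 : √(2 * r) * Real.sin (Real.pi / 2 / 2) = √r := by
      rw [show Real.pi / 2 / 2 = Real.pi / 4 by ring, Real.sin_pi_div_four, Real.sqrt_mul (by norm_num)]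
      linear_combination √r / 2 * Real.mul_self_sqrt (show (0 : ℝ) ≤ 2 by norm_num)
    simp only [e1, zero_div, Real.sin_zero, mul_zero] at h
    rw [← h, ← intervalIntegral.integral_const_mul]
    congr 1
    ext t
    have e2 : ((√(2 * r) * Real.sin (t / 2) : ℝ) : ℂ) ^ 2 = (2 * r * Real.sin (t / 2) ^ 2 : ℝ) := by
      rw [← Complex.ofReal_pow, mul_pow, Real.sq_sqrt (by positivity)]
    have e3 : ((√(2 * r) : ℝ) : ℂ) * (√(2 / r) : ℝ) = 2 := by
      exact_mod_cast sqrt_two_mul_mul_sqrt_two_div hr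
    rw [Function.comp_apply, e2, phaseFactor, Complex.real_smul]
    push_cast
    rw [show -Complex.I * (2 * (r : ℂ) * Complex.sin (t / 2) ^ 2)
      = -(2 * r) * Complex.I * Complex.sin (t / 2) ^ 2 by ring]
    linear_combination (-Complex.cos (t / 2) / 2 *
      Complex.exp (-(2 * r) * Complex.I * Complex.sin (t / 2) ^ 2)) * e3
  · refine (((hasDerivAt_id t).div_const 2).sin.const_mul √(2 * r)).congr_deriv ?_
    simp only [id]
    ring

/-- `(1 - cos (t/2)) / (sin (t/2) cos (t/2))`. -/
def phaseQuotient (t : ℝ) : ℝ := Real.sin (t / 4) / (Real.cos (t / 4) * Real.cos (t / 2))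

/-- The derivative of `phaseQuotient`. -/
def phaseQuotientDeriv (t : ℝ) : ℝ :=
  (Real.cos (t / 4) / 4 * (Real.cos (t / 4) * Real.cos (t / 2)) - Real.sin (t / 4) *
    (-Real.sin (t / 4) / 4 * Real.cos (t / 2) + Real.cos (t / 4) * (-Real.sin (t / 2) / 2)))
    / (Real.cos (t / 4) * Real.cos (t / 2)) ^ 2

lemma phase_cos_pos {t : ℝ} (ht : t ∈ Set.uIcc 0 (Real.pi / 2)) :
    0 < Real.cos (t / 4) ∧ 0 < Real.cos (t / 2) := by
  have hp := Real.pi_pos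
  rw [Set.uIcc_of_le (by positivity)] at ht
  constructor <;> apply Real.cos_pos_of_mem_Ioo <;> constructor <;> linarith [ht.1, ht.2]

lemma hasDerivAt_phaseQuotient {t : ℝ} (ht : t ∈ Set.uIcc 0 (Real.pi / 2)) :
    HasDerivAt phaseQuotient (phaseQuotientDeriv t) t := by
  obtain ⟨h1, h2⟩ := phase_cos_pos ht
  have a1 := (Real.hasDerivAt_sin (t / 4)).comp t ((hasDerivAt_id t).div_const 4)
  have a2 := (Real.hasDerivAt_cos (t / 4)).comp t ((hasDerivAt_id t).div_const 4)
  have a3 := (Real.hasDerivAt_cos (t / 2)).comp t ((hasDerivAt_id t).div_const 2)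
  refine (a1.div (a2.mul a3) (by simp; exact ⟨h1.ne', h2.ne'⟩)).congr_deriv ?_
  simp only [Function.comp_apply, id, phaseQuotientDeriv, Pi.mul_apply]
  ring

lemma continuousOn_phaseQuotientDeriv :
    ContinuousOn phaseQuotientDeriv (Set.uIcc 0 (Real.pi / 2)) := by
  unfold phaseQuotientDeriv
  refine ContinuousOn.div (by fun_prop) (by fun_prop) fun t ht => ?_
  obtain ⟨h1, h2⟩ := phase_cos_pos ht
  positivity

/-- The weight vanishes at the critical point `t = 0`. Its quotient by the derivative of the phase
is therefore regular up to that point, and one integration by parts gains `1/r`. -/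
lemma exists_norm_integral_phaseFactor_le : ∃ C : ℝ, ∀ r : ℝ, 0 < r →
    ‖∫ t in (0 : ℝ)..Real.pi / 2, phaseFactor r t * (1 - Real.cos (t / 2) : ℂ)‖ ≤ C / r := by
  refine ⟨(|phaseQuotient (Real.pi / 2)| +
    ∫ t in (0 : ℝ)..Real.pi / 2, |phaseQuotientDeriv t|) / 2, fun r hr => ?_⟩
  have hp : 0 ≤ Real.pi / 2 := by positivity
  have hcd : Continuous fun t : ℝ => -(2 * r : ℝ) * Complex.I *
      (Real.sin (t / 2) * Real.cos (t / 2) : ℝ) * phaseFactor r t := by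
    have := continuous_phaseFactor r
    fun_prop
  have h := intervalIntegral.integral_mul_deriv_eq_deriv_mul
    (u := fun t => (phaseQuotient t : ℂ)) (u' := fun t => (phaseQuotientDeriv t : ℂ))
    (a := 0) (b := Real.pi / 2)
    (fun t ht => (hasDerivAt_phaseQuotient ht).ofReal_comp)
    (fun t _ => hasDerivAt_phaseFactor r t)
    ((Complex.continuous_ofReal.comp_continuousOn
      continuousOn_phaseQuotientDeriv).intervalIntegrable)
    (hcd.intervalIntegrable _ _)
  have e : ∀ t ∈ Set.uIcc 0 (Real.pi / 2), (phaseQuotient t : ℂ) * (-(2 * r : ℝ) * Complex.I *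
      (Real.sin (t / 2) * Real.cos (t / 2) : ℝ) * phaseFactor r t) =
      -(2 * r : ℝ) * Complex.I * (phaseFactor r t * (1 - Real.cos (t / 2) : ℂ)) := by
    intro t ht
    obtain ⟨h1, h2⟩ := phase_cos_pos ht
    have h3 : phaseQuotient t * (Real.sin (t / 2) * Real.cos (t / 2)) = 1 - Real.cos (t / 2) := by
      have q : t / 2 = 2 * (t / 4) := by ring
      rw [phaseQuotient, div_mul_eq_mul_div, div_eq_iff (by positivity), q, Real.sin_two_mul,
        Real.cos_two_mul]
      have := Real.sin_sq_add_cos_sq (t / 4)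
      have : Real.sin (t / 4) ^ 2 = 1 - Real.cos (t / 4) ^ 2 := by linarith
      linear_combination (2 * Real.cos (t / 4) * (2 * Real.cos (t / 4) ^ 2 - 1)) * this
    rw [show (1 - Real.cos (t / 2) : ℂ) = ((1 - Real.cos (t / 2) : ℝ) : ℂ) by push_cast; ring,
      ← h3]
    push_cast
    ring
  rw [intervalIntegral.integral_congr e, intervalIntegral.integral_const_mul] at h
  have hb : ‖∫ t in (0 : ℝ)..Real.pi / 2, (phaseQuotientDeriv t : ℂ) * phaseFactor r t‖
      ≤ ∫ t in (0 : ℝ)..Real.pi / 2, |phaseQuotientDeriv t| := by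
    refine (intervalIntegral.norm_integral_le_integral_norm hp).trans (le_of_eq ?_)
    simp [norm_phaseFactor]
  have h0 : phaseQuotient 0 = 0 := by simp [phaseQuotient]
  have h4 := congrArg norm h
  rw [norm_mul, norm_mul, norm_neg, Complex.norm_I, Complex.norm_real,
    Real.norm_of_nonneg (by positivity)] at h4
  have h5 : ‖(phaseQuotient (Real.pi / 2) : ℂ) * phaseFactor r (Real.pi / 2)
      - (phaseQuotient 0 : ℂ) * phaseFactor r 0
      - ∫ t in (0 : ℝ)..Real.pi / 2, (phaseQuotientDeriv t : ℂ) * phaseFactor r t‖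
      ≤ |phaseQuotient (Real.pi / 2)| + ∫ t in (0 : ℝ)..Real.pi / 2, |phaseQuotientDeriv t| := by
    refine (norm_sub_le _ _).trans (add_le_add (le_of_eq ?_) hb)
    rw [h0, Complex.ofReal_zero, zero_mul, sub_zero, norm_mul, norm_phaseFactor, mul_one,
      Complex.norm_real, Real.norm_eq_abs]
  rw [← h4] at h5
  rw [div_div, le_div_iff₀ (by positivity)]
  linarith

/-- The mean value theorem on `[r, r+1]` gives a point where `d₁` equals `d (r+1) - d r`; a second
application, to `d₁` on an interval shorter than `1`, moves back to `r` at the cost of a value of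
`d₂`. -/
lemma tendsto_deriv_of_tendsto {d d₁ d₂ : ℝ → ℝ} (h1 : ∀ r, 0 < r → HasDerivAt d (d₁ r) r)
    (h2 : ∀ r, 0 < r → HasDerivAt d₁ (d₂ r) r) (hd : Tendsto d atTop (𝓝 0))
    (hd2 : Tendsto d₂ atTop (𝓝 0)) : Tendsto d₁ atTop (𝓝 0) := by
  rw [Metric.tendsto_atTop] at hd hd2 ⊢
  intro ε hε
  obtain ⟨N1, hN1⟩ := hd (ε / 4) (by positivity)
  obtain ⟨N2, hN2⟩ := hd2 (ε / 4) (by positivity)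
  refine ⟨max 1 (max N1 N2), fun r hr => ?_⟩
  have r1 : (1 : ℝ) ≤ r := (le_max_left _ _).trans hr
  have r2 : N1 ≤ r := (le_max_left _ _).trans ((le_max_right _ _).trans hr)
  have r3 : N2 ≤ r := (le_max_right _ _).trans ((le_max_right _ _).trans hr)
  have hr0 : ∀ x, r ≤ x → 0 < x := fun x hx => by linarith
  obtain ⟨c, hc, hc'⟩ := exists_hasDerivAt_eq_slope d d₁ (lt_add_one r)
    (fun x hx => (h1 x (hr0 x hx.1)).continuousAt.continuousWithinAt)
    (fun x hx => h1 x (hr0 x hx.1.le))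
  obtain ⟨e, he, he'⟩ := exists_hasDerivAt_eq_slope d₁ d₂ hc.1
    (fun x hx => (h2 x (hr0 x hx.1)).continuousAt.continuousWithinAt)
    (fun x hx => h2 x (hr0 x hx.1.le))
  have a1 := hN1 r r2
  have a2 := hN1 (r + 1) (by linarith)
  have a3 := hN2 e (by linarith [he.1])
  have hcr : 0 < c - r := by linarith [hc.1]
  rw [eq_div_iff hcr.ne'] at he'
  rw [show r + 1 - r = 1 by ring, div_one] at hc'
  rw [dist_zero_right, Real.norm_eq_abs] at a1 a2 a3 ⊢
  have e1 : d₁ r = d (r + 1) - d r - d₂ e * (c - r) := by linarith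
  have e2 : |d₂ e * (c - r)| ≤ ε / 4 := by
    rw [abs_mul, abs_of_pos hcr]
    have := hc.2
    nlinarith [abs_nonneg (d₂ e)]
  rw [abs_lt] at *
  rw [abs_le] at e2
  constructor <;> linarith [e2.1, e2.2, a1.1, a1.2, a2.1, a2.2]

/-- The weight `1` is split as `cos (t/2) + (1 - cos (t/2))`. The first part tends to the Fresnel
limit; the second is `O(1/r)`, hence `O(r^{-1/2})` after multiplication by the normalizing factor of
size `√r`. -/
lemma tendsto_besselWave_zero :
    Tendsto (fun r => besselWave 0 r - Real.cos (r - besselPhase 0)) atTop (𝓝 0) := by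
  obtain ⟨C, hC⟩ := exists_norm_integral_phaseFactor_le
  set F : ℝ → ℂ := fun S => ∫ x in (0 : ℝ)..S, Complex.exp (-Complex.I * (x : ℂ) ^ 2) with hF
  set L : ℂ := √Real.pi * Complex.exp (-(Real.pi / 4 : ℝ) * Complex.I) / 2 with hL
  have hp := Real.pi_pos
  have hsp := Real.sqrt_pos.2 hp
  have hFL : Tendsto (fun r : ℝ => 2 / √Real.pi * ‖F √r - L‖ + 2 * C * √r⁻¹) atTop (𝓝 0) := by
    have h1 := (tendsto_iff_norm_sub_tendsto_zero.1 (tendsto_fresnel.comp Real.tendsto_sqrt_atTop))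
    have h2 := tendsto_inv_atTop_zero.sqrt (α := ℝ)
    have h3 := (h1.const_mul (2 / √Real.pi)).add (h2.const_mul (2 * C))
    rw [Real.sqrt_zero, mul_zero, mul_zero, add_zero] at h3
    exact h3
  refine squeeze_zero_norm' ?_ hFL
  filter_upwards [eventually_gt_atTop 0] with r hr
  set R : ℂ := ∫ t in (0 : ℝ)..Real.pi / 2, phaseFactor r t * (1 - Real.cos (t / 2) : ℂ) with hR
  have hcf := continuous_phaseFactor r
  have hK : ∫ t in (0 : ℝ)..Real.pi / 2, Real.cos (r * Real.cos t)
      = (Complex.exp (r * Complex.I) * (√(2 / r) * F √r + R)).re := by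
    rw [hF, hR, ← integral_phaseFactor_mul_cos hr, ← intervalIntegral.integral_add
      (Continuous.intervalIntegrable (by fun_prop) _ _)
      (Continuous.intervalIntegrable (by fun_prop) _ _),
      ← intervalIntegral.integral_const_mul]
    have := Complex.reCLM.intervalIntegral_comp_comm (μ := volume) (a := 0) (b := Real.pi / 2)
      (f := fun t => Complex.exp (r * Complex.I) * (phaseFactor r t * (Real.cos (t / 2) : ℂ)
        + phaseFactor r t * (1 - Real.cos (t / 2) : ℂ)))
      (Continuous.intervalIntegrable (by fun_prop) _ _)
    simp only [Complex.reCLM_apply] at this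
    rw [← this]
    congr 1
    ext t
    rw [cos_mul_cos_eq, ← mul_add, add_sub_cancel, mul_one]
  have hcos : Real.cos (r - besselPhase 0) = 2 / √Real.pi * (Complex.exp (r * Complex.I) * L).re := by
    rw [hL, show Complex.exp (r * Complex.I) * (√Real.pi * Complex.exp (-(Real.pi / 4 : ℝ) *
      Complex.I) / 2) = ((√Real.pi / 2 : ℝ) : ℂ) * Complex.exp ((r - besselPhase 0 : ℝ) * Complex.I) by
        rw [show ((r - besselPhase 0 : ℝ) : ℂ) * Complex.I = r * Complex.I +
          -(Real.pi / 4 : ℝ) * Complex.I by simp only [besselPhase]; push_cast; ring, Complex.exp_add]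
        push_cast; ring, Complex.re_ofReal_mul, Complex.exp_ofReal_mul_I_re]
    field_simp
  have hw : besselWave 0 r = 2 / √Real.pi * (Complex.exp (r * Complex.I) * F √r).re
      + 2 / √Real.pi * √(r / 2) * (Complex.exp (r * Complex.I) * R).re := by
    have h1 : besselClifford 0 (r ^ 2 / 4) = 2 / Real.pi *
        (Complex.exp (r * Complex.I) * (√(2 / r) * F √r + R)).re := by
      rw [← hK]
      have := pi_mul_besselClifford_zero' r
      field_simp
      linarith
    have h2 : √(r / 2) * √(2 / r) = 1 := by
      rw [← Real.sqrt_mul (by positivity), show r / 2 * (2 / r) = 1 by field_simp, Real.sqrt_one]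
    have h3 : √Real.pi * (2 / Real.pi) = 2 / √Real.pi := by
      nth_rewrite 2 [← Real.mul_self_sqrt hp.le]
      field_simp
    rw [besselWave, h1, zero_add, ← Real.sqrt_eq_rpow, mul_add, Complex.add_re,
      show Complex.exp (r * Complex.I) * (√(2 / r) * F √r)
        = (√(2 / r) : ℝ) * (Complex.exp (r * Complex.I) * F √r) by ring, Complex.re_ofReal_mul,
      ← h3]
    linear_combination √Real.pi * (2 / Real.pi) * (Complex.exp (r * Complex.I) * F √r).re * h2
  have hn : ∀ z : ℂ, |(Complex.exp (r * Complex.I) * z).re| ≤ ‖z‖ := fun z => by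
    refine (Complex.abs_re_le_norm _).trans (le_of_eq ?_)
    rw [norm_mul, Complex.norm_exp_ofReal_mul_I, one_mul]
  have hdiff : besselWave 0 r - Real.cos (r - besselPhase 0)
      = 2 / √Real.pi * (Complex.exp (r * Complex.I) * (F √r - L)).re
      + 2 / √Real.pi * √(r / 2) * (Complex.exp (r * Complex.I) * R).re := by
    rw [hw, hcos, mul_sub, Complex.sub_re]; ring
  rw [hdiff, Real.norm_eq_abs]
  refine (abs_add_le _ _).trans (add_le_add ?_ ?_)
  · rw [abs_mul, abs_of_pos (by positivity)]
    gcongr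
    exact hn _
  · rw [abs_mul, abs_of_pos (by positivity)]
    have hCr := hC r hr
    have hC0 : 0 ≤ C / r := (norm_nonneg _).trans hCr
    have hs1 : 1 ≤ √Real.pi := Real.one_le_sqrt.2 (by linarith [Real.pi_gt_three])
    have hs2 : 2 / √Real.pi ≤ 2 := div_le_self (by norm_num) hs1
    have hs3 : √(r / 2) ≤ √r := Real.sqrt_le_sqrt (by linarith)
    calc 2 / √Real.pi * √(r / 2) * |(Complex.exp (r * Complex.I) * R).re|
        ≤ 2 * √r * (C / r) := by
          gcongr
          exact (hn R).trans hCr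
      _ = 2 * C * √r⁻¹ := by
          rw [Real.sqrt_inv]
          have := Real.sqrt_pos.2 hr
          nth_rewrite 2 [← Real.mul_self_sqrt hr.le]
          field_simp

lemma besselAsymptotic_zero : BesselAsymptotic 0 := by
  refine ⟨tendsto_besselWave_zero, ?_⟩
  have hcos : ∀ r, HasDerivAt (fun r => Real.cos (r - besselPhase 0))
      (-Real.sin (r - besselPhase 0)) r := fun r => by
    simpa using ((hasDerivAt_id r).sub_const (besselPhase 0)).cos
  have hsin : ∀ r, HasDerivAt (fun r => Real.sin (r - besselPhase 0))
      (Real.cos (r - besselPhase 0)) r := fun r => by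
    simpa using ((hasDerivAt_id r).sub_const (besselPhase 0)).sin
  -- No second stationary-phase argument is needed: by Bessel's equation the difference `d = w -
  -- cos` satisfies `d'' = -d - w/(4r²)`, and the right side tends to `0`.
  refine tendsto_deriv_of_tendsto (d := fun r => besselWave 0 r - Real.cos (r - besselPhase 0))
    (d₂ := fun r => -(besselWave 0 r - Real.cos (r - besselPhase 0))
      - 1 / 4 / r * (1 / r * besselWave 0 r))
    (fun r hr => ?_) (fun r hr => ?_) tendsto_besselWave_zero ?_
  · refine ((hasDerivAt_besselWave le_rfl hr).sub (hcos r)).congr_deriv ?_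
    ring
  · refine ((hasDerivAt_besselWaveDeriv le_rfl hr).add (hsin r)).congr_deriv ?_
    field_simp
    ring
  · have h1 : Tendsto (fun r : ℝ => 1 / 4 / r) atTop (𝓝 0) :=
      tendsto_const_nhds.div_atTop tendsto_id
    simpa using tendsto_besselWave_zero.neg.sub
      (h1.mul (tendsto_const_div_mul_of_bounded tendsto_besselWave_zero 1))

end

noncomputable section

/-! ### Uniform bounds for solutions of the Bessel equation -/

section BesselODE

variable {w dw : ℝ → ℝ} {μ φ : ℝ}

/-- The energy has derivative `2μw²/r³ ≥ 0` and tends to `sin² + cos² = 1` at infinity. -/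
lemma bessel_energy_le_one (hμ : 0 ≤ μ) (h1 : ∀ r, 0 < r → HasDerivAt w (dw r) r)
    (h2 : ∀ r, 0 < r → HasDerivAt dw ((μ / r ^ 2 - 1) * w r) r)
    (a1 : Tendsto (fun r => w r - Real.cos (r - φ)) atTop (𝓝 0))
    (a2 : Tendsto (fun r => dw r + Real.sin (r - φ)) atTop (𝓝 0)) {r : ℝ} (hr : 0 < r) :
    dw r ^ 2 + (1 - μ / r ^ 2) * w r ^ 2 ≤ 1 := by
  set E : ℝ → ℝ := fun r => dw r ^ 2 + (1 - μ / r ^ 2) * w r ^ 2 with hE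
  have hder : ∀ t, 0 < t → HasDerivAt E (2 * μ / t ^ 3 * w t ^ 2) t := by
    intro t ht
    have h3 : HasDerivAt (fun t : ℝ => 1 - μ / t ^ 2) (2 * μ / t ^ 3) t := by
      have h := ((hasDerivAt_const t μ).div (hasDerivAt_pow 2 t) (by positivity)).const_sub 1
      refine h.congr_deriv ?_
      field_simp
      simp
      ring
    refine (((h2 t ht).pow 2).add (h3.mul ((h1 t ht).pow 2))).congr_deriv ?_
    simp only [Nat.cast_ofNat]
    field_simp
    simp only [Pi.pow_apply]
    ring
  have hmono : MonotoneOn E (Set.Ioi 0) := by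
    refine monotoneOn_of_deriv_nonneg (convex_Ioi 0)
      (fun t ht => (hder t ht).continuousAt.continuousWithinAt) ?_ ?_
    · rw [interior_Ioi]
      exact fun t ht => (hder t ht).differentiableAt.differentiableWithinAt
    · rw [interior_Ioi]
      intro t ht
      have ht : 0 < t := ht
      rw [(hder t ht).deriv]
      positivity
  have hlim : Tendsto E atTop (𝓝 1) := by
    have hs : ∀ f : ℝ → ℝ, (∀ t, |f t| ≤ 1) → ∀ g : ℝ → ℝ, Tendsto g atTop (𝓝 0) →
        Tendsto (fun t => g t * f t) atTop (𝓝 0) := fun f hf g hg =>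
      hg.zero_mul_isBoundedUnder_le (isBoundedUnder_of ⟨1, hf⟩)
    have b1 := hs _ (fun t => Real.abs_cos_le_one (t - φ)) _ a1
    have b2 := hs _ (fun t => Real.abs_sin_le_one (t - φ)) _ a2
    have b3 := tendsto_const_div_mul_of_bounded a1 1
    have b4 := ((((a1.mul a1).add (a2.mul a2)).add (b1.const_mul 2)).sub (b2.const_mul 2)).sub
      ((b3.mul b3).const_mul μ)
    have b5 := b4.const_add 1
    simp only [mul_zero, add_zero, sub_zero] at b5
    refine b5.congr fun t => ?_
    have := Real.sin_sq_add_cos_sq (t - φ)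
    simp only [hE]
    rw [show μ / t ^ 2 = μ * (1 / t) ^ 2 by ring]
    linear_combination -this
  refine ge_of_tendsto hlim ?_
  filter_upwards [eventually_ge_atTop r] with t ht
  exact hmono hr (hr.trans_le ht) ht

/-- For `r² ≥ μ` the energy bound suffices. Below the turning point `√μ`, the product `w w'`
increases from the limit `0`, so it is nonnegative; therefore `w'²` increases up to `√μ`, where the
energy reduces to `w'²`. -/
lemma bessel_abs_deriv_le_one (hμ : 0 ≤ μ) (h1 : ∀ r, 0 < r → HasDerivAt w (dw r) r)
    (h2 : ∀ r, 0 < r → HasDerivAt dw ((μ / r ^ 2 - 1) * w r) r)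
    (hE : ∀ r, 0 < r → dw r ^ 2 + (1 - μ / r ^ 2) * w r ^ 2 ≤ 1)
    (h0 : Tendsto (fun r => w r * dw r) (𝓝[>] 0) (𝓝 0)) {r : ℝ} (hr : 0 < r) : |dw r| ≤ 1 := by
  rw [← sq_le_one_iff_abs_le_one]
  rcases le_or_gt μ (r ^ 2) with h | h
  · have h3 : 0 ≤ 1 - μ / r ^ 2 := by
      rw [sub_nonneg, div_le_one (by positivity)]; exact h
    nlinarith [hE r hr, mul_nonneg h3 (sq_nonneg (w r))]
  have hμ0 : 0 < μ := lt_of_le_of_lt (sq_nonneg r) h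
  set s := √μ with hs
  have hs0 : 0 < s := Real.sqrt_pos.2 hμ0
  have hs2 : s ^ 2 = μ := Real.sq_sqrt hμ
  have hrs : r ≤ s := Real.le_sqrt_of_sq_le h.le
  have hge : ∀ t ∈ Set.Ioc 0 s, 0 ≤ μ / t ^ 2 - 1 := by
    intro t ht
    rw [sub_nonneg, one_le_div (pow_pos ht.1 2), ← hs2]
    exact pow_le_pow_left₀ ht.1.le ht.2 2
  have mono : ∀ F F' : ℝ → ℝ, (∀ t, 0 < t → HasDerivAt F (F' t) t) →
      (∀ t ∈ Set.Ioc 0 s, 0 ≤ F' t) → MonotoneOn F (Set.Ioc 0 s) := by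
    intro F F' hF hF'
    refine monotoneOn_of_deriv_nonneg (convex_Ioc 0 s)
      (fun t ht => (hF t ht.1).continuousAt.continuousWithinAt) ?_ ?_
    · rw [interior_Ioc]
      exact fun t ht => (hF t ht.1).differentiableAt.differentiableWithinAt
    · rw [interior_Ioc]
      intro t ht
      rw [(hF t ht.1).deriv]
      exact hF' t ⟨ht.1, ht.2.le⟩
  have m1 := mono (fun t => w t * dw t) (fun t => dw t ^ 2 + (μ / t ^ 2 - 1) * w t ^ 2)
    (fun t ht => ((h1 t ht).mul (h2 t ht)).congr_deriv (by ring))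
    (fun t ht => by have := hge t ht; positivity)
  have p1 : ∀ t ∈ Set.Ioc 0 s, 0 ≤ w t * dw t := by
    intro t ht
    refine le_of_tendsto h0 ?_
    filter_upwards [Ioo_mem_nhdsGT ht.1] with x hx
    exact m1 ⟨hx.1, hx.2.le.trans ht.2⟩ ht hx.2.le
  have m2 := mono (fun t => dw t ^ 2) (fun t => 2 * ((μ / t ^ 2 - 1) * (w t * dw t)))
    (fun t ht => ((h2 t ht).pow 2).congr_deriv (by simp; ring))
    (fun t ht => mul_nonneg two_pos.le (mul_nonneg (hge t ht) (p1 t ht)))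
  have h5 := hE s hs0
  rw [hs2, div_self hμ0.ne', sub_self, zero_mul, add_zero] at h5
  exact (m2 ⟨hr, hrs⟩ ⟨hs0, le_rfl⟩ hrs).trans h5

lemma bessel_abs_le (h1 : ∀ r, 0 < r → HasDerivAt w (dw r) r) (h3 : ∀ r, 0 < r → |dw r| ≤ 1)
    (h0 : Tendsto w (𝓝[>] 0) (𝓝 0)) {r : ℝ} (hr : 0 < r) : |w r| ≤ r := by
  have hlim : Tendsto (fun t => |w r - w t|) (𝓝[>] 0) (𝓝 |w r - 0|) := (h0.const_sub _).abs
  rw [sub_zero] at hlim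
  refine le_of_tendsto hlim ?_
  filter_upwards [Ioo_mem_nhdsGT hr] with t ht
  have := (convex_Ioi (0 : ℝ)).norm_image_sub_le_of_norm_hasDerivWithin_le (f := w) (C := 1)
    (fun x hx => (h1 x hx).hasDerivWithinAt) (fun x hx => h3 x hx) ht.1 (Set.mem_Ioi.2 hr)
  rw [Real.norm_eq_abs, Real.norm_eq_abs, abs_of_pos (by linarith [ht.2] : 0 < r - t)] at this
  linarith [ht.1]

/-- Variation of constants. The quantity `Z = (w + iw')e^{i(r-φ)}` would be constant for `w'' = -w`;
here `Z' = iμr⁻²w e^{i(r-φ)}` and `Z → 1`, so integration from `r` to infinity bounds `|Z - 1|`, the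
modulus of the pair of errors. -/
lemma bessel_sub_cos_le (h1 : ∀ r, 0 < r → HasDerivAt w (dw r) r)
    (h2 : ∀ r, 0 < r → HasDerivAt dw ((μ / r ^ 2 - 1) * w r) r)
    (a1 : Tendsto (fun r => w r - Real.cos (r - φ)) atTop (𝓝 0))
    (a2 : Tendsto (fun r => dw r + Real.sin (r - φ)) atTop (𝓝 0)) {r M : ℝ} (hr : 0 < r)
    (hM : ∀ t, r ≤ t → |w t| ≤ M) :
    |w r - Real.cos (r - φ)| ≤ |μ| * M / r ∧ |dw r + Real.sin (r - φ)| ≤ |μ| * M / r := by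
  have hM0 : 0 ≤ M := (abs_nonneg _).trans (hM r le_rfl)
  set e : ℝ → ℂ := fun t => Complex.exp ((t - φ : ℝ) * Complex.I) with he
  have hen : ∀ t, ‖e t‖ = 1 := fun t => Complex.norm_exp_ofReal_mul_I _
  have hecs : ∀ t, e t = Real.cos (t - φ) + Real.sin (t - φ) * Complex.I := fun t => by
    simp only [he]; rw [Complex.exp_mul_I, Complex.ofReal_cos, Complex.ofReal_sin]
  set Z : ℝ → ℂ := fun t => (w t + dw t * Complex.I) * e t with hZ
  have hZ1 : ∀ t, Z t - 1 = ((w t - Real.cos (t - φ) : ℝ) +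
      (dw t + Real.sin (t - φ) : ℝ) * Complex.I) * e t := by
    intro t
    have hI := Complex.I_sq
    have hcs : (Real.sin (t - φ) : ℂ) ^ 2 + (Real.cos (t - φ) : ℂ) ^ 2 = 1 := by
      exact_mod_cast Real.sin_sq_add_cos_sq (t - φ)
    simp only [hZ, hecs]
    push_cast at hcs ⊢
    linear_combination hcs - Complex.sin (t - φ) ^ 2 * hI
  have hnZ : ∀ t, ‖Z t - 1‖ = ‖((w t - Real.cos (t - φ) : ℝ) : ℂ) +
      (dw t + Real.sin (t - φ) : ℝ) * Complex.I‖ := fun t => by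
    rw [hZ1, norm_mul, hen, mul_one]
  have hlim : Tendsto (fun t => ‖Z t - 1‖) atTop (𝓝 0) := by
    have h := ((Complex.continuous_ofReal.tendsto 0).comp a1).add
      (((Complex.continuous_ofReal.tendsto 0).comp a2).mul_const Complex.I)
    have h3 := h.norm
    simp only [Complex.ofReal_zero, zero_mul, add_zero, norm_zero] at h3
    exact h3.congr fun t => (hnZ t).symm
  have hder : ∀ t, 0 < t → HasDerivAt Z (Complex.I * (μ / t ^ 2 * w t : ℝ) * e t) t := by
    intro t ht
    have d1 : HasDerivAt e (Complex.I * e t) t := by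
      have h := (((hasDerivAt_id t).sub_const φ).ofReal_comp.mul_const Complex.I).cexp
      refine h.congr_deriv ?_
      simp [he]; ring
    have d2 := ((h1 t ht).ofReal_comp.add ((h2 t ht).ofReal_comp.mul_const Complex.I)).mul d1
    refine d2.congr_deriv ?_
    simp only [Pi.add_apply]
    push_cast
    linear_combination (dw t : ℂ) * e t * Complex.I_sq
  have hZr : ∀ T, r ≤ T → ‖Z T - Z r‖ ≤ |μ| * M * (1 / r - 1 / T) := by
    intro T hT
    have hpos : ∀ x, r ≤ x → 0 < x := fun x hx => hr.trans_le hx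
    have hBd : ∀ x, r ≤ x →
        HasDerivAt (fun x : ℝ => |μ| * M * (1 / r - 1 / x)) (|μ| * M / x ^ 2) x := by
      intro x hx
      have h := ((hasDerivAt_inv (hpos x hx).ne').const_sub (1 / r)).const_mul (|μ| * M)
      simp only [one_div]
      simp only [one_div] at h
      refine h.congr_deriv ?_
      ring
    refine image_norm_le_of_norm_deriv_right_le_deriv_boundary' (a := r) (b := T)
      (f := fun t => Z t - Z r) (f' := fun t => Complex.I * (μ / t ^ 2 * w t : ℝ) * e t)
      (B := fun x => |μ| * M * (1 / r - 1 / x)) (B' := fun x => |μ| * M / x ^ 2)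
      (fun x hx => ((hder x (hpos x hx.1)).sub_const _).continuousAt.continuousWithinAt)
      (fun x hx => ((hder x (hpos x hx.1)).sub_const _).hasDerivWithinAt) (by simp)
      (fun x hx => (hBd x hx.1).continuousAt.continuousWithinAt)
      (fun x hx => (hBd x hx.1).hasDerivWithinAt) (fun x hx => ?_) ⟨hT, le_rfl⟩
    rw [norm_mul, norm_mul, Complex.norm_I, hen, Complex.norm_real, Real.norm_eq_abs, one_mul,
      mul_one, abs_mul, abs_div, abs_of_pos (pow_pos (hpos x hx.1) 2), div_mul_eq_mul_div]
    have := hM x hx.1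
    have := hpos x hx.1
    gcongr
  have hfin : ‖Z r - 1‖ ≤ |μ| * M / r := by
    have hlim2 : Tendsto (fun t => |μ| * M / r + ‖Z t - 1‖) atTop (𝓝 (|μ| * M / r + 0)) :=
      hlim.const_add _
    rw [add_zero] at hlim2
    refine ge_of_tendsto hlim2 ?_
    filter_upwards [eventually_ge_atTop r] with T hT
    have hT0 : 0 < T := hr.trans_le hT
    have h3 := hZr T hT
    have h4 : |μ| * M * (1 / r - 1 / T) ≤ |μ| * M / r := by
      have : 0 ≤ |μ| * M * (1 / T) := by positivity
      have e5 : |μ| * M * (1 / r - 1 / T) = |μ| * M / r - |μ| * M * (1 / T) := by ring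
      linarith
    have h5 : Z r - 1 = (Z T - 1) - (Z T - Z r) := by ring
    rw [h5]
    linarith [norm_sub_le (Z T - 1) (Z T - Z r)]
  rw [hnZ] at hfin
  have hre : ∀ a b : ℝ, |a| ≤ ‖(a : ℂ) + b * Complex.I‖ ∧ |b| ≤ ‖(a : ℂ) + b * Complex.I‖ :=
    fun a b => ⟨by simpa using Complex.abs_re_le_norm ((a : ℂ) + b * Complex.I),
      by simpa using Complex.abs_im_le_norm ((a : ℂ) + b * Complex.I)⟩
  exact ⟨(hre _ _).1.trans hfin, (hre _ _).2.trans hfin⟩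

/-- The split is at `r = 2√μ`. Beyond it `1 - μ/r² ≥ 3/4`, so the energy bounds `w` by a constant
and variation of constants applies. Before it, `|w| ≤ r` and `|w'| ≤ 1` are enough because `r`
itself is controlled by `μ`. -/
lemma bessel_uniform_bounds (hμ : 0 ≤ μ) (h1 : ∀ r, 0 < r → HasDerivAt w (dw r) r)
    (h2 : ∀ r, 0 < r → HasDerivAt dw ((μ / r ^ 2 - 1) * w r) r)
    (a1 : Tendsto (fun r => w r - Real.cos (r - φ)) atTop (𝓝 0))
    (a2 : Tendsto (fun r => dw r + Real.sin (r - φ)) atTop (𝓝 0))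
    (h0 : Tendsto w (𝓝[>] 0) (𝓝 0))
    (h0' : Tendsto (fun r => w r * dw r) (𝓝[>] 0) (𝓝 0)) {r : ℝ} (hr : 0 < r) :
    |w r - Real.cos (r - φ)| ≤ 5 * (1 + μ) ∧ |w r - Real.cos (r - φ)| ≤ 5 * (1 + μ) / r ∧
      |dw r + Real.sin (r - φ)| ≤ 5 * (1 + μ) / r := by
  have hE := fun r (hr : 0 < r) => bessel_energy_le_one hμ h1 h2 a1 a2 hr
  have hd := fun r (hr : 0 < r) => bessel_abs_deriv_le_one hμ h1 h2 hE h0' hr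
  have hw := bessel_abs_le h1 hd h0 hr
  have hc := Real.abs_cos_le_one (r - φ)
  have hsn := Real.abs_sin_le_one (r - φ)
  have hs2 : √μ ^ 2 = μ := Real.sq_sqrt hμ
  have hs0 := Real.sqrt_nonneg μ
  have t1 : |w r - Real.cos (r - φ)| ≤ |w r| + 1 := (abs_sub _ _).trans (by linarith)
  have t2 : |dw r + Real.sin (r - φ)| ≤ 2 := (abs_add_le _ _).trans (by linarith [hd r hr])
  rcases le_or_gt (2 * √μ) r with h | h
  · have hM : ∀ t, r ≤ t → |w t| ≤ 2 := by
      intro t ht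
      have ht0 : 0 < t := hr.trans_le ht
      have h3 : μ / t ^ 2 ≤ 1 / 4 := by
        rw [div_le_iff₀ (by positivity)]
        nlinarith
      have h4 := hE t ht0
      refine abs_le_of_sq_le_sq (by nlinarith [sq_nonneg (dw t), sq_nonneg (w t)]) (by norm_num)
    obtain ⟨b1, b2⟩ := bessel_sub_cos_le h1 h2 a1 a2 hr hM
    rw [abs_of_nonneg hμ] at b1 b2
    have h6 : μ * 2 / r ≤ 5 * (1 + μ) / r :=
      div_le_div_of_nonneg_right (by linarith) hr.le
    exact ⟨by linarith [hM r le_rfl], b1.trans h6, b2.trans h6⟩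
  -- From `r < 2√μ ≤ 1 + μ` it follows that `r + r² ≤ 1 + 5μ`; this is the source of the constant
  -- `5`.
  · have h7 : r * (1 + r) ≤ 5 * (1 + μ) := by nlinarith [sq_nonneg (√μ - 1)]
    have h8 : 2 * r ≤ 5 * (1 + μ) := by nlinarith [sq_nonneg (√μ - 1)]
    refine ⟨by linarith, ?_, ?_⟩
    · rw [le_div_iff₀ hr]; nlinarith
    · rw [le_div_iff₀ hr]; nlinarith

end BesselODE

/-! ### Integer and half-integer orders, and bounds polynomial in the degree -/

lemma besselAsymptotic_nat (k : ℕ) : BesselAsymptotic k := by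
  induction k with
  | zero => simpa using besselAsymptotic_zero
  | succ k ih => simpa using ih.add_one (by positivity)

lemma besselAsymptotic_nat_add_half (k : ℕ) : BesselAsymptotic (k + 1 / 2) := by
  induction k with
  | zero => simpa using besselAsymptotic_half
  | succ k ih =>
    have := ih.add_one (by positivity)
    rwa [show ((k + 1 : ℕ) : ℝ) + 1 / 2 = k + 1 / 2 + 1 by push_cast; ring]

/-- The order of the Bessel function that corresponds to spherical harmonics of degree `l`. -/
def sphereOrder (n l : ℕ) : ℝ := l + n / 2 - 1

lemma sphereOrder_nonneg {n : ℕ} (hn : 2 ≤ n) (l : ℕ) : 0 ≤ sphereOrder n l := by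
  have h1 : (2 : ℝ) ≤ n := by exact_mod_cast hn
  have h2 : (0 : ℝ) ≤ l := by positivity
  rw [sphereOrder]; linarith

lemma besselAsymptotic_sphereOrder {n : ℕ} (hn : 2 ≤ n) (l : ℕ) :
    BesselAsymptotic (sphereOrder n l) := by
  rcases Nat.even_or_odd n with ⟨m, hm⟩ | ⟨m, hm⟩
  · convert besselAsymptotic_nat (l + (m - 1)) using 1
    rw [sphereOrder, hm, Nat.cast_add l, Nat.cast_sub (by omega)]; push_cast; ring
  · convert besselAsymptotic_nat_add_half (l + (m - 1)) using 1
    rw [sphereOrder, hm, Nat.cast_add l, Nat.cast_sub (by omega)]; push_cast; ring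

/-- The phase is `r₀` plus `l` quarter turns; these quarter turns produce the splitting into `f_R`
and `f_I`. -/
lemma besselPhase_sphereOrder (n l : ℕ) :
    besselPhase (sphereOrder n l) = Real.pi / 4 * (n - 1) + l * (Real.pi / 2) := by
  rw [besselPhase, sphereOrder]; ring

/-- Near `0` the function is of size `r^{ν+1/2}` and its derivative of size `r^{ν-1/2}`. For `ν =
1/2` the derivative stays bounded without vanishing, which is why the product is considered. -/
lemma tendsto_besselWave_nhdsGT_zero {ν : ℝ} (hν : 1 / 2 ≤ ν) :
    Tendsto (besselWave ν) (𝓝[>] 0) (𝓝 0) ∧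
    Tendsto (fun r => besselWave ν r * besselWaveDeriv ν r) (𝓝[>] 0) (𝓝 0) := by
  have hc : ∀ {ν : ℝ}, 1 / 2 ≤ ν → Continuous (besselWave ν) := by
    intro ν hν
    have h1 := continuous_besselClifford (ν := ν) (by linarith)
    have h2 : Continuous fun r : ℝ => (r / 2) ^ (ν + 1 / 2) :=
      (by fun_prop : Continuous fun r : ℝ => r / 2).rpow_const fun _ => Or.inr (by linarith)
    unfold besselWave
    fun_prop
  have hz : ∀ {ν : ℝ}, 1 / 2 ≤ ν → besselWave ν 0 = 0 := by
    intro ν hν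
    rw [besselWave, zero_div, Real.zero_rpow (by linarith)]; simp
  have A : Tendsto (besselWave ν) (𝓝[>] 0) (𝓝 0) := by
    have := (hc hν).tendsto 0
    rw [hz hν] at this
    exact this.mono_left nhdsWithin_le_nhds
  refine ⟨A, ?_⟩
  have hg : Continuous fun r : ℝ => (ν + 1 / 2) / 2 * √Real.pi * (r / 2) ^ (ν - 1 / 2) *
      besselClifford ν (r ^ 2 / 4) - besselWave (ν + 1) r := by
    have h1 := continuous_besselClifford (ν := ν) (by linarith)
    have h2 : Continuous fun r : ℝ => (r / 2) ^ (ν - 1 / 2) :=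
      (by fun_prop : Continuous fun r : ℝ => r / 2).rpow_const fun _ => Or.inr (by linarith)
    have h3 := hc (ν := ν + 1) (by linarith)
    fun_prop
  have B := A.mul ((hg.tendsto 0).mono_left nhdsWithin_le_nhds)
  rw [zero_mul] at B
  refine B.congr' ?_
  filter_upwards [self_mem_nhdsWithin] with r hr
  have hr : 0 < r := hr
  congr 1
  rw [besselWaveDeriv]
  congr 1
  rw [besselWave, show ν + 1 / 2 = ν - 1 / 2 + 1 by ring, Real.rpow_add_one (by positivity)]
  field_simp

/-- Order `0` arises only for `n = 2`, `l = 0`. There `μ = -1/4` and the energy is not increasing,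
but for a single function a global bound follows from compactness and the asymptotics. -/
lemma exists_besselWave_zero_bound : ∃ C : ℝ, 0 < C ∧ ∀ r : ℝ, 0 < r →
    |besselWave 0 r - Real.cos (r - besselPhase 0)| ≤ C ∧
    |besselWave 0 r - Real.cos (r - besselPhase 0)| ≤ C / r ∧
    |besselWaveDeriv 0 r + Real.sin (r - besselPhase 0)| ≤ C / r := by
  have hc : Continuous (besselWave 0) := by
    have h1 := continuous_besselClifford (ν := 0) le_rfl
    have h2 : Continuous fun r : ℝ => (r / 2) ^ (0 + 1 / 2 : ℝ) :=
      (by fun_prop : Continuous fun r : ℝ => r / 2).rpow_const fun _ => Or.inr (by norm_num)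
    unfold besselWave
    fun_prop
  obtain ⟨N, hN⟩ := (Metric.tendsto_atTop.1 besselAsymptotic_zero.1) 1 one_pos
  obtain ⟨K, hK⟩ := (isCompact_Icc (a := (0 : ℝ)) (b := N)).exists_bound_of_continuousOn
    hc.continuousOn
  have hM : ∀ t : ℝ, 0 < t → |besselWave 0 t| ≤ max K 2 := by
    intro t ht
    rcases le_total t N with h | h
    · exact (hK t ⟨ht.le, h⟩).trans (le_max_left _ _)
    · refine le_trans ?_ (le_max_right _ _)
      have h1 := hN t h
      rw [dist_zero_right, Real.norm_eq_abs] at h1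
      have h2 := Real.abs_cos_le_one (t - besselPhase 0)
      have h3 := abs_add_le (besselWave 0 t - Real.cos (t - besselPhase 0))
        (Real.cos (t - besselPhase 0))
      rw [sub_add_cancel] at h3
      linarith
  have h2 : (2 : ℝ) ≤ max K 2 := le_max_right _ _
  refine ⟨max K 2 + 1, by linarith, fun r hr => ?_⟩
  obtain ⟨b1, b2⟩ := bessel_sub_cos_le (fun r hr => hasDerivAt_besselWave le_rfl hr)
    (fun r hr => hasDerivAt_besselWaveDeriv le_rfl hr) besselAsymptotic_zero.1
    besselAsymptotic_zero.2 hr (fun t ht => hM t (hr.trans_le ht))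
  have h6 : |(0 : ℝ) ^ 2 - 1 / 4| * max K 2 / r ≤ (max K 2 + 1) / r := by
    gcongr
    rw [show |(0 : ℝ) ^ 2 - 1 / 4| = 1 / 4 by norm_num [abs_of_pos]]
    linarith
  refine ⟨?_, b1.trans h6, b2.trans h6⟩
  have := abs_sub (besselWave 0 r) (Real.cos (r - besselPhase 0))
  linarith [hM r hr, Real.abs_cos_le_one (r - besselPhase 0)]

/-- The uniform asymptotics of the Bessel functions of the orders `l + n/2 - 1`. -/
theorem exists_besselWave_bound {n : ℕ} (hn : 2 ≤ n) : ∃ C : ℝ, 0 < C ∧ ∀ (l : ℕ) (r : ℝ), 0 < r →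
    |besselWave (sphereOrder n l) r - Real.cos (r - besselPhase (sphereOrder n l))|
      ≤ C * (1 + l) ^ 2 ∧
    |besselWave (sphereOrder n l) r - Real.cos (r - besselPhase (sphereOrder n l))|
      ≤ C * (1 + l) ^ 2 / r ∧
    |besselWaveDeriv (sphereOrder n l) r + Real.sin (r - besselPhase (sphereOrder n l))|
      ≤ C * (1 + l) ^ 2 / r := by
  obtain ⟨C₀, hC₀, h0⟩ := exists_besselWave_zero_bound
  have hn' : (2 : ℝ) ≤ n := by exact_mod_cast hn
  refine ⟨C₀ + 5 * (1 + n ^ 2), by positivity, fun l r hr => ?_⟩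
  set D : ℝ := (C₀ + 5 * (1 + n ^ 2)) * (1 + l) ^ 2 with hD
  have hl : (0 : ℝ) ≤ l := by positivity
  have h1l : (1 : ℝ) ≤ (1 + l) ^ 2 := by nlinarith
  suffices ∃ D' ≤ D, |besselWave (sphereOrder n l) r - Real.cos (r - besselPhase (sphereOrder n l))|
      ≤ D' ∧ |besselWave (sphereOrder n l) r - Real.cos (r - besselPhase (sphereOrder n l))|
      ≤ D' / r ∧ |besselWaveDeriv (sphereOrder n l) r +
        Real.sin (r - besselPhase (sphereOrder n l))| ≤ D' / r by
    obtain ⟨D', hD', b1, b2, b3⟩ := this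
    exact ⟨b1.trans hD', b2.trans (by gcongr), b3.trans (by gcongr)⟩
  have hν := sphereOrder_nonneg hn l
  -- Twice the order is an integer, so a positive order is at least `1/2`; this is exactly `μ ≥ 0`.
  rcases hν.eq_or_lt with h | h
  · refine ⟨C₀, ?_, by simpa only [← h] using h0 r hr⟩
    rw [hD]
    nlinarith [sq_nonneg (n : ℝ)]
  · have hν2 : 1 / 2 ≤ sphereOrder n l := by
      have h3 : (2 * l + n : ℝ) = 2 * sphereOrder n l + 2 := by rw [sphereOrder]; ring
      have h4 : (2 : ℝ) < (2 * l + n : ℕ) := by push_cast; linarith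
      have h5 : 3 ≤ 2 * l + n := by exact_mod_cast h4
      have h6 : (3 : ℝ) ≤ (2 * l + n : ℕ) := by exact_mod_cast h5
      push_cast at h6
      linarith
    have hA := besselAsymptotic_sphereOrder hn l
    have hT := tendsto_besselWave_nhdsGT_zero hν2
    refine ⟨_, ?_, bessel_uniform_bounds (μ := sphereOrder n l ^ 2 - 1 / 4) (by nlinarith)
      (fun r hr => hasDerivAt_besselWave hν hr) (fun r hr => hasDerivAt_besselWaveDeriv hν hr)
      hA.1 hA.2 hT.1 hT.2 hr⟩
    have h7 : sphereOrder n l ≤ n * (1 + l) := by rw [sphereOrder]; nlinarith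
    have h8 : sphereOrder n l ^ 2 ≤ (n * (1 + l)) ^ 2 := pow_le_pow_left₀ hν h7 2
    rw [hD]
    nlinarith [mul_pos hC₀ (by positivity : (0 : ℝ) < (1 + l) ^ 2)]

end

noncomputable section

/-! ### Polynomial functions on Euclidean space -/

/-- The function on Euclidean space defined by a polynomial. -/
def polyFun {n : ℕ} (p : MvPolynomial (Fin n) ℝ) (x : EuclideanSpace ℝ (Fin n)) : ℝ :=
  MvPolynomial.eval (fun i => x i) p

section PolyFun

variable {n : ℕ}

@[simp] lemma polyFun_add (p q : MvPolynomial (Fin n) ℝ) (x : EuclideanSpace ℝ (Fin n)) :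
    polyFun (p + q) x = polyFun p x + polyFun q x := map_add _ _ _

@[simp] lemma polyFun_sub (p q : MvPolynomial (Fin n) ℝ) (x : EuclideanSpace ℝ (Fin n)) :
    polyFun (p - q) x = polyFun p x - polyFun q x := map_sub _ _ _

@[simp] lemma polyFun_mul (p q : MvPolynomial (Fin n) ℝ) (x : EuclideanSpace ℝ (Fin n)) :
    polyFun (p * q) x = polyFun p x * polyFun q x := map_mul _ _ _

@[simp] lemma polyFun_pow (p : MvPolynomial (Fin n) ℝ) (k : ℕ) (x : EuclideanSpace ℝ (Fin n)) :
    polyFun (p ^ k) x = polyFun p x ^ k := map_pow _ _ _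

@[simp] lemma polyFun_zero (x : EuclideanSpace ℝ (Fin n)) :
    polyFun (0 : MvPolynomial (Fin n) ℝ) x = 0 := map_zero _

@[simp] lemma polyFun_one (x : EuclideanSpace ℝ (Fin n)) :
    polyFun (1 : MvPolynomial (Fin n) ℝ) x = 1 := map_one _

@[simp] lemma polyFun_C (a : ℝ) (x : EuclideanSpace ℝ (Fin n)) :
    polyFun (MvPolynomial.C a) x = a := MvPolynomial.eval_C _

@[simp] lemma polyFun_natCast (a : ℕ) (x : EuclideanSpace ℝ (Fin n)) :
    polyFun (a : MvPolynomial (Fin n) ℝ) x = a := map_natCast _ _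

@[simp] lemma polyFun_X (i : Fin n) (x : EuclideanSpace ℝ (Fin n)) :
    polyFun (MvPolynomial.X i) x = x i := MvPolynomial.eval_X _

@[simp] lemma polyFun_smul (a : ℝ) (p : MvPolynomial (Fin n) ℝ) (x : EuclideanSpace ℝ (Fin n)) :
    polyFun (a • p) x = a * polyFun p x := MvPolynomial.smul_eval _ _ _

@[simp] lemma polyFun_sum {ι : Type*} (s : Finset ι) (p : ι → MvPolynomial (Fin n) ℝ)
    (x : EuclideanSpace ℝ (Fin n)) : polyFun (∑ i ∈ s, p i) x = ∑ i ∈ s, polyFun (p i) x :=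
  map_sum _ _ _

lemma polyFun_smul_arg {p : MvPolynomial (Fin n) ℝ} {d : ℕ} (hp : p.IsHomogeneous d) (r : ℝ)
    (x : EuclideanSpace ℝ (Fin n)) : polyFun p (r • x) = r ^ d * polyFun p x := by
  rw [polyFun, polyFun, MvPolynomial.eval_eq', MvPolynomial.eval_eq', Finset.mul_sum]
  refine Finset.sum_congr rfl fun m hm => ?_
  have hdeg : ∑ i, m i = d := by
    have h := hp (MvPolynomial.mem_support_iff.1 hm)
    rw [Finsupp.weight_apply, Finsupp.sum_fintype _ _ (by simp)] at h
    simpa using h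
  simp only [PiLp.smul_apply, smul_eq_mul, mul_pow, Finset.prod_mul_distrib,
    Finset.prod_pow_eq_pow_sum, hdeg]
  ring

/-- The gradient of a polynomial function. -/
def polyGrad (p : MvPolynomial (Fin n) ℝ) (x : EuclideanSpace ℝ (Fin n)) :
    EuclideanSpace ℝ (Fin n) :=
  WithLp.toLp 2 fun i => polyFun (MvPolynomial.pderiv i p) x

@[simp] lemma polyGrad_apply (p : MvPolynomial (Fin n) ℝ) (x : EuclideanSpace ℝ (Fin n))
    (i : Fin n) : polyGrad p x i = polyFun (MvPolynomial.pderiv i p) x := rfl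

lemma hasGradientAt_polyFun (p : MvPolynomial (Fin n) ℝ) (x : EuclideanSpace ℝ (Fin n)) :
    HasGradientAt (polyFun p) (polyGrad p x) x := by
  rw [hasGradientAt_iff_hasFDerivAt]
  induction p using MvPolynomial.induction_on with
  | C a =>
    have h : polyFun (MvPolynomial.C a : MvPolynomial (Fin n) ℝ) = fun _ => a := by
      ext; simp
    have h2 : polyGrad (MvPolynomial.C a : MvPolynomial (Fin n) ℝ) x = 0 := by
      ext i; simp
    rw [h, h2, map_zero]
    exact hasFDerivAt_const _ _
  | add p q hp hq =>
    have h : polyFun (p + q) = fun x => polyFun p x + polyFun q x := by ext; simp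
    have h2 : polyGrad (p + q) x = polyGrad p x + polyGrad q x := by ext i; simp
    rw [h, h2, map_add]
    exact hp.add hq
  | mul_X p i hp =>
    have h : polyFun (p * MvPolynomial.X i) = fun x => polyFun p x * x i := by ext; simp
    have h2 : polyGrad (p * MvPolynomial.X i) x
        = polyFun p x • EuclideanSpace.single i 1 + x i • polyGrad p x := by
      ext j
      simp only [polyGrad_apply, Derivation.leibniz, MvPolynomial.pderiv_X, smul_eq_mul,
        polyFun_add, polyFun_mul, polyFun_X, PiLp.add_apply, PiLp.smul_apply,
        PiLp.single_apply, Pi.single_apply]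
      rcases eq_or_ne i j with rfl | hij
      · simp
      · simp [hij, hij.symm]
    have h3 : HasFDerivAt (fun x : EuclideanSpace ℝ (Fin n) => x i)
        (EuclideanSpace.proj i : EuclideanSpace ℝ (Fin n) →L[ℝ] ℝ) x :=
      (EuclideanSpace.proj i : EuclideanSpace ℝ (Fin n) →L[ℝ] ℝ).hasFDerivAt
    rw [h, h2]
    refine (hp.mul h3).congr_fderiv ?_
    ext v
    simp [InnerProductSpace.toDual_apply_apply, EuclideanSpace.inner_single_left]

lemma continuous_polyFun (p : MvPolynomial (Fin n) ℝ) : Continuous (polyFun p) :=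
  continuous_iff_continuousAt.2 fun x => (hasGradientAt_polyFun p x).continuousAt

lemma fderiv_polyFun_single (p : MvPolynomial (Fin n) ℝ) (x : EuclideanSpace ℝ (Fin n))
    (i : Fin n) : fderiv ℝ (polyFun p) x (EuclideanSpace.single i 1)
      = polyFun (MvPolynomial.pderiv i p) x := by
  rw [(hasGradientAt_polyFun p x).hasFDerivAt.fderiv, InnerProductSpace.toDual_apply_apply,
    EuclideanSpace.inner_single_right]
  simp

/-! ### Integrals of polynomials over the sphere -/

instance : IsFiniteMeasure (areaMeasure n) := by unfold areaMeasure; infer_instance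

/-- The integral of a polynomial over the unit sphere. -/
def sphereIntegral (p : MvPolynomial (Fin n) ℝ) : ℝ :=
  ∫ ξ : USphere n, polyFun p (ξ : EuclideanSpace ℝ (Fin n)) ∂(areaMeasure n)

lemma integrable_of_continuous_sphere {F : Type*} [NormedAddCommGroup F] {f : USphere n → F}
    (hf : Continuous f) : Integrable f (areaMeasure n) :=
  hf.integrable_of_hasCompactSupport (HasCompactSupport.of_compactSpace f)

lemma continuous_polyFun_sphere (p : MvPolynomial (Fin n) ℝ) :
    Continuous fun ξ : USphere n => polyFun p (ξ : EuclideanSpace ℝ (Fin n)) :=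
  (continuous_polyFun p).comp continuous_subtype_val

lemma sphereIntegral_add (p q : MvPolynomial (Fin n) ℝ) :
    sphereIntegral (p + q) = sphereIntegral p + sphereIntegral q := by
  simp only [sphereIntegral, polyFun_add]
  exact integral_add (integrable_of_continuous_sphere (continuous_polyFun_sphere p))
    (integrable_of_continuous_sphere (continuous_polyFun_sphere q))

lemma sphereIntegral_smul (a : ℝ) (p : MvPolynomial (Fin n) ℝ) :
    sphereIntegral (a • p) = a * sphereIntegral p := by
  simp only [sphereIntegral, polyFun_smul]
  exact integral_const_mul _ _

@[simp] lemma sphereIntegral_zero : sphereIntegral (0 : MvPolynomial (Fin n) ℝ) = 0 := by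
  simp [sphereIntegral]

lemma sphereIntegral_sum {ι : Type*} (s : Finset ι) (p : ι → MvPolynomial (Fin n) ℝ) :
    sphereIntegral (∑ i ∈ s, p i) = ∑ i ∈ s, sphereIntegral (p i) := by
  classical
  induction s using Finset.induction_on with
  | empty => simp
  | insert a s ha ih => rw [Finset.sum_insert ha, Finset.sum_insert ha, sphereIntegral_add, ih]

/-- Polar coordinates for a homogeneous polynomial times a radial weight. -/
lemma integral_polyFun_mul_radial (hn : 1 ≤ n) {p : MvPolynomial (Fin n) ℝ} {d : ℕ}
    (hp : p.IsHomogeneous d) (ψ : ℝ → ℝ) :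
    ∫ x : EuclideanSpace ℝ (Fin n), polyFun p x * ψ ‖x‖
      = sphereIntegral p * ∫ r in Set.Ioi (0 : ℝ), r ^ (d + (n - 1)) * ψ r := by
  have : Nonempty (Fin n) := ⟨⟨0, hn⟩⟩
  have : Nontrivial (EuclideanSpace ℝ (Fin n)) := inferInstance
  set E := EuclideanSpace ℝ (Fin n)
  have hdim : Module.finrank ℝ E = n := by simp [E]
  calc ∫ x : E, polyFun p x * ψ ‖x‖
      = ∫ x : ({(0 : E)}ᶜ : Set E), polyFun p x.1 * ψ ‖x.1‖ ∂(volume.comap Subtype.val) := by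
        rw [integral_subtype_comap (measurableSet_singleton _).compl
          fun x : E => polyFun p x * ψ ‖x‖, restrict_compl_singleton]
    _ = ∫ z : USphere n × Set.Ioi (0 : ℝ), polyFun p z.1 * (z.2.1 ^ d * ψ z.2.1)
          ∂((volume : Measure E).toSphere.prod (.volumeIoiPow (Module.finrank ℝ E - 1))) := by
        rw [← (volume : Measure E).measurePreserving_homeomorphUnitSphereProd.integral_comp
          (Homeomorph.measurableEmbedding _)]
        refine integral_congr_ae (Eventually.of_forall fun x => ?_)
        have hx : 0 < ‖x.1‖ := norm_pos_iff.2 x.2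
        simp only [homeomorphUnitSphereProd_apply_fst_coe, homeomorphUnitSphereProd_apply_snd_coe]
        rw [polyFun_smul_arg hp, inv_pow]
        field_simp
    _ = sphereIntegral p * ∫ r : Set.Ioi (0 : ℝ), r.1 ^ d * ψ r.1
          ∂(Measure.volumeIoiPow (Module.finrank ℝ E - 1)) :=
        integral_prod_mul (fun ξ : USphere n => polyFun p (ξ : E))
          fun r : Set.Ioi (0 : ℝ) => r.1 ^ d * ψ r.1
    _ = _ := by
        congr 1
        simp only [Measure.volumeIoiPow, ENNReal.ofReal]
        rw [integral_withDensity_eq_integral_smul,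
          integral_subtype_comap measurableSet_Ioi fun a : ℝ =>
            Real.toNNReal (a ^ (Module.finrank ℝ E - 1)) • (a ^ d * ψ a)]
        · refine setIntegral_congr_fun measurableSet_Ioi fun x hx => ?_
          have hx : 0 < x := hx
          simp only [NNReal.smul_def]
          rw [Real.coe_toNNReal _ (pow_nonneg hx.le _), hdim, smul_eq_mul]
          ring
        · exact (measurable_subtype_coe.pow_const _).real_toNNReal

/-! ### Integration by parts on the sphere by means of a radial cutoff -/

/-- A smooth cutoff function. -/
def cutoff (t : ℝ) : ℝ := Real.smoothTransition (2 - t)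

lemma contDiff_cutoff : ContDiff ℝ 1 cutoff :=
  (Real.smoothTransition.contDiff).comp (contDiff_const.sub contDiff_id)

lemma cutoff_nonneg (t : ℝ) : 0 ≤ cutoff t := Real.smoothTransition.nonneg _

lemma cutoff_eq_one {t : ℝ} (ht : t ≤ 1) : cutoff t = 1 :=
  Real.smoothTransition.one_of_one_le (by linarith)

lemma cutoff_eq_zero {t : ℝ} (ht : 2 ≤ t) : cutoff t = 0 :=
  Real.smoothTransition.zero_of_nonpos (by linarith)

lemma deriv_cutoff_eq_zero {t : ℝ} (ht : 2 < t) : deriv cutoff t = 0 := by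
  have : cutoff =ᶠ[𝓝 t] fun _ => 0 := by
    filter_upwards [lt_mem_nhds ht] with x hx using cutoff_eq_zero hx.le
  rw [this.deriv_eq, deriv_const]

lemma continuous_deriv_cutoff : Continuous (deriv cutoff) :=
  contDiff_cutoff.continuous_deriv le_rfl

lemma hasDerivAt_cutoff (t : ℝ) : HasDerivAt cutoff (deriv cutoff t) t :=
  (contDiff_cutoff.differentiable one_ne_zero t).hasDerivAt

lemma integrable_of_eq_zero_of_two_lt {E : Type*} [NormedAddCommGroup E]
    [NormedSpace ℝ E] [FiniteDimensional ℝ E] [MeasurableSpace E] [BorelSpace E]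
    {μ : Measure E} [IsFiniteMeasureOnCompacts μ] {f : E → ℝ} (hf : Continuous f)
    (h : ∀ x, 2 < ‖x‖ → f x = 0) : Integrable f μ := by
  have := FiniteDimensional.proper_real E
  refine hf.integrable_of_hasCompactSupport
    (HasCompactSupport.of_support_subset_isCompact (isCompact_closedBall (0 : E) 2) fun x hx => ?_)
  by_contra hx2
  exact hx (h x (by simpa using hx2))

lemma two_lt_sq {t : ℝ} (ht : 2 < t) : 2 < t ^ 2 := by nlinarith

/-- The derivative of `r^k cutoff (r²)` integrates to zero: `k ≥ 1` kills the value at `0`, and the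
cutoff kills the one at infinity. -/
lemma integral_cutoff_parts {k : ℕ} (hk : 1 ≤ k) :
    ∫ r in Set.Ioi (0 : ℝ), r ^ (k + 1) * (2 * deriv cutoff (r ^ 2))
      = -(k * ∫ r in Set.Ioi (0 : ℝ), r ^ (k - 1) * cutoff (r ^ 2)) := by
  have hc := contDiff_cutoff.continuous
  have hc' := continuous_deriv_cutoff
  have i1 : IntegrableOn (fun r : ℝ => r ^ (k + 1) * (2 * deriv cutoff (r ^ 2))) (Set.Ioi 0) := by
    refine IntegrableOn.congr_fun (f := fun r : ℝ => |r| ^ (k + 1) * (2 * deriv cutoff (r ^ 2)))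
      (Integrable.integrableOn ?_) (fun r hr => by
        simp only; rw [abs_of_pos hr]) measurableSet_Ioi
    refine integrable_of_eq_zero_of_two_lt (by fun_prop) fun x hx => ?_
    rw [← sq_abs, ← Real.norm_eq_abs, deriv_cutoff_eq_zero (two_lt_sq hx)]; simp
  have i2 : IntegrableOn (fun r : ℝ => k * (r ^ (k - 1) * cutoff (r ^ 2))) (Set.Ioi 0) := by
    refine Integrable.integrableOn (integrable_of_eq_zero_of_two_lt (by fun_prop) fun x hx => ?_)
    rw [← sq_abs, ← Real.norm_eq_abs, cutoff_eq_zero (two_lt_sq hx).le]; simp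
  have hder : ∀ r ∈ Set.Ioi (0 : ℝ), HasDerivAt (fun r : ℝ => r ^ k * cutoff (r ^ 2))
      (r ^ (k + 1) * (2 * deriv cutoff (r ^ 2)) + k * (r ^ (k - 1) * cutoff (r ^ 2))) r := by
    intro r _
    refine ((hasDerivAt_pow k r).mul
      ((hasDerivAt_cutoff (r ^ 2)).comp r (hasDerivAt_pow 2 r))).congr_deriv ?_
    simp only [Function.comp_apply, Nat.cast_ofNat]
    ring
  have hFTC := integral_Ioi_of_hasDerivAt_of_tendsto (a := 0) (m := 0)
    (f := fun r : ℝ => r ^ k * cutoff (r ^ 2))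
    ((by fun_prop : Continuous fun r : ℝ => r ^ k * cutoff (r ^ 2)).continuousWithinAt) hder
    (i1.add i2) (tendsto_const_nhds.congr' ?_)
  · rw [integral_add i1 i2, integral_const_mul] at hFTC
    rw [zero_pow (by omega), zero_mul, sub_zero] at hFTC
    linarith
  · filter_upwards [eventually_gt_atTop 2] with r hr
    rw [cutoff_eq_zero (two_lt_sq hr).le, mul_zero]

lemma integral_cutoff_pos (k : ℕ) : 0 < ∫ r in Set.Ioi (0 : ℝ), r ^ k * cutoff (r ^ 2) := by
  have hc := contDiff_cutoff.continuous
  have hi : IntegrableOn (fun r : ℝ => r ^ k * cutoff (r ^ 2)) (Set.Ioi 0) := by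
    refine Integrable.integrableOn (integrable_of_eq_zero_of_two_lt (by fun_prop) fun x hx => ?_)
    rw [← sq_abs, ← Real.norm_eq_abs, cutoff_eq_zero (two_lt_sq hx).le]; simp
  rw [setIntegral_pos_iff_support_of_nonneg_ae _ hi]
  · refine lt_of_lt_of_le ?_ (measure_mono (s := Set.Ioo (0 : ℝ) 1) fun r hr => ⟨?_, hr.1⟩)
    · simp
    · have h1 : r ^ 2 ≤ 1 := by nlinarith [hr.1, hr.2]
      rw [Function.mem_support, cutoff_eq_one h1, mul_one]
      exact (pow_pos hr.1 k).ne'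
  · filter_upwards [ae_restrict_mem measurableSet_Ioi] with r hr
    exact mul_nonneg (pow_nonneg (le_of_lt hr) _) (cutoff_nonneg _)

/-- The divergence theorem for homogeneous polynomials on the sphere. -/
theorem sphereIntegral_X_mul (hn : 2 ≤ n) {p : MvPolynomial (Fin n) ℝ} {d : ℕ}
    (hp : p.IsHomogeneous d) (i : Fin n) :
    ((d : ℝ) + n - 1) * sphereIntegral (MvPolynomial.X i * p)
      = sphereIntegral (MvPolynomial.pderiv i p) := by
  have hc := contDiff_cutoff.continuous
  have hc' := continuous_deriv_cutoff
  have hd : ∀ x : EuclideanSpace ℝ (Fin n), HasFDerivAt (fun x => cutoff (‖x‖ ^ 2))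
      (deriv cutoff (‖x‖ ^ 2) • (2 • innerSL ℝ x)) x := fun x =>
    HasDerivAt.comp_hasFDerivAt (h₂ := cutoff) (f := fun x : EuclideanSpace ℝ (Fin n) => ‖x‖ ^ 2)
      x (hasDerivAt_cutoff (‖x‖ ^ 2)) (hasStrictFDerivAt_norm_sq x).hasFDerivAt
  have hdv : ∀ x : EuclideanSpace ℝ (Fin n),
      fderiv ℝ (fun x => cutoff (‖x‖ ^ 2)) x (EuclideanSpace.single i 1)
        = x i * (2 * deriv cutoff (‖x‖ ^ 2)) := fun x => by
    rw [(hd x).fderiv]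
    simp [EuclideanSpace.inner_single_right]
    ring
  have cp := continuous_polyFun p
  have cp' := continuous_polyFun (MvPolynomial.pderiv i p)
  -- Integration by parts over `ℝⁿ` moves `∂_i` from the radial cutoff to `p`. In polar coordinates
  -- both sides contain the same positive radial integral, the left one with the factor `d + n - 1`;
  -- cancelling it leaves the identity on the sphere.
  have hibp := integral_mul_fderiv_eq_neg_fderiv_mul_of_integrable (μ := volume)
    (f := polyFun p) (g := fun x : EuclideanSpace ℝ (Fin n) => cutoff (‖x‖ ^ 2))
    (v := EuclideanSpace.single i 1) ?_ ?_ ?_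
    (fun x _ => (hasGradientAt_polyFun p x).differentiableAt)
    (fun x _ => (hd x).differentiableAt)
  · simp only [hdv, fderiv_polyFun_single] at hibp
    have e1 : ∀ x : EuclideanSpace ℝ (Fin n), polyFun p x * (x i * (2 * deriv cutoff (‖x‖ ^ 2)))
        = polyFun (MvPolynomial.X i * p) x * (2 * deriv cutoff (‖x‖ ^ 2)) := fun x => by
      simp; ring
    simp only [e1] at hibp
    have hXp : (MvPolynomial.X i * p).IsHomogeneous (1 + d) :=
      (MvPolynomial.isHomogeneous_X ℝ i).mul hp
    rw [integral_polyFun_mul_radial (by omega) hXp (fun r => 2 * deriv cutoff (r ^ 2)),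
      show 1 + d + (n - 1) = (d + (n - 1)) + 1 by ring, integral_cutoff_parts (by omega)] at hibp
    have hcast : ((d + (n - 1) : ℕ) : ℝ) = d + n - 1 := by
      rw [Nat.cast_add, Nat.cast_sub (by omega)]; push_cast; ring
    rw [hcast] at hibp
    have hpos := integral_cutoff_pos (d + (n - 1) - 1)
    have hpd : ∫ x : EuclideanSpace ℝ (Fin n), polyFun (MvPolynomial.pderiv i p) x *
        cutoff (‖x‖ ^ 2) = sphereIntegral (MvPolynomial.pderiv i p) *
          ∫ r in Set.Ioi (0 : ℝ), r ^ (d + (n - 1) - 1) * cutoff (r ^ 2) := by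
      -- The degree `d - 1` of the derivative is a truncated subtraction, so constant `p` is treated
      -- apart.
      rcases Nat.eq_zero_or_pos d with h0 | h0
      · have hz : MvPolynomial.pderiv i p = 0 := by
          rw [h0, ← MvPolynomial.totalDegree_zero_iff_isHomogeneous,
            MvPolynomial.totalDegree_eq_zero_iff_eq_C] at hp
          rw [hp, MvPolynomial.pderiv_C]
        simp [hz]
      · rw [integral_polyFun_mul_radial (by omega) hp.pderiv (fun r => cutoff (r ^ 2)),
          show d - 1 + (n - 1) = d + (n - 1) - 1 by omega]
    rw [hpd] at hibp
    refine mul_right_cancel₀ hpos.ne' ?_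
    linarith
  · simp only [fderiv_polyFun_single]
    refine integrable_of_eq_zero_of_two_lt (by fun_prop) fun x hx => ?_
    rw [cutoff_eq_zero (two_lt_sq hx).le, mul_zero]
  · simp only [hdv]
    refine integrable_of_eq_zero_of_two_lt (by fun_prop) fun x hx => ?_
    rw [deriv_cutoff_eq_zero (two_lt_sq hx)]; simp
  · refine integrable_of_eq_zero_of_two_lt (by fun_prop) fun x hx => ?_
    rw [cutoff_eq_zero (two_lt_sq hx).le, mul_zero]

end PolyFun

end

noncomputable section

/-! ### Moments of solid harmonics against powers of a linear form -/

section Moments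

variable {n : ℕ}

/-- The Laplacian of a polynomial. -/
def polyLap (p : MvPolynomial (Fin n) ℝ) : MvPolynomial (Fin n) ℝ :=
  ∑ i, MvPolynomial.pderiv i (MvPolynomial.pderiv i p)

/-- The linear form `ξ ↦ x · ξ`. -/
def linForm (x : EuclideanSpace ℝ (Fin n)) : MvPolynomial (Fin n) ℝ :=
  ∑ i, x i • MvPolynomial.X i

/-- The derivative of a polynomial in the direction `x`. -/
def dirDeriv (x : EuclideanSpace ℝ (Fin n)) (p : MvPolynomial (Fin n) ℝ) :
    MvPolynomial (Fin n) ℝ :=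
  ∑ i, x i • MvPolynomial.pderiv i p

lemma pderiv_pderiv_comm (i j : Fin n) (p : MvPolynomial (Fin n) ℝ) :
    MvPolynomial.pderiv i (MvPolynomial.pderiv j p)
      = MvPolynomial.pderiv j (MvPolynomial.pderiv i p) := by
  have h : ⁅(MvPolynomial.pderiv i : Derivation ℝ (MvPolynomial (Fin n) ℝ) _), 
      (MvPolynomial.pderiv j : Derivation ℝ (MvPolynomial (Fin n) ℝ) _)⁆ = 0 := by
    refine MvPolynomial.derivation_ext fun k => ?_
    rw [Derivation.commutator_apply]
    simp only [MvPolynomial.pderiv_X, Pi.single_apply]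
    split_ifs <;> simp
  have h2 := congrArg (fun D => D p) h
  simp only [Derivation.commutator_apply, Derivation.coe_zero, Pi.zero_apply] at h2
  exact sub_eq_zero.1 h2

lemma polyLap_pderiv (i : Fin n) (p : MvPolynomial (Fin n) ℝ) :
    polyLap (MvPolynomial.pderiv i p) = MvPolynomial.pderiv i (polyLap p) := by
  simp only [polyLap, map_sum]
  refine Finset.sum_congr rfl fun j _ => ?_
  rw [pderiv_pderiv_comm j i p, pderiv_pderiv_comm j i]

lemma polyLap_smul (a : ℝ) (p : MvPolynomial (Fin n) ℝ) : polyLap (a • p) = a • polyLap p := by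
  simp [polyLap, Finset.smul_sum]

lemma polyLap_sum {ι : Type*} (s : Finset ι) (p : ι → MvPolynomial (Fin n) ℝ) :
    polyLap (∑ i ∈ s, p i) = ∑ i ∈ s, polyLap (p i) := by
  simp only [polyLap, map_sum]
  exact Finset.sum_comm

lemma polyLap_dirDeriv (x : EuclideanSpace ℝ (Fin n)) {p : MvPolynomial (Fin n) ℝ}
    (hp : polyLap p = 0) : polyLap (dirDeriv x p) = 0 := by
  simp [dirDeriv, polyLap_sum, polyLap_smul, polyLap_pderiv, hp]

lemma isHomogeneous_smul {p : MvPolynomial (Fin n) ℝ} {d : ℕ} (hp : p.IsHomogeneous d) (a : ℝ) :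
    (a • p).IsHomogeneous d :=
  (MvPolynomial.homogeneousSubmodule (Fin n) ℝ d).smul_mem a hp

lemma isHomogeneous_dirDeriv (x : EuclideanSpace ℝ (Fin n)) {p : MvPolynomial (Fin n) ℝ} {d : ℕ}
    (hp : p.IsHomogeneous d) : (dirDeriv x p).IsHomogeneous (d - 1) :=
  MvPolynomial.IsHomogeneous.sum _ _ _ fun _ _ => isHomogeneous_smul hp.pderiv _

lemma isHomogeneous_linForm (x : EuclideanSpace ℝ (Fin n)) : (linForm x).IsHomogeneous 1 :=
  MvPolynomial.IsHomogeneous.sum _ _ _ fun i _ =>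
    isHomogeneous_smul (MvPolynomial.isHomogeneous_X ℝ i) _

lemma pderiv_linForm (x : EuclideanSpace ℝ (Fin n)) (i : Fin n) :
    MvPolynomial.pderiv i (linForm x) = MvPolynomial.C (x i) := by
  simp only [linForm, map_sum, Derivation.map_smul, MvPolynomial.pderiv_X, Pi.single_apply]
  simp [Finset.sum_ite_eq', MvPolynomial.smul_eq_C_mul]

lemma polyFun_linForm (x ξ : EuclideanSpace ℝ (Fin n)) : polyFun (linForm x) ξ = inner ℝ x ξ := by
  simp [linForm, PiLp.inner_apply, mul_comm]

lemma euler_polyFun {p : MvPolynomial (Fin n) ℝ} {d : ℕ} (hp : p.IsHomogeneous d)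
    (x : EuclideanSpace ℝ (Fin n)) :
    ∑ i, x i * polyFun (MvPolynomial.pderiv i p) x = d * polyFun p x := by
  have h := congrArg (fun q => polyFun q x) hp.sum_X_mul_pderiv
  simpa using h

lemma polyFun_dirDeriv_self {p : MvPolynomial (Fin n) ℝ} {d : ℕ} (hp : p.IsHomogeneous d)
    (x : EuclideanSpace ℝ (Fin n)) : polyFun (dirDeriv x p) x = d * polyFun p x := by
  simp [dirDeriv, euler_polyFun hp]

lemma eq_C_of_isHomogeneous_zero {p : MvPolynomial (Fin n) ℝ} (hp : p.IsHomogeneous 0) :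
    ∃ a, p = MvPolynomial.C a := by
  rw [← MvPolynomial.totalDegree_zero_iff_isHomogeneous,
    MvPolynomial.totalDegree_eq_zero_iff_eq_C] at hp
  exact ⟨_, hp⟩

/-- The divergence identity for `(x·ξ)^m p`, multiplied by `x_i` and summed over `i`. For `m = 0`
the truncated exponent `m - 1` is harmless because of the factor `m`. -/
lemma sphereIntegral_linForm_pow_succ (hn : 2 ≤ n) {p : MvPolynomial (Fin n) ℝ} {l : ℕ}
    (hp : p.IsHomogeneous l) (x : EuclideanSpace ℝ (Fin n)) (m : ℕ) :
    ((m : ℝ) + l + n - 1) * sphereIntegral (linForm x ^ (m + 1) * p)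
      = m * ‖x‖ ^ 2 * sphereIntegral (linForm x ^ (m - 1) * p)
        + sphereIntegral (linForm x ^ m * dirDeriv x p) := by
  have hq : (linForm x ^ m * p).IsHomogeneous (m + l) := by
    simpa using ((isHomogeneous_linForm x).pow m).mul hp
  have e1 : linForm x ^ (m + 1) * p
      = ∑ i, x i • (MvPolynomial.X i * (linForm x ^ m * p)) := by
    have : linForm x ^ (m + 1) * p = linForm x * (linForm x ^ m * p) := by ring
    rw [this]
    nth_rewrite 1 [linForm]
    rw [Finset.sum_mul]
    exact Finset.sum_congr rfl fun i _ => smul_mul_assoc _ _ _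
  have e2 : ∀ i, MvPolynomial.pderiv i (linForm x ^ m * p)
      = (m * x i) • (linForm x ^ (m - 1) * p) + linForm x ^ m * MvPolynomial.pderiv i p := by
    intro i
    rw [Derivation.leibniz, Derivation.leibniz_pow, pderiv_linForm, MvPolynomial.smul_eq_C_mul,
      MvPolynomial.C_mul, map_natCast]
    simp only [smul_eq_mul, nsmul_eq_mul]
    ring
  have e3 : ‖x‖ ^ 2 = ∑ i, x i * x i := by
    rw [EuclideanSpace.real_norm_sq_eq]
    exact Finset.sum_congr rfl fun i _ => sq _
  rw [e1, sphereIntegral_sum, Finset.mul_sum]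
  have e4 : ∀ i, ((m : ℝ) + l + n - 1) * sphereIntegral (x i • (MvPolynomial.X i *
      (linForm x ^ m * p))) = x i * x i * (m * sphereIntegral (linForm x ^ (m - 1) * p))
        + x i * sphereIntegral (linForm x ^ m * MvPolynomial.pderiv i p) := by
    intro i
    have h := sphereIntegral_X_mul hn hq i
    rw [e2, sphereIntegral_add, sphereIntegral_smul, Nat.cast_add] at h
    rw [sphereIntegral_smul]
    linear_combination x i * h
  rw [Finset.sum_congr rfl fun i _ => e4 i, Finset.sum_add_distrib, ← Finset.sum_mul, ← e3,
    dirDeriv, Finset.mul_sum, sphereIntegral_sum]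
  congr 1
  · ring
  · refine Finset.sum_congr rfl fun i _ => ?_
    rw [mul_smul_comm, sphereIntegral_smul]

/-- By Euler's identity `l p = ∑ X_i ∂_i p`, and the divergence identity turns the integral of the
right side into a multiple of the integral of `Δp`. -/
lemma sphereIntegral_harmonic_eq_zero (hn : 2 ≤ n) {p : MvPolynomial (Fin n) ℝ} {l : ℕ}
    (hp : p.IsHomogeneous l) (hl : 1 ≤ l) (hΔ : polyLap p = 0) : sphereIntegral p = 0 := by
  have h1 : ∑ i, ((l - 1 : ℕ) + (n : ℝ) - 1) *
      sphereIntegral (MvPolynomial.X i * MvPolynomial.pderiv i p) = 0 := by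
    rw [Finset.sum_congr rfl fun i _ => sphereIntegral_X_mul hn hp.pderiv i, ← sphereIntegral_sum]
    change sphereIntegral (polyLap p) = 0
    rw [hΔ, sphereIntegral_zero]
  rw [← Finset.mul_sum, ← sphereIntegral_sum, hp.sum_X_mul_pderiv, ← Nat.cast_smul_eq_nsmul ℝ,
    sphereIntegral_smul, Nat.cast_sub hl] at h1
  have hn' : (2 : ℝ) ≤ n := by exact_mod_cast hn
  have hl' : (1 : ℝ) ≤ l := by exact_mod_cast hl
  have hc : (l : ℝ) - (1 : ℕ) + n - 1 ≠ 0 := by push_cast; linarith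
  exact (mul_eq_zero.1 ((mul_eq_zero.1 h1).resolve_left hc)).resolve_left (by linarith)

/-- The coefficients of the moments of the spherical harmonics. -/
def momentCoeff (n l k : ℕ) : ℝ :=
  2 * Real.pi ^ ((n : ℝ) / 2) * (l + 2 * k).factorial /
    (4 ^ k * 2 ^ l * k.factorial * Real.Gamma (l + k + (n : ℝ) / 2))

lemma sphereIntegral_one (hn : 2 ≤ n) :
    sphereIntegral (1 : MvPolynomial (Fin n) ℝ) = momentCoeff n 0 0 := by
  have : Nonempty (Fin n) := ⟨⟨0, by omega⟩⟩
  have hn0 : (0 : ℝ) < (n : ℝ) / 2 := by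
    have : (2 : ℝ) ≤ n := by exact_mod_cast hn
    linarith
  have hG := Real.Gamma_pos_of_pos hn0
  simp only [sphereIntegral, polyFun_one, integral_const, smul_eq_mul, mul_one]
  rw [areaMeasure, Measure.toSphere_real_apply_univ, Measure.real, EuclideanSpace.volume_ball,
    finrank_euclideanSpace, Fintype.card_fin, Real.Gamma_add_one hn0.ne', momentCoeff]
  rw [ENNReal.ofReal_one, one_pow, one_mul, ENNReal.toReal_ofReal (by positivity),
    Real.sqrt_eq_rpow, ← Real.rpow_natCast, ← Real.rpow_mul Real.pi_pos.le]
  simp only [Nat.cast_zero, zero_add, mul_zero, Nat.factorial_zero, Nat.cast_one, pow_zero]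
  rw [show (1 / 2 : ℝ) * n = n / 2 by ring]
  have : (n : ℝ) ≠ 0 := by positivity
  field_simp

/-- Together with the next two lemmas, this is the moment recursion expressed for the coefficients:
its edges `k = 0` and `l = 0`, where one of the two terms is absent, and its interior. -/
lemma momentCoeff_succ_zero (hn : 2 ≤ n) (l : ℕ) :
    (2 * (l : ℝ) + n) * momentCoeff n (l + 1) 0 = (l + 1) * momentCoeff n l 0 := by
  have hn0 : (0 : ℝ) < (n : ℝ) / 2 := by positivity
  have h0 : (0 : ℝ) < l + (n : ℝ) / 2 := by positivity
  have hG := Real.Gamma_pos_of_pos h0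
  have e : ((l + 1 : ℕ) : ℝ) + (0 : ℕ) + (n : ℝ) / 2 = l + (n : ℝ) / 2 + 1 := by push_cast; ring
  have e2 : (l : ℝ) + (0 : ℕ) + (n : ℝ) / 2 = l + (n : ℝ) / 2 := by push_cast; ring
  rw [momentCoeff, momentCoeff, e, e2, Real.Gamma_add_one h0.ne',
    show l + 1 + 2 * 0 = l + 1 by ring, Nat.factorial_succ, pow_succ]
  simp only [mul_zero, add_zero, Nat.factorial_zero, pow_zero, Nat.cast_mul,
    Nat.cast_succ]
  field_simp

lemma momentCoeff_zero_succ (hn : 2 ≤ n) (k : ℕ) :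
    (2 * (k : ℝ) + n) * momentCoeff n 0 (k + 1) = (2 * k + 1) * momentCoeff n 0 k := by
  have hn0 : (0 : ℝ) < (n : ℝ) / 2 := by positivity
  have h0 : (0 : ℝ) < k + (n : ℝ) / 2 := by positivity
  have hG := Real.Gamma_pos_of_pos h0
  have e : ((0 : ℕ) : ℝ) + (k + 1 : ℕ) + (n : ℝ) / 2 = k + (n : ℝ) / 2 + 1 := by push_cast; ring
  have e2 : ((0 : ℕ) : ℝ) + k + (n : ℝ) / 2 = k + (n : ℝ) / 2 := by push_cast; ring
  rw [momentCoeff, momentCoeff, e, e2, Real.Gamma_add_one h0.ne',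
    show 0 + 2 * (k + 1) = 2 * k + 1 + 1 by ring, Nat.factorial_succ, Nat.factorial_succ (2 * k),
    Nat.factorial_succ k, pow_succ, zero_add]
  push_cast
  field_simp
  ring

lemma momentCoeff_succ_succ (hn : 2 ≤ n) (l k : ℕ) :
    (2 * (l : ℝ) + 2 * k + n + 2) * momentCoeff n (l + 1) (k + 1)
      = (l + 2 * k + 2) * momentCoeff n (l + 1) k + (l + 1) * momentCoeff n l (k + 1) := by
  have hn0 : (0 : ℝ) < (n : ℝ) / 2 := by positivity
  have h0 : (0 : ℝ) < l + k + 1 + (n : ℝ) / 2 := by positivity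
  have hG := Real.Gamma_pos_of_pos h0
  have e : ((l + 1 : ℕ) : ℝ) + (k + 1 : ℕ) + (n : ℝ) / 2 = l + k + 1 + (n : ℝ) / 2 + 1 := by
    push_cast; ring
  have e2 : ((l + 1 : ℕ) : ℝ) + k + (n : ℝ) / 2 = l + k + 1 + (n : ℝ) / 2 := by push_cast; ring
  have e3 : (l : ℝ) + (k + 1 : ℕ) + (n : ℝ) / 2 = l + k + 1 + (n : ℝ) / 2 := by push_cast; ring
  rw [momentCoeff, momentCoeff, momentCoeff, e, e2, e3, Real.Gamma_add_one h0.ne',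
    show l + 1 + 2 * (k + 1) = l + 2 * k + 1 + 1 + 1 by ring,
    show l + 1 + 2 * k = l + 2 * k + 1 by ring, show l + 2 * (k + 1) = l + 2 * k + 1 + 1 by ring,
    Nat.factorial_succ (l + 2 * k + 1 + 1), Nat.factorial_succ (l + 2 * k + 1),
    Nat.factorial_succ k, pow_succ, pow_succ]
  push_cast
  field_simp
  ring

/-- The moments of a spherical harmonic. -/
theorem sphereIntegral_linForm_pow_mul (hn : 2 ≤ n) (m : ℕ) :
    ∀ (l : ℕ) (p : MvPolynomial (Fin n) ℝ), p.IsHomogeneous l → polyLap p = 0 →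
      ∀ x : EuclideanSpace ℝ (Fin n),
      (∀ k, m = l + 2 * k → sphereIntegral (linForm x ^ m * p)
        = momentCoeff n l k * ‖x‖ ^ (2 * k) * polyFun p x) ∧
      ((∀ k, m ≠ l + 2 * k) → sphereIntegral (linForm x ^ m * p) = 0) := by
  have hn' : (2 : ℝ) ≤ n := by exact_mod_cast hn
  induction m using Nat.strong_induction_on with
  | _ m ih =>
  intro l p hp hΔ x
  rcases Nat.eq_zero_or_pos m with rfl | hm
  · rw [pow_zero, one_mul]
    refine ⟨fun k hk => ?_, fun h => ?_⟩
    · obtain rfl : l = 0 := by omega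
      obtain rfl : k = 0 := by omega
      obtain ⟨a, rfl⟩ := eq_C_of_isHomogeneous_zero hp
      rw [show (MvPolynomial.C a : MvPolynomial (Fin n) ℝ) = a • 1 by
        rw [MvPolynomial.smul_eq_C_mul, mul_one], sphereIntegral_smul, sphereIntegral_one hn]
      simp [mul_comm]
    · refine sphereIntegral_harmonic_eq_zero hn hp ?_ hΔ
      have := h 0
      omega
  · obtain ⟨m, rfl⟩ : ∃ j, m = j + 1 := ⟨m - 1, by omega⟩
    have hrec := sphereIntegral_linForm_pow_succ hn hp x m
    have hpos : (m : ℝ) + l + n - 1 ≠ 0 := by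
      have h1 : (0 : ℝ) ≤ m := by positivity
      have h2 : (0 : ℝ) ≤ l := by positivity
      intro h; linarith
    have hD := ih m (by omega) (l - 1) (dirDeriv x p) (isHomogeneous_dirDeriv x hp)
      (polyLap_dirDeriv x hΔ) x
    rw [polyFun_dirDeriv_self hp] at hD
    have hD0 : l = 0 → dirDeriv x p = 0 := by
      rintro rfl
      obtain ⟨a, rfl⟩ := eq_C_of_isHomogeneous_zero hp
      simp [dirDeriv]
    have hS := ih (m - 1) (by omega) l p hp hΔ x
    refine ⟨fun k hk => mul_left_cancel₀ hpos ?_, fun h => ?_⟩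
    · rw [hrec]
      -- For `l = 0` the directional derivative vanishes; for `k = 0` the lower moment has an
      -- exponent too small for the degree, and its coefficient covers the case `m = 0`.
      rcases l with _ | l <;> rcases k with _ | k
      · omega
      · obtain rfl : m = 2 * k + 1 := by omega
        rw [hD0 rfl, mul_zero, sphereIntegral_zero, hS.1 k (by omega)]
        have := momentCoeff_zero_succ hn k
        push_cast
        linear_combination -(‖x‖ ^ (2 * k + 2) * polyFun p x) * this
      · obtain rfl : m = l := by omega
        have h1 : (m : ℝ) * ‖x‖ ^ 2 * sphereIntegral (linForm x ^ (m - 1) * p) = 0 := by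
          rw [hS.2 (by omega), mul_zero]
        rw [h1, hD.1 0 (by omega)]
        have := momentCoeff_succ_zero hn m
        simp only [Nat.add_sub_cancel]
        push_cast
        linear_combination -(polyFun p x) * this
      · obtain rfl : m = l + 2 * k + 2 := by omega
        rw [hS.1 k (by omega), hD.1 (k + 1) (by simp; ring)]
        have := momentCoeff_succ_succ hn l k
        simp only [Nat.add_sub_cancel]
        push_cast
        linear_combination -(‖x‖ ^ (2 * k + 2) * polyFun p x) * this
    · have h1 : (m : ℝ) * ‖x‖ ^ 2 * sphereIntegral (linForm x ^ (m - 1) * p) = 0 := by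
        rcases Nat.eq_zero_or_pos m with rfl | hm0
        · simp
        · rw [hS.2 fun k hk => h (k + 1) (by omega), mul_zero]
      have h2 : sphereIntegral (linForm x ^ m * dirDeriv x p) = 0 := by
        rcases Nat.eq_zero_or_pos l with h0 | h0
        · rw [hD0 h0, mul_zero, sphereIntegral_zero]
        · exact hD.2 fun k hk => h k (by omega)
      rw [h1, h2, add_zero] at hrec
      exact (mul_eq_zero.1 hrec).resolve_left hpos

end Moments

/-! ### The Fourier transform of a spherical harmonic -/

/-- The radial factor of the Fourier transform of a spherical harmonic of degree `l`. -/
def fourierRadial (n l : ℕ) (r : ℝ) : ℝ :=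
  2 * Real.pi ^ ((n : ℝ) / 2) / 2 ^ l * besselClifford (sphereOrder n l) (r ^ 2 / 4)

/-- In the exponential series only the exponents `m = l + 2k` survive. The factorial `(l+2k)!` of
the moment cancels that of the series, and `(-i)^{l+2k} = (-i)^l (-1)^k` leaves the Bessel series in
`|x|²/4`. -/
theorem integral_cexp_mul_harmonic {n : ℕ} (hn : 2 ≤ n) {l : ℕ} {p : MvPolynomial (Fin n) ℝ}
    (hp : p.IsHomogeneous l) (hΔ : polyLap p = 0) (x : EuclideanSpace ℝ (Fin n)) :
    ∫ ξ : USphere n, Complex.exp (-Complex.I *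
        ((inner ℝ x (ξ : EuclideanSpace ℝ (Fin n)) : ℝ) : ℂ)) *
        (polyFun p (ξ : EuclideanSpace ℝ (Fin n)) : ℂ) ∂(areaMeasure n)
      = (-Complex.I) ^ l * ((fourierRadial n l ‖x‖ * polyFun p x : ℝ) : ℂ) := by
  have hc := continuous_polyFun_sphere p
  have hci : Continuous fun ξ : USphere n => inner ℝ x (ξ : EuclideanSpace ℝ (Fin n)) := by fun_prop
  obtain ⟨K, hK⟩ := isCompact_univ.exists_bound_of_continuousOn hc.continuousOn
  have hsum := hasSum_integral_of_dominated_convergence (μ := areaMeasure n)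
    (F := fun (m : ℕ) (ξ : USphere n) => (-Complex.I) ^ m / m.factorial *
      ((polyFun (linForm x ^ m * p) (ξ : EuclideanSpace ℝ (Fin n)) : ℝ) : ℂ))
    (f := fun ξ => Complex.exp (-Complex.I *
        ((inner ℝ x (ξ : EuclideanSpace ℝ (Fin n)) : ℝ) : ℂ)) *
        (polyFun p (ξ : EuclideanSpace ℝ (Fin n)) : ℂ))
    (fun m _ => ‖x‖ ^ m / m.factorial * K)
    (fun m => ?_) (fun m => ae_of_all _ fun ξ => ?_) (ae_of_all _ fun ξ => ?_) ?_
    (ae_of_all _ fun ξ => ?_)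
  · rw [← hsum.tsum_eq]
    have hterm : ∀ m : ℕ, ∫ ξ : USphere n, (-Complex.I) ^ m / m.factorial *
        ((polyFun (linForm x ^ m * p) (ξ : EuclideanSpace ℝ (Fin n)) : ℝ) : ℂ) ∂(areaMeasure n)
        = (-Complex.I) ^ m / m.factorial * (sphereIntegral (linForm x ^ m * p) : ℝ) := by
      intro m
      rw [integral_const_mul, integral_complex_ofReal, sphereIntegral]
    simp_rw [hterm]
    have hinj : Function.Injective fun k : ℕ => l + 2 * k := fun a b h => by
      simp only at h; omega
    rw [← hinj.tsum_eq (f := fun m : ℕ => (-Complex.I) ^ m / (m.factorial : ℂ) *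
      (sphereIntegral (linForm x ^ m * p) : ℝ))]
    · rw [fourierRadial, besselClifford]
      push_cast
      rw [← tsum_mul_left, ← tsum_mul_right, ← tsum_mul_left]
      refine tsum_congr fun k => ?_
      rw [(sphereIntegral_linForm_pow_mul hn _ l p hp hΔ x).1 k rfl, momentCoeff, besselCoeff,
        show sphereOrder n l + k + 1 = l + k + (n : ℝ) / 2 by rw [sphereOrder]; ring,
        pow_add, pow_mul, neg_sq, Complex.I_sq, div_pow, ← pow_mul]
      have hG : Real.Gamma (l + k + (n : ℝ) / 2) ≠ 0 := by
        have : 0 < (n : ℝ) := by positivity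
        exact (Real.Gamma_pos_of_pos (by positivity)).ne'
      have hG' : (Real.Gamma (l + k + (n : ℝ) / 2) : ℂ) ≠ 0 := by exact_mod_cast hG
      have h1 : ((l + 2 * k).factorial : ℂ) ≠ 0 := by exact_mod_cast (Nat.factorial_pos _).ne'
      have h2 : (k.factorial : ℂ) ≠ 0 := by exact_mod_cast (Nat.factorial_pos _).ne'
      push_cast at *
      field_simp
    · intro m hm
      by_contra hne
      refine hm ?_
      simp only
      rw [(sphereIntegral_linForm_pow_mul hn m l p hp hΔ x).2 fun k hk => hne ⟨k, hk.symm⟩]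
      simp
  · have := continuous_polyFun_sphere (linForm x ^ m * p)
    exact (by fun_prop : Continuous _).aestronglyMeasurable
  · rw [norm_mul, norm_div, norm_pow, norm_neg, Complex.norm_I, one_pow, Complex.norm_natCast,
      Complex.norm_real, polyFun_mul, polyFun_pow, polyFun_linForm, norm_mul, norm_pow]
    have h1 : ‖(inner ℝ x (ξ : EuclideanSpace ℝ (Fin n)) : ℝ)‖ ≤ ‖x‖ := by
      have := norm_inner_le_norm (𝕜 := ℝ) x (ξ : EuclideanSpace ℝ (Fin n))
      rwa [norm_eq_of_mem_sphere, mul_one] at this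
    have h2 := hK ξ (Set.mem_univ _)
    rw [div_mul_eq_mul_div, one_mul, ← mul_div_right_comm]
    gcongr
  · exact (Real.summable_pow_div_factorial ‖x‖).mul_right K
  · exact integrable_const _
  · have h := NormedSpace.expSeries_div_hasSum_exp (𝔸 := ℂ) (-Complex.I *
        ((inner ℝ x (ξ : EuclideanSpace ℝ (Fin n)) : ℝ) : ℂ))
    rw [← Complex.exp_eq_exp_ℂ] at h
    have e : (fun m : ℕ => (-Complex.I) ^ m / m.factorial *
        ((polyFun (linForm x ^ m * p) (ξ : EuclideanSpace ℝ (Fin n)) : ℝ) : ℂ))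
        = fun m : ℕ => (-Complex.I * ((inner ℝ x (ξ : EuclideanSpace ℝ (Fin n)) : ℝ) : ℂ)) ^ m /
          m.factorial * (polyFun p (ξ : EuclideanSpace ℝ (Fin n)) : ℂ) := by
      ext m
      rw [polyFun_mul, polyFun_pow, polyFun_linForm]
      push_cast
      ring
    rw [e]
    exact h.mul_right _

lemma fourierRadial_eq_besselWave {n : ℕ} (l : ℕ) {r : ℝ} (hr : 0 < r) :
    fourierRadial n l r * r ^ l = 2 * (2 * Real.pi) ^ (((n : ℝ) - 1) / 2) / r ^ (((n : ℝ) - 1) / 2)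
      * besselWave (sphereOrder n l) r := by
  have hp := Real.pi_pos
  have e1 : (r / 2) ^ (sphereOrder n l + 1 / 2)
      = r ^ (((n : ℝ) - 1) / 2) / 2 ^ (((n : ℝ) - 1) / 2) * (r ^ l / 2 ^ l) := by
    rw [show sphereOrder n l + 1 / 2 = ((n : ℝ) - 1) / 2 + l by rw [sphereOrder]; ring,
      Real.rpow_add (by positivity), Real.rpow_natCast, div_pow, Real.div_rpow hr.le (by norm_num)]
  have e2 : Real.pi ^ ((n : ℝ) / 2) = Real.pi ^ (((n : ℝ) - 1) / 2) * √Real.pi := by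
    rw [Real.sqrt_eq_rpow, ← Real.rpow_add hp]; congr 1; ring
  have h1 : 0 < r ^ (((n : ℝ) - 1) / 2) := Real.rpow_pos_of_pos hr _
  have h2 : (0 : ℝ) < 2 ^ (((n : ℝ) - 1) / 2) := Real.rpow_pos_of_pos two_pos _
  rw [fourierRadial, besselWave, e1, e2, Real.mul_rpow (by norm_num) hp.le]
  field_simp

end

noncomputable section

section Harmonics

variable {n : ℕ}

/-! ### Polynomials and their restrictions to the sphere -/

lemma polynomial_ext {p q : MvPolynomial (Fin n) ℝ} (h : ∀ x, polyFun p x = polyFun q x) :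
    p = q :=
  MvPolynomial.funext fun x => h (WithLp.toLp 2 x)

lemma polyFun_eq_norm_pow_mul {p : MvPolynomial (Fin n) ℝ} {l : ℕ} (hp : p.IsHomogeneous l)
    {x : EuclideanSpace ℝ (Fin n)} (hx : x ≠ 0) :
    polyFun p x = ‖x‖ ^ l * polyFun p (angle x hx : EuclideanSpace ℝ (Fin n)) := by
  have hx' := norm_ne_zero_iff.2 hx
  rw [← polyFun_smul_arg hp, angle, smul_smul, mul_inv_cancel₀ hx', one_smul]

lemma eq_of_eq_on_sphere (hn : 2 ≤ n) {p q : MvPolynomial (Fin n) ℝ} {l : ℕ}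
    (hp : p.IsHomogeneous l) (hq : q.IsHomogeneous l)
    (h : ∀ ξ : USphere n, polyFun p (ξ : EuclideanSpace ℝ (Fin n)) = polyFun q ξ) : p = q := by
  have h1 : ∀ x : EuclideanSpace ℝ (Fin n), x ≠ 0 → polyFun p x = polyFun q x := fun x hx => by
    rw [polyFun_eq_norm_pow_mul hp hx, polyFun_eq_norm_pow_mul hq hx, h]
  -- After multiplication by a coordinate, equality at the origin is automatic; the coordinate is
  -- then cancelled.
  have h2 : p * MvPolynomial.X ⟨0, by omega⟩ = q * MvPolynomial.X ⟨0, by omega⟩ := by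
    refine polynomial_ext fun x => ?_
    rcases eq_or_ne x 0 with rfl | hx
    · simp
    · simp [h1 x hx]
  exact mul_right_cancel₀ (MvPolynomial.X_ne_zero _) h2

/-! ### The rotation fields -/

/-- The infinitesimal rotation `x_i ∂_j - x_j ∂_i`. -/
def rotField (i j : Fin n) (p : MvPolynomial (Fin n) ℝ) : MvPolynomial (Fin n) ℝ :=
  MvPolynomial.X i * MvPolynomial.pderiv j p - MvPolynomial.X j * MvPolynomial.pderiv i p

lemma rotField_mul (i j : Fin n) (p q : MvPolynomial (Fin n) ℝ) :
    rotField i j (p * q) = p * rotField i j q + q * rotField i j p := by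
  simp only [rotField, Derivation.leibniz, smul_eq_mul]
  ring

lemma rotField_sum {ι : Type*} (i j : Fin n) (s : Finset ι) (p : ι → MvPolynomial (Fin n) ℝ) :
    rotField i j (∑ k ∈ s, p k) = ∑ k ∈ s, rotField i j (p k) := by
  simp [rotField, Finset.mul_sum]

lemma isHomogeneous_rotField (i j : Fin n) {p : MvPolynomial (Fin n) ℝ} {l : ℕ}
    (hp : p.IsHomogeneous l) : (rotField i j p).IsHomogeneous l := by
  rcases l with _ | l
  · obtain ⟨a, rfl⟩ := eq_C_of_isHomogeneous_zero hp
    simp [rotField, MvPolynomial.isHomogeneous_zero]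
  · have h : ∀ i j, (MvPolynomial.X i * MvPolynomial.pderiv j p).IsHomogeneous (l + 1) := by
      intro i j
      have := (MvPolynomial.isHomogeneous_X ℝ i).mul (hp.pderiv (i := j))
      rwa [Nat.add_sub_cancel, add_comm] at this
    exact (h i j).sub (h j i)

lemma polyLap_mul (p q : MvPolynomial (Fin n) ℝ) : polyLap (p * q) =
    p * polyLap q + q * polyLap p +
      2 * ∑ i, MvPolynomial.pderiv i p * MvPolynomial.pderiv i q := by
  simp only [polyLap, Derivation.leibniz, smul_eq_mul, map_add, Finset.mul_sum,
    ← Finset.sum_add_distrib]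
  exact Finset.sum_congr rfl fun i _ => by ring

lemma polyLap_X_mul (i : Fin n) (p : MvPolynomial (Fin n) ℝ) :
    polyLap (MvPolynomial.X i * p) = MvPolynomial.X i * polyLap p + 2 * MvPolynomial.pderiv i p := by
  have h : polyLap (MvPolynomial.X i : MvPolynomial (Fin n) ℝ) = 0 := by
    rw [polyLap]
    refine Finset.sum_eq_zero fun j _ => ?_
    rw [MvPolynomial.pderiv_X, Pi.single_apply]
    split_ifs <;> simp
  rw [polyLap_mul, h, mul_zero, add_zero]
  congr 2
  rw [Finset.sum_eq_single i]
  · simp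
  · intro j _ hj
    rw [MvPolynomial.pderiv_X_of_ne hj.symm, zero_mul]
  · simp

lemma polyLap_sub (p q : MvPolynomial (Fin n) ℝ) : polyLap (p - q) = polyLap p - polyLap q := by
  simp [polyLap, Finset.sum_sub_distrib]

lemma polyLap_rotField (i j : Fin n) {p : MvPolynomial (Fin n) ℝ} (hp : polyLap p = 0) :
    polyLap (rotField i j p) = 0 := by
  rw [rotField, polyLap_sub, polyLap_X_mul, polyLap_X_mul, polyLap_pderiv, polyLap_pderiv, hp,
    pderiv_pderiv_comm i j]
  simp

lemma sphereIntegral_sub (p q : MvPolynomial (Fin n) ℝ) :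
    sphereIntegral (p - q) = sphereIntegral p - sphereIntegral q := by
  rw [sub_eq_add_neg, ← neg_one_smul ℝ q, sphereIntegral_add, sphereIntegral_smul]
  ring

/-- The divergence identity turns both terms into integrals of the same mixed second derivative.
With the Leibniz rule, this makes rotation fields skew-adjoint. -/
lemma sphereIntegral_rotField (hn : 2 ≤ n) (i j : Fin n) {p : MvPolynomial (Fin n) ℝ} {d : ℕ}
    (hp : p.IsHomogeneous d) : sphereIntegral (rotField i j p) = 0 := by
  have h1 := sphereIntegral_X_mul hn (hp.pderiv (i := j)) i
  have h2 := sphereIntegral_X_mul hn (hp.pderiv (i := i)) j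
  rw [pderiv_pderiv_comm] at h1
  have hn' : (2 : ℝ) ≤ n := by exact_mod_cast hn
  have hd : (0 : ℝ) ≤ (d - 1 : ℕ) := by positivity
  have hc : ((d - 1 : ℕ) : ℝ) + n - 1 ≠ 0 := by intro h; linarith
  rw [rotField, sphereIntegral_sub]
  refine mul_left_cancel₀ hc ?_
  rw [mul_sub, h1, h2, sub_self, mul_zero]

lemma sphereIntegral_rotField_mul (hn : 2 ≤ n) (i j : Fin n) {p q : MvPolynomial (Fin n) ℝ}
    {d e : ℕ} (hp : p.IsHomogeneous d) (hq : q.IsHomogeneous e) :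
    sphereIntegral (rotField i j p * q) = -sphereIntegral (rotField i j q * p) := by
  have h := sphereIntegral_rotField hn i j (hp.mul hq)
  rw [rotField_mul, sphereIntegral_add, mul_comm p, mul_comm q] at h
  linarith

/-! ### The addition theorem on the diagonal -/

/-- A polynomial annihilated by the rotation fields is a multiple of a power of the norm. -/
lemma exists_eq_norm_pow_of_rotField (hn : 2 ≤ n) {p : MvPolynomial (Fin n) ℝ} {l : ℕ}
    (hp : p.IsHomogeneous (2 * l)) (hrot : ∀ i j, rotField i j p = 0) :
    ∃ κ : ℝ, ∀ x : EuclideanSpace ℝ (Fin n), x ≠ 0 → polyFun p x = κ * (‖x‖ ^ 2) ^ l := by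
  -- Invariance under rotations makes the gradient parallel to `x`, and Euler's identity fixes the
  -- factor. Hence `p |x|^{-2l}` has zero derivative away from the origin.
  have hgrad : ∀ x : EuclideanSpace ℝ (Fin n),
      ‖x‖ ^ 2 • polyGrad p x = (2 * l * polyFun p x) • x := by
    intro x
    ext j
    have h1 : ∀ i, x i * polyFun (MvPolynomial.pderiv j p) x
        = x j * polyFun (MvPolynomial.pderiv i p) x := fun i => by
      have := congrArg (fun q => polyFun q x) (hrot i j)
      simp only [rotField, polyFun_sub, polyFun_mul, polyFun_X, polyFun_zero] at this
      linarith
    have h2 := euler_polyFun hp x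
    push_cast at h2
    simp only [PiLp.smul_apply, smul_eq_mul, polyGrad_apply]
    rw [← h2, EuclideanSpace.real_norm_sq_eq, Finset.sum_mul, Finset.sum_mul]
    refine Finset.sum_congr rfl fun i _ => ?_
    linear_combination x i * h1 i
  have hder : ∀ x : EuclideanSpace ℝ (Fin n), x ≠ 0 →
      HasFDerivAt (fun x => polyFun p x * (‖x‖ ^ 2) ^ (-(l : ℤ)))
        (0 : EuclideanSpace ℝ (Fin n) →L[ℝ] ℝ) x := by
    intro x hx
    have hx2 : ‖x‖ ^ 2 ≠ 0 := pow_ne_zero 2 (norm_ne_zero_iff.2 hx)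
    have d1 := HasDerivAt.comp_hasFDerivAt (h₂ := fun t : ℝ => t ^ (-(l : ℤ)))
      (f := fun x : EuclideanSpace ℝ (Fin n) => ‖x‖ ^ 2)
      x (hasDerivAt_zpow (-(l : ℤ)) (‖x‖ ^ 2) (Or.inl hx2))
      (hasStrictFDerivAt_norm_sq x).hasFDerivAt
    refine ((hasGradientAt_polyFun p x).hasFDerivAt.mul d1).congr_fderiv ?_
    ext v
    have h3 := congrArg (fun y => inner ℝ y v) (hgrad x)
    simp only [inner_smul_left, RCLike.conj_to_real] at h3
    simp only [Function.comp_apply, add_apply, smul_apply,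
      InnerProductSpace.toDual_apply_apply, smul_eq_mul, zero_apply,
      innerSL_apply_apply, nsmul_eq_mul]
    rw [zpow_sub_one₀ hx2]
    push_cast
    field_simp
    linear_combination (‖x‖ ^ 2) ^ (-(l : ℤ)) * h3
  -- The punctured space is connected because `n ≥ 2`.
  obtain ⟨κ, hκ⟩ := isOpen_compl_singleton.exists_is_const_of_fderiv_eq_zero (𝕜 := ℝ)
    (isConnected_compl_singleton_of_one_lt_rank (by
      rw [← Module.finrank_eq_rank, finrank_euclideanSpace, Fintype.card_fin]
      exact_mod_cast (by omega : 1 < n)) (0 : EuclideanSpace ℝ (Fin n))).isPreconnected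
    (fun x hx => (hder x hx).differentiableAt.differentiableWithinAt)
    (fun x hx => (hder x hx).fderiv)
  refine ⟨κ, fun x hx => ?_⟩
  have hx2 : ‖x‖ ^ 2 ≠ 0 := pow_ne_zero 2 (norm_ne_zero_iff.2 hx)
  rw [← hκ x hx, zpow_neg, zpow_natCast]
  field_simp

/-- The square of the norm, as a polynomial. -/
def normSqPoly (n : ℕ) : MvPolynomial (Fin n) ℝ := ∑ i, MvPolynomial.X i ^ 2

lemma polyFun_normSqPoly (x : EuclideanSpace ℝ (Fin n)) : polyFun (normSqPoly n) x = ‖x‖ ^ 2 := by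
  simp [normSqPoly, EuclideanSpace.real_norm_sq_eq]

lemma isHomogeneous_normSqPoly : (normSqPoly n).IsHomogeneous 2 :=
  MvPolynomial.IsHomogeneous.sum _ _ _ fun i _ => by
    simpa using (MvPolynomial.isHomogeneous_X ℝ i).pow 2

lemma pderiv_normSqPoly (i : Fin n) :
    MvPolynomial.pderiv i (normSqPoly n) = 2 * MvPolynomial.X i := by
  rw [normSqPoly, map_sum, Finset.sum_eq_single i]
  · simp [Derivation.leibniz_pow]
  · intro j _ hj
    rw [Derivation.leibniz_pow, MvPolynomial.pderiv_X_of_ne hj]; simp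
  · simp

lemma polyFun_polyLap_normSqPoly_pow (l : ℕ) {x : EuclideanSpace ℝ (Fin n)} (hx : ‖x‖ = 1) :
    polyFun (polyLap (normSqPoly n ^ l)) x = 4 * l * (l - 1) + 2 * l * n := by
  have hs : ∑ i, x i ^ 2 = 1 := by rw [← EuclideanSpace.real_norm_sq_eq, hx, one_pow]
  have h : ∀ i, polyFun (MvPolynomial.pderiv i (MvPolynomial.pderiv i (normSqPoly n ^ l))) x
      = 4 * l * (l - 1) * x i ^ 2 + 2 * l := by
    intro i
    rcases l with _ | l
    · simp
    · simp only [Derivation.leibniz_pow, pderiv_normSqPoly, smul_eq_mul, nsmul_eq_mul,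
        Derivation.leibniz, Derivation.map_natCast, MvPolynomial.pderiv_X_self, polyFun_add,
        polyFun_mul, polyFun_natCast, polyFun_pow, polyFun_normSqPoly, hx, polyFun_X,
        polyFun_zero, polyFun_one]
      have h2 : polyFun (2 : MvPolynomial (Fin n) ℝ) x = 2 := polyFun_natCast 2 x
      have h3 : (MvPolynomial.pderiv i) (2 : MvPolynomial (Fin n) ℝ) = 0 :=
        Derivation.map_natCast _ 2
      rw [h3, h2]
      simp
      ring
  rw [polyLap, polyFun_sum, Finset.sum_congr rfl fun i _ => h i, Finset.sum_add_distrib,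
    ← Finset.mul_sum, hs]
  simp
  ring

section Family

variable {l d : ℕ} {p : Fin d → MvPolynomial (Fin n) ℝ}

/-- A rotation field maps harmonics of degree `l` to such harmonics, with a skew-symmetric matrix in
an orthonormal basis. Applied to the sum of squares it yields a skew matrix paired with the
symmetric `p m * p k`, hence zero. -/
lemma rotField_sum_sq_eq_zero (hn : 2 ≤ n) (hp : ∀ m, (p m).IsHomogeneous l)
    (hΔ : ∀ m, polyLap (p m) = 0)
    (ho : ∀ m m', sphereIntegral (p m * p m') = if m = m' then 1 else 0)
    (hs : ∀ q : MvPolynomial (Fin n) ℝ, q.IsHomogeneous l → polyLap q = 0 →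
      ∃ a : Fin d → ℝ, q = ∑ m, a m • p m) (i j : Fin n) :
    rotField i j (∑ m, p m ^ 2) = 0 := by
  choose A hA using fun m => hs (rotField i j (p m)) (isHomogeneous_rotField i j (hp m))
    (polyLap_rotField i j (hΔ m))
  have hA' : ∀ m k, sphereIntegral (rotField i j (p m) * p k) = A m k := by
    intro m k
    rw [hA m, Finset.sum_mul, sphereIntegral_sum]
    simp_rw [smul_mul_assoc, sphereIntegral_smul, ho]
    simp
  have hanti : ∀ m k, A m k = -A k m := fun m k => by
    rw [← hA', ← hA', sphereIntegral_rotField_mul hn i j (hp m) (hp k)]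
  have h1 : rotField i j (∑ m, p m ^ 2) = (2 : ℝ) • ∑ m, ∑ k, A m k • (p m * p k) := by
    rw [rotField_sum, Finset.smul_sum]
    refine Finset.sum_congr rfl fun m _ => ?_
    rw [sq, rotField_mul, hA m, Finset.mul_sum, ← two_smul ℝ]
    congr 1
    exact Finset.sum_congr rfl fun k _ => mul_smul_comm _ _ _
  have h2 : ∑ m, ∑ k, A m k • (p m * p k) = -∑ m, ∑ k, A m k • (p m * p k) := by
    nth_rewrite 1 [Finset.sum_comm]
    rw [← Finset.sum_neg_distrib]
    refine Finset.sum_congr rfl fun m _ => ?_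
    rw [← Finset.sum_neg_distrib]
    refine Finset.sum_congr rfl fun k _ => ?_
    rw [hanti k m, mul_comm, neg_smul]
  rw [h1, self_eq_neg.1 h2, smul_zero]

lemma sum_sq_orthonormal_eq (hn : 2 ≤ n) (hp : ∀ m, (p m).IsHomogeneous l)
    (hΔ : ∀ m, polyLap (p m) = 0)
    (ho : ∀ m m', sphereIntegral (p m * p m') = if m = m' then 1 else 0)
    (hs : ∀ q : MvPolynomial (Fin n) ℝ, q.IsHomogeneous l → polyLap q = 0 →
      ∃ a : Fin d → ℝ, q = ∑ m, a m • p m) :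
    ∑ m, p m ^ 2 = (d / sphereIntegral (1 : MvPolynomial (Fin n) ℝ)) • normSqPoly n ^ l := by
  have hhom : (∑ m, p m ^ 2).IsHomogeneous (2 * l) :=
    MvPolynomial.IsHomogeneous.sum _ _ _ fun m _ => by
      rw [mul_comm]; exact (hp m).pow 2
  obtain ⟨κ, hκ⟩ := exists_eq_norm_pow_of_rotField hn hhom
    (rotField_sum_sq_eq_zero hn hp hΔ ho hs)
  have h1 : ∑ m, p m ^ 2 = κ • normSqPoly n ^ l := by
    refine eq_of_eq_on_sphere hn hhom (isHomogeneous_smul (isHomogeneous_normSqPoly.pow l) κ)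
      fun ξ => ?_
    have hξ : (ξ : EuclideanSpace ℝ (Fin n)) ≠ 0 := ne_zero_of_mem_unit_sphere ξ
    rw [hκ _ hξ, polyFun_smul, polyFun_pow, polyFun_normSqPoly]
  have h2 : sphereIntegral (∑ m, p m ^ 2) = d := by
    rw [sphereIntegral_sum]
    simp [sq, ho]
  have h3 : sphereIntegral (κ • normSqPoly n ^ l) = κ * sphereIntegral (1 : MvPolynomial (Fin n) ℝ) := by
    rw [sphereIntegral_smul]
    congr 1
    simp [sphereIntegral, polyFun_normSqPoly]
  have h4 : 0 < sphereIntegral (1 : MvPolynomial (Fin n) ℝ) := by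
    rw [sphereIntegral_one hn, momentCoeff]
    have hn0 : (0 : ℝ) < n := by positivity
    have := Real.Gamma_pos_of_pos (s := ((0 : ℕ) : ℝ) + (0 : ℕ) + (n : ℝ) / 2) (by positivity)
    positivity
  rw [h1]
  congr 1
  rw [← h1, h2] at h3
  field_simp
  exact h3.symm

lemma sum_sq_polyFun_eq (hn : 2 ≤ n) (hp : ∀ m, (p m).IsHomogeneous l)
    (hΔ : ∀ m, polyLap (p m) = 0)
    (ho : ∀ m m', sphereIntegral (p m * p m') = if m = m' then 1 else 0)
    (hs : ∀ q : MvPolynomial (Fin n) ℝ, q.IsHomogeneous l → polyLap q = 0 →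
      ∃ a : Fin d → ℝ, q = ∑ m, a m • p m) (ξ : USphere n) :
    ∑ m, polyFun (p m) (ξ : EuclideanSpace ℝ (Fin n)) ^ 2
      = d / sphereIntegral (1 : MvPolynomial (Fin n) ℝ) := by
  have h := congrArg (fun q => polyFun q (ξ : EuclideanSpace ℝ (Fin n)))
    (sum_sq_orthonormal_eq hn hp hΔ ho hs)
  simpa [polyFun_normSqPoly] using h

/-- The Laplacian is applied to the addition theorem, which holds as an identity of polynomials,
with `Δ(p²) = 2|∇p|²` for harmonic `p`. -/
lemma sum_norm_sq_polyGrad_eq (hn : 2 ≤ n) (hp : ∀ m, (p m).IsHomogeneous l)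
    (hΔ : ∀ m, polyLap (p m) = 0)
    (ho : ∀ m m', sphereIntegral (p m * p m') = if m = m' then 1 else 0)
    (hs : ∀ q : MvPolynomial (Fin n) ℝ, q.IsHomogeneous l → polyLap q = 0 →
      ∃ a : Fin d → ℝ, q = ∑ m, a m • p m) (ξ : USphere n) :
    ∑ m, ‖polyGrad (p m) (ξ : EuclideanSpace ℝ (Fin n))‖ ^ 2
      = d / sphereIntegral (1 : MvPolynomial (Fin n) ℝ) * (2 * l * (l - 1) + l * n) := by
  have h := congrArg (fun q => polyFun (polyLap q) (ξ : EuclideanSpace ℝ (Fin n)))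
    (sum_sq_orthonormal_eq hn hp hΔ ho hs)
  simp only [polyLap_sum, polyLap_smul, polyFun_sum, polyFun_smul] at h
  rw [polyFun_polyLap_normSqPoly_pow l (norm_eq_of_mem_sphere ξ)] at h
  have h2 : ∀ m, polyFun (polyLap (p m ^ 2)) (ξ : EuclideanSpace ℝ (Fin n))
      = 2 * ‖polyGrad (p m) (ξ : EuclideanSpace ℝ (Fin n))‖ ^ 2 := by
    intro m
    have e2 : polyFun (2 : MvPolynomial (Fin n) ℝ) (ξ : EuclideanSpace ℝ (Fin n)) = 2 :=
      polyFun_natCast 2 _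
    rw [sq, polyLap_mul, hΔ, EuclideanSpace.real_norm_sq_eq]
    simp [e2, sq]
  rw [Finset.sum_congr rfl fun m _ => h2 m, ← Finset.mul_sum] at h
  linear_combination h / 2

end Family

/-! ### The dimension of the space of harmonics -/

/-- Cauchy data on a hyperplane: `Δp = 0` expresses each coefficient with exponent `k ≥ 2` in the
first variable through coefficients with exponent `k - 2`. -/
lemma harmonic_eq_zero_of_coeff {n : ℕ} {p : MvPolynomial (Fin (n + 2)) ℝ} (hΔ : polyLap p = 0)
    (h : ∀ α : Fin (n + 2) →₀ ℕ, α 0 ≤ 1 → p.coeff α = 0) : p = 0 := by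
  have key : ∀ (k : ℕ) (α : Fin (n + 2) →₀ ℕ), α 0 = k → p.coeff α = 0 := by
    intro k
    induction k using Nat.strong_induction_on with
    | _ k ih =>
    intro α hα
    rcases le_or_gt k 1 with hk | hk
    · exact h α (hα ▸ hk)
    set β : Fin (n + 2) →₀ ℕ := α - Finsupp.single 0 2 with hβ
    have hαβ : α = β + Finsupp.single 0 1 + Finsupp.single 0 1 := by
      rw [add_assoc, ← Finsupp.single_add]
      refine (tsub_add_cancel_of_le ?_).symm
      rw [Finsupp.single_le_iff]; omega
    have hβ0 : β 0 = k - 2 := by rw [hβ]; simp [hα]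
    have hc := congrArg (MvPolynomial.coeff β) hΔ
    rw [polyLap, MvPolynomial.coeff_sum, MvPolynomial.coeff_zero] at hc
    simp only [MvPolynomial.coeff_pderiv] at hc
    rw [Finset.sum_eq_single 0] at hc
    · rw [← hαβ] at hc
      have h1 : (((β + Finsupp.single 0 1 : Fin (n + 2) →₀ ℕ) 0 : ℝ) + 1) ≠ 0 := by positivity
      have h2 : ((β 0 : ℝ) + 1) ≠ 0 := by positivity
      exact (mul_eq_zero.1 ((mul_eq_zero.1 hc).resolve_right h2)).resolve_right h1
    · intro i _ hi
      rw [ih (k - 2) (by omega) _ (by simp [hβ0, hi]), zero_mul, zero_mul]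
    · simp
  ext α
  rw [key _ α rfl, MvPolynomial.coeff_zero]

/-- The exponents of degree `l` whose first entry is at most `1`. -/
def cauchyExponent (n l : ℕ) (t : Fin 2 × (Fin n → Fin (l + 1))) : Fin (n + 2) →₀ ℕ :=
  Finsupp.equivFunOnFinite.symm (Fin.cons (t.1 : ℕ)
    (Fin.snoc (fun j => (t.2 j : ℕ)) (l - t.1 - ∑ j, (t.2 j : ℕ)) : Fin (n + 1) → ℕ))

/-- Because of truncated subtraction the parametrization also reaches exponents of other degrees;
for the dimension count only surjectivity matters. -/
lemma exists_cauchyExponent_eq {n l : ℕ} {α : Fin (n + 2) →₀ ℕ} (hα : ∑ i, α i = l)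
    (h0 : α 0 ≤ 1) : ∃ t, cauchyExponent n l t = α := by
  have hle : ∀ i, α i ≤ l := fun i => hα ▸ Finset.single_le_sum (f := fun i => α i)
    (fun _ _ => Nat.zero_le _) (Finset.mem_univ i)
  refine ⟨(⟨α 0, by omega⟩, fun j => ⟨α j.castSucc.succ, by have := hle j.castSucc.succ; omega⟩), ?_⟩
  rw [Fin.sum_univ_succ, Fin.sum_univ_castSucc] at hα
  ext i
  rw [cauchyExponent, Finsupp.equivFunOnFinite_symm_apply_apply]
  refine Fin.cases ?_ (fun i => ?_) i
  · simp
  · rw [Fin.cons_succ]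
    refine Fin.lastCases ?_ (fun j => ?_) i
    · rw [Fin.snoc_last]
      simp only
      omega
    · rw [Fin.snoc_castSucc]

/-- The Cauchy coefficients embed the span: the first exponent takes two values, the `n - 2` middle
ones at most `l + 1` each, and the last is fixed by the degree. -/
lemma card_orthonormal_le (hn : 2 ≤ n) {l d : ℕ} {p : Fin d → MvPolynomial (Fin n) ℝ}
    (hp : ∀ m, (p m).IsHomogeneous l) (hΔ : ∀ m, polyLap (p m) = 0)
    (ho : ∀ m m', sphereIntegral (p m * p m') = if m = m' then 1 else 0) :
    d ≤ 2 * (l + 1) ^ (n - 2) := by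
  obtain ⟨n, rfl⟩ : ∃ k, n = k + 2 := ⟨n - 2, by omega⟩
  have hli : LinearIndependent ℝ fun (m : Fin d) (t : Fin 2 × (Fin n → Fin (l + 1))) =>
      (p m).coeff (cauchyExponent n l t) := by
    rw [Fintype.linearIndependent_iff]
    intro g hg k
    have hz : ∑ m, g m • p m = 0 := by
      refine harmonic_eq_zero_of_coeff ?_ fun α hα => ?_
      · simp [polyLap_sum, polyLap_smul, hΔ]
      · by_cases hdeg : ∑ i, α i = l
        · obtain ⟨t, rfl⟩ := exists_cauchyExponent_eq hdeg hα
          have := congrFun hg t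
          simpa [MvPolynomial.coeff_sum] using this
        · have hhom : (∑ m, g m • p m).IsHomogeneous l :=
            MvPolynomial.IsHomogeneous.sum _ _ _ fun m _ => isHomogeneous_smul (hp m) _
          by_contra hne
          have := hhom hne
          rw [Finsupp.weight_apply, Finsupp.sum_fintype _ _ (by simp)] at this
          exact hdeg (by simpa using this)
    have h1 : sphereIntegral ((∑ m, g m • p m) * p k) = g k := by
      rw [Finset.sum_mul, sphereIntegral_sum]
      simp_rw [smul_mul_assoc, sphereIntegral_smul, ho]
      simp
    rw [← h1, hz, zero_mul, sphereIntegral_zero]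
  have := hli.fintype_card_le_finrank
  simpa using this

end Harmonics

/-! ### Polynomial representatives of a basis of spherical harmonics -/

namespace SphericalHarmonicBasis

variable {n : ℕ} (B : SphericalHarmonicBasis n)

lemma exists_poly (l : ℕ) (m : Fin (B.d l)) : ∃ p : MvPolynomial (Fin n) ℝ, p.IsHomogeneous l ∧
    polyLap p = 0 ∧ ∀ ξ : USphere n, B.Y l m ξ = polyFun p (ξ : EuclideanSpace ℝ (Fin n)) := by
  have h : B.Y l m ∈ sphericalHarmonics n l := by
    rw [← B.span_eq]
    exact Submodule.subset_span ⟨m, rfl⟩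
  exact h

/-- The solid harmonic that restricts to `Y l m`. -/
def poly (l : ℕ) (m : Fin (B.d l)) : MvPolynomial (Fin n) ℝ := (B.exists_poly l m).choose

lemma isHomogeneous_poly (l : ℕ) (m : Fin (B.d l)) : (B.poly l m).IsHomogeneous l :=
  (B.exists_poly l m).choose_spec.1

lemma polyLap_poly (l : ℕ) (m : Fin (B.d l)) : polyLap (B.poly l m) = 0 :=
  (B.exists_poly l m).choose_spec.2.1

lemma Y_eq (l : ℕ) (m : Fin (B.d l)) (ξ : USphere n) :
    B.Y l m ξ = polyFun (B.poly l m) (ξ : EuclideanSpace ℝ (Fin n)) :=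
  (B.exists_poly l m).choose_spec.2.2 ξ

lemma sphereIntegral_poly_mul (l : ℕ) (m m' : Fin (B.d l)) :
    sphereIntegral (B.poly l m * B.poly l m') = if m = m' then 1 else 0 := by
  rw [← B.orthonormal l m m', sphereIntegral]
  simp [Y_eq]

lemma exists_eq_sum_poly (hn : 2 ≤ n) (l : ℕ) (q : MvPolynomial (Fin n) ℝ) (hq : q.IsHomogeneous l)
    (hΔ : polyLap q = 0) : ∃ a : Fin (B.d l) → ℝ, q = ∑ m, a m • B.poly l m := by
  have h : (fun ξ : USphere n => polyFun q (ξ : EuclideanSpace ℝ (Fin n)))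
      ∈ sphericalHarmonics n l := ⟨q, hq, hΔ, fun ξ => rfl⟩
  rw [← B.span_eq, Submodule.mem_span_range_iff_exists_fun] at h
  obtain ⟨a, ha⟩ := h
  refine ⟨a, eq_of_eq_on_sphere hn hq (MvPolynomial.IsHomogeneous.sum _ _ _ fun m _ =>
    isHomogeneous_smul (B.isHomogeneous_poly l m) _) fun ξ => ?_⟩
  rw [← congrFun ha ξ]
  simp [Y_eq]

end SphericalHarmonicBasis

theorem exists_harmonic_bounds {n : ℕ} (hn : 2 ≤ n) : ∃ C : ℝ, 0 < C ∧
    ∀ (B : SphericalHarmonicBasis n) (l : ℕ) (ξ : USphere n),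
      ∑ m, polyFun (B.poly l m) (ξ : EuclideanSpace ℝ (Fin n)) ^ 2 ≤ C * (1 + (l : ℝ)) ^ (n - 2) ∧
      ∑ m, ‖polyGrad (B.poly l m) (ξ : EuclideanSpace ℝ (Fin n))‖ ^ 2
        ≤ C * (1 + (l : ℝ)) ^ (n - 2) * (1 + l) ^ 2 := by
  set S := sphereIntegral (1 : MvPolynomial (Fin n) ℝ) with hS
  have hS0 : 0 < S := by
    rw [hS, sphereIntegral_one hn, momentCoeff]
    have hn0 : (0 : ℝ) < n := by positivity
    have := Real.Gamma_pos_of_pos (s := ((0 : ℕ) : ℝ) + (0 : ℕ) + (n : ℝ) / 2) (by positivity)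
    positivity
  have hn' : (2 : ℝ) ≤ n := by exact_mod_cast hn
  refine ⟨2 * n / S, by positivity, fun B l ξ => ?_⟩
  have hl : (0 : ℝ) ≤ l := by positivity
  have hcard : (B.d l : ℝ) ≤ 2 * (1 + (l : ℝ)) ^ (n - 2) := by
    have := card_orthonormal_le hn (B.isHomogeneous_poly l) (B.polyLap_poly l)
      (B.sphereIntegral_poly_mul l)
    have h2 : (B.d l : ℝ) ≤ ((2 * (l + 1) ^ (n - 2) : ℕ) : ℝ) := by exact_mod_cast this
    rw [add_comm (1 : ℝ)]
    exact_mod_cast h2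
  have hκ : (B.d l : ℝ) / S ≤ 2 / S * (1 + (l : ℝ)) ^ (n - 2) := by
    rw [div_mul_eq_mul_div]; gcongr
  rw [sum_sq_polyFun_eq hn (B.isHomogeneous_poly l) (B.polyLap_poly l)
    (B.sphereIntegral_poly_mul l) (B.exists_eq_sum_poly hn l), sum_norm_sq_polyGrad_eq hn
    (B.isHomogeneous_poly l) (B.polyLap_poly l) (B.sphereIntegral_poly_mul l)
    (B.exists_eq_sum_poly hn l), ← hS]
  have hpow : 0 < (1 + (l : ℝ)) ^ (n - 2) := by positivity
  have e : 2 * (n : ℝ) / S * (1 + (l : ℝ)) ^ (n - 2)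
      = n * (2 / S * (1 + (l : ℝ)) ^ (n - 2)) := by ring
  have hK : 0 < 2 / S * (1 + (l : ℝ)) ^ (n - 2) := by positivity
  rw [e]
  constructor
  · nlinarith
  · have h1 : 2 * (l : ℝ) * (l - 1) + l * n ≤ n * (1 + l) ^ 2 := by
      nlinarith [mul_nonneg (sub_nonneg.2 hn') (sq_nonneg (l : ℝ)), mul_nonneg hl (by positivity : (0 : ℝ) ≤ n)]
    have h2 : 0 ≤ 2 * (l : ℝ) * (l - 1) + l * n := by nlinarith [mul_nonneg hl hl]
    calc _ ≤ (2 / S * (1 + (l : ℝ)) ^ (n - 2)) * (n * (1 + l) ^ 2) :=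
          mul_le_mul hκ h1 h2 hK.le
      _ = _ := by ring

end

noncomputable section

/-! ### Series of functions in separated variables -/

/-- A sequence of functions `Q l` homogeneous of degree `0`, with gradients `G l`, that grow like
spherical harmonics with rapidly decreasing coefficients. -/
structure AngularFamily (n : ℕ) where
  Q : ℕ → EuclideanSpace ℝ (Fin n) → ℝ
  G : ℕ → EuclideanSpace ℝ (Fin n) → EuclideanSpace ℝ (Fin n)
  b : ℕ → ℝ
  hasGradientAt : ∀ l x, x ≠ 0 → HasGradientAt (Q l) (G l x) x
  Q_le : ∀ l x, x ≠ 0 → |Q l x| ≤ b l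
  G_le : ∀ l x, x ≠ 0 → ‖G l x‖ ≤ b l * (1 + l) / ‖x‖
  inner_G : ∀ l x, x ≠ 0 → inner ℝ x (G l x) = 0
  Q_angle : ∀ l x (hx : x ≠ 0), Q l (angle x hx : EuclideanSpace ℝ (Fin n)) = Q l x
  G_angle : ∀ l x (hx : x ≠ 0), G l (angle x hx : EuclideanSpace ℝ (Fin n)) = ‖x‖ • G l x
  summable : Summable fun l => b l * (1 + (l : ℝ)) ^ 3

namespace AngularFamily

variable {n : ℕ} (𝒬 : AngularFamily n)

/-- The sum that controls all series. -/
def bound : ℝ := ∑' l, 𝒬.b l * (1 + (l : ℝ)) ^ 3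

/-- The function `∑ₗ e l |x| Q l x`. -/
def series (e : ℕ → ℝ → ℝ) (x : EuclideanSpace ℝ (Fin n)) : ℝ := ∑' l, e l ‖x‖ * 𝒬.Q l x

/-- The vector field `∑ₗ e l |x| G l x`. -/
def gradSeries (e : ℕ → ℝ → ℝ) (x : EuclideanSpace ℝ (Fin n)) : EuclideanSpace ℝ (Fin n) :=
  ∑' l, e l ‖x‖ • 𝒬.G l x

variable {𝒬} {e e' : ℕ → ℝ → ℝ} {x : EuclideanSpace ℝ (Fin n)} {D : ℝ}

lemma b_nonneg (hx : x ≠ 0) (l : ℕ) : 0 ≤ 𝒬.b l := (abs_nonneg _).trans (𝒬.Q_le l x hx)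

lemma term_le (hx : x ≠ 0) {c : ℝ} {l : ℕ} (hc : |c| ≤ D * (1 + l) ^ 2) :
    |c * 𝒬.Q l x| ≤ D * (𝒬.b l * (1 + (l : ℝ)) ^ 3) := by
  have hl : (0 : ℝ) ≤ l := by positivity
  have hb := 𝒬.b_nonneg hx l
  have h0 : 0 ≤ D * (1 + (l : ℝ)) ^ 2 := (abs_nonneg _).trans hc
  have hD : 0 ≤ D := nonneg_of_mul_nonneg_left h0 (by positivity)
  rw [abs_mul]
  calc |c| * |𝒬.Q l x| ≤ D * (1 + l) ^ 2 * 𝒬.b l :=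
        mul_le_mul hc (𝒬.Q_le l x hx) (abs_nonneg _) h0
    _ ≤ D * (1 + l) ^ 2 * 𝒬.b l * (1 + l) :=
        le_mul_of_one_le_right (mul_nonneg h0 hb) (by linarith)
    _ = _ := by ring

/-- This estimate uses the full weight `(1+l)³`: two powers come from the Bessel factors and one
from the tangential derivative. -/
lemma gradTerm_le (hx : x ≠ 0) {c : ℝ} {l : ℕ} (hc : |c| ≤ D * (1 + l) ^ 2) :
    ‖c • 𝒬.G l x‖ ≤ D / ‖x‖ * (𝒬.b l * (1 + (l : ℝ)) ^ 3) := by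
  have h0 : 0 ≤ D * (1 + (l : ℝ)) ^ 2 := (abs_nonneg _).trans hc
  rw [norm_smul, Real.norm_eq_abs]
  calc |c| * ‖𝒬.G l x‖ ≤ D * (1 + l) ^ 2 * (𝒬.b l * (1 + l) / ‖x‖) :=
        mul_le_mul hc (𝒬.G_le l x hx) (norm_nonneg _) h0
    _ = _ := by ring

lemma summable_series (hx : x ≠ 0) (he : ∀ l, |e l ‖x‖| ≤ D * (1 + (l : ℝ)) ^ 2) :
    Summable fun l => e l ‖x‖ * 𝒬.Q l x :=
  Summable.of_norm_bounded (𝒬.summable.mul_left D) fun l =>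
    (Real.norm_eq_abs _).trans_le (term_le (𝒬 := 𝒬) hx (he l))

lemma summable_gradSeries (hx : x ≠ 0) (he : ∀ l, |e l ‖x‖| ≤ D * (1 + (l : ℝ)) ^ 2) :
    Summable fun l => e l ‖x‖ • 𝒬.G l x :=
  Summable.of_norm_bounded (𝒬.summable.mul_left (D / ‖x‖)) fun l =>
    gradTerm_le (𝒬 := 𝒬) hx (he l)

lemma abs_series_le (hx : x ≠ 0) (he : ∀ l, |e l ‖x‖| ≤ D * (1 + (l : ℝ)) ^ 2) :
    |𝒬.series e x| ≤ D * 𝒬.bound := by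
  rw [bound, ← tsum_mul_left]
  rw [← Real.norm_eq_abs]
  exact tsum_of_norm_bounded (𝒬.summable.mul_left D).hasSum fun l =>
    (Real.norm_eq_abs _).trans_le (term_le (𝒬 := 𝒬) hx (he l))

lemma norm_gradSeries_le (hx : x ≠ 0) (he : ∀ l, |e l ‖x‖| ≤ D * (1 + (l : ℝ)) ^ 2) :
    ‖𝒬.gradSeries e x‖ ≤ D / ‖x‖ * 𝒬.bound := by
  rw [bound, ← tsum_mul_left]
  exact tsum_of_norm_bounded (𝒬.summable.mul_left (D / ‖x‖)).hasSum fun l =>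
    gradTerm_le (𝒬 := 𝒬) hx (he l)

lemma inner_gradSeries (hx : x ≠ 0) (he : ∀ l, |e l ‖x‖| ≤ D * (1 + (l : ℝ)) ^ 2) :
    inner ℝ x (𝒬.gradSeries e x) = 0 := by
  have h := (innerSL ℝ x).map_tsum (summable_gradSeries (𝒬 := 𝒬) hx he)
  simp only [innerSL_apply_apply, inner_smul_right, 𝒬.inner_G _ x hx, mul_zero, tsum_zero] at h
  exact h

lemma gradSeries_angle (c : ℕ → ℝ) (hx : x ≠ 0) :
    𝒬.gradSeries (fun l _ => c l) (angle x hx : EuclideanSpace ℝ (Fin n))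
      = ‖x‖ • 𝒬.gradSeries (fun l _ => c l) x := by
  simp only [gradSeries, 𝒬.G_angle]
  rw [← tsum_const_smul'']
  exact tsum_congr fun l => smul_comm _ _ _

lemma series_angle (c : ℕ → ℝ) (hx : x ≠ 0) :
    𝒬.series (fun l _ => c l) (angle x hx : EuclideanSpace ℝ (Fin n))
      = 𝒬.series (fun l _ => c l) x := by
  simp only [series, 𝒬.Q_angle]

lemma hasGradientAt_norm (hx : x ≠ 0) : HasGradientAt (fun x => ‖x‖) (‖x‖⁻¹ • x) x := by
  have h := ((hasStrictFDerivAt_norm_sq x).hasFDerivAt).sqrt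
    (pow_ne_zero 2 (norm_ne_zero_iff.2 hx))
  simp only [Real.sqrt_sq (norm_nonneg _)] at h
  rw [hasGradientAt_iff_hasFDerivAt]
  refine h.congr_fderiv ?_
  ext v
  simp
  ring

lemma hasGradientAt_term (hd : ∀ l r, 0 < r → HasDerivAt (e l) (e' l r) r) (hx : x ≠ 0) (l : ℕ) :
    HasGradientAt (fun x => e l ‖x‖ * 𝒬.Q l x)
      ((‖x‖⁻¹ * (e' l ‖x‖ * 𝒬.Q l x)) • x + e l ‖x‖ • 𝒬.G l x) x := by
  have h1 := HasDerivAt.comp_hasFDerivAt (h₂ := e l) x (hd l _ (norm_pos_iff.2 hx))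
    (hasGradientAt_norm hx).hasFDerivAt
  rw [hasGradientAt_iff_hasFDerivAt]
  refine (h1.mul (𝒬.hasGradientAt l x hx).hasFDerivAt).congr_fderiv ?_
  ext v
  simp
  ring

/-- Termwise differentiation on the ball of radius `|x|/2` around `x`. It stays away from the
origin, so the factors `1/|y|` in the bounds are uniformly controlled there. -/
lemma hasGradientAt_series (hd : ∀ l r, 0 < r → HasDerivAt (e l) (e' l r) r)
    (he : ∀ l r, 0 < r → |e l r| ≤ D * (1 + (l : ℝ)) ^ 2)
    (he' : ∀ l r, 0 < r → |e' l r| ≤ D * (1 + 1 / r) * (1 + (l : ℝ)) ^ 2) (hx : x ≠ 0) :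
    HasGradientAt (𝒬.series e) ((‖x‖⁻¹ * 𝒬.series e' x) • x + 𝒬.gradSeries e x) x := by
  have hr : 0 < ‖x‖ := norm_pos_iff.2 hx
  have hD : 0 ≤ D := by
    have := (abs_nonneg _).trans (he 0 1 one_pos)
    simpa using this
  have hy : ∀ y ∈ Metric.ball x (‖x‖ / 2), ‖x‖ / 2 < ‖y‖ := by
    intro y hy
    rw [Metric.mem_ball, dist_eq_norm, norm_sub_rev] at hy
    have := norm_sub_norm_le x y
    linarith
  have hy0 : ∀ y ∈ Metric.ball x (‖x‖ / 2), y ≠ 0 := fun y h => by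
    rw [← norm_pos_iff]; linarith [hy y h]
  have hgb : ∀ (l : ℕ) (y : EuclideanSpace ℝ (Fin n)), y ≠ 0 →
      ‖(‖y‖⁻¹ * (e' l ‖y‖ * 𝒬.Q l y)) • y + e l ‖y‖ • 𝒬.G l y‖
        ≤ (D * (1 + 1 / ‖y‖) + D / ‖y‖) * (𝒬.b l * (1 + (l : ℝ)) ^ 3) := by
    intro l y hy
    have hyp := norm_pos_iff.2 hy
    refine (norm_add_le _ _).trans ?_
    rw [add_mul]
    refine add_le_add ?_ (gradTerm_le hy (he l _ hyp))
    rw [norm_smul, norm_mul, norm_inv, norm_norm, mul_comm, ← mul_assoc,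
      mul_inv_cancel₀ hyp.ne', one_mul]
    exact term_le hy (he' l _ hyp)
  have key := hasFDerivAt_tsum_of_isPreconnected
    (f := fun l y => e l ‖y‖ * 𝒬.Q l y)
    (f' := fun l y => InnerProductSpace.toDual ℝ (EuclideanSpace ℝ (Fin n))
      ((‖y‖⁻¹ * (e' l ‖y‖ * 𝒬.Q l y)) • y + e l ‖y‖ • 𝒬.G l y))
    (𝒬.summable.mul_left (D * (1 + 1 / (‖x‖ / 2)) + D / (‖x‖ / 2)))
    Metric.isOpen_ball (convex_ball x (‖x‖ / 2)).isPreconnected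
    (fun l y h => (hasGradientAt_term hd (hy0 y h) l).hasFDerivAt)
    (fun l y h => ?_) (Metric.mem_ball_self (by positivity))
    (summable_series (𝒬 := 𝒬) hx fun l => he l _ hr) (Metric.mem_ball_self (by positivity))
  · rw [hasGradientAt_iff_hasFDerivAt]
    refine key.congr_fderiv ?_
    have s1 : Summable fun l => (‖x‖⁻¹ * (e' l ‖x‖ * 𝒬.Q l x)) • x :=
      ((summable_series (𝒬 := 𝒬) hx fun l => he' l _ hr).mul_left _).smul_const x
    have s2 := summable_gradSeries (𝒬 := 𝒬) hx fun l => he l _ hr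
    have h := (InnerProductSpace.toDual ℝ
      (EuclideanSpace ℝ (Fin n))).toContinuousLinearEquiv.map_tsum
      (L := SummationFilter.unconditional ℕ)
      (f := fun l => (‖x‖⁻¹ * (e' l ‖x‖ * 𝒬.Q l x)) • x + e l ‖x‖ • 𝒬.G l x)
    have h2 : ∑' l, ((‖x‖⁻¹ * (e' l ‖x‖ * 𝒬.Q l x)) • x + e l ‖x‖ • 𝒬.G l x)
        = (‖x‖⁻¹ * 𝒬.series e' x) • x + 𝒬.gradSeries e x := by
      rw [s1.tsum_add s2, Summable.tsum_smul_const
        ((summable_series (𝒬 := 𝒬) hx fun l => he' l _ hr).mul_left _), tsum_mul_left]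
      rfl
    rw [h2] at h
    exact h.symm
  · rw [LinearIsometryEquiv.norm_map]
    refine (hgb l y (hy0 y h)).trans ?_
    have := hy y h
    have hb := 𝒬.b_nonneg hx l
    gcongr

end AngularFamily

end

noncomputable section

/-! ### The angular part of a homogeneous polynomial -/

section AngularPart

variable {n : ℕ} {p : MvPolynomial (Fin n) ℝ} {l : ℕ} {x : EuclideanSpace ℝ (Fin n)}

/-- The function `|x|⁻ˡ p x`, which is homogeneous of degree `0` if `p` has degree `l`. -/
def angularPart (p : MvPolynomial (Fin n) ℝ) (l : ℕ) (x : EuclideanSpace ℝ (Fin n)) : ℝ :=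
  (‖x‖ ^ l)⁻¹ * polyFun p x

/-- The gradient of `angularPart`. -/
def angularPartGrad (p : MvPolynomial (Fin n) ℝ) (l : ℕ) (x : EuclideanSpace ℝ (Fin n)) :
    EuclideanSpace ℝ (Fin n) :=
  (‖x‖ ^ l)⁻¹ • (polyGrad p x - (l * polyFun p x / ‖x‖ ^ 2) • x)

lemma angle_eq (hx : x ≠ 0) : (angle x hx : EuclideanSpace ℝ (Fin n)) = ‖x‖⁻¹ • x := rfl

lemma norm_smul_angle (hx : x ≠ 0) : ‖x‖ • (angle x hx : EuclideanSpace ℝ (Fin n)) = x := by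
  rw [angle_eq, smul_smul, mul_inv_cancel₀ (norm_ne_zero_iff.2 hx), one_smul]

lemma norm_coe_sphere (ξ : USphere n) : ‖(ξ : EuclideanSpace ℝ (Fin n))‖ = 1 :=
  mem_sphere_zero_iff_norm.1 ξ.2

lemma coe_sphere_ne_zero (ξ : USphere n) : (ξ : EuclideanSpace ℝ (Fin n)) ≠ 0 := by
  rw [← norm_ne_zero_iff, norm_coe_sphere]; exact one_ne_zero

lemma angularPart_coe (ξ : USphere n) :
    angularPart p l (ξ : EuclideanSpace ℝ (Fin n)) = polyFun p (ξ : EuclideanSpace ℝ (Fin n)) := by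
  rw [angularPart, norm_coe_sphere]; simp

lemma smul_polyGrad_smul (hp : p.IsHomogeneous l) (r : ℝ) (x : EuclideanSpace ℝ (Fin n)) :
    r • polyGrad p (r • x) = r ^ l • polyGrad p x := by
  ext i
  simp only [PiLp.smul_apply, polyGrad_apply, smul_eq_mul]
  rcases l with _ | l
  · obtain ⟨a, rfl⟩ := eq_C_of_isHomogeneous_zero hp
    simp
  · have h : (MvPolynomial.pderiv i p).IsHomogeneous l := hp.pderiv
    rw [polyFun_smul_arg h]
    ring

lemma inner_polyGrad (hp : p.IsHomogeneous l) (x : EuclideanSpace ℝ (Fin n)) :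
    inner ℝ x (polyGrad p x) = l * polyFun p x := by
  rw [← euler_polyFun hp, PiLp.inner_apply]
  exact Finset.sum_congr rfl fun i _ => by simp [mul_comm]

lemma hasGradientAt_angularPart (hx : x ≠ 0) :
    HasGradientAt (angularPart p l) (angularPartGrad p l x) x := by
  have hr := norm_ne_zero_iff.2 hx
  have h0 : HasDerivAt (fun r : ℝ => (r ^ l)⁻¹) (-(l * (‖x‖ ^ (l + 1))⁻¹)) ‖x‖ := by
    refine ((hasDerivAt_pow l ‖x‖).fun_inv (pow_ne_zero l hr)).congr_deriv ?_
    rcases l with _ | l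
    · simp
    · field_simp
      simp
      ring
  have h1 := HasDerivAt.comp_hasFDerivAt x h0 (AngularFamily.hasGradientAt_norm hx).hasFDerivAt
  rw [hasGradientAt_iff_hasFDerivAt]
  refine (h1.mul (hasGradientAt_polyFun p x).hasFDerivAt).congr_fderiv ?_
  ext v
  simp [angularPartGrad]
  field_simp
  ring

lemma inner_angularPartGrad (hp : p.IsHomogeneous l) (hx : x ≠ 0) :
    inner ℝ x (angularPartGrad p l x) = 0 := by
  have hr := norm_ne_zero_iff.2 hx
  rw [angularPartGrad, inner_smul_right, inner_sub_right, inner_smul_right, inner_polyGrad hp,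
    real_inner_self_eq_norm_sq, div_mul_cancel₀ _ (pow_ne_zero 2 hr), sub_self, mul_zero]

lemma angularPart_angle (hp : p.IsHomogeneous l) (hx : x ≠ 0) :
    angularPart p l (angle x hx : EuclideanSpace ℝ (Fin n)) = angularPart p l x := by
  have hr := norm_ne_zero_iff.2 hx
  rw [angularPart_coe, angularPart, polyFun_eq_norm_pow_mul hp hx, ← mul_assoc,
    inv_mul_cancel₀ (pow_ne_zero l hr), one_mul]

lemma polyGrad_angle (hp : p.IsHomogeneous l) (hx : x ≠ 0) :
    polyGrad p (angle x hx : EuclideanSpace ℝ (Fin n))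
      = (‖x‖ * (‖x‖ ^ l)⁻¹) • polyGrad p x := by
  have hr := norm_ne_zero_iff.2 hx
  have h := smul_polyGrad_smul hp ‖x‖ (angle x hx : EuclideanSpace ℝ (Fin n))
  rw [norm_smul_angle] at h
  rw [mul_comm, ← smul_smul, h, smul_smul, inv_mul_cancel₀ (pow_ne_zero l hr), one_smul]

lemma angularPartGrad_angle (hp : p.IsHomogeneous l) (hx : x ≠ 0) :
    angularPartGrad p l (angle x hx : EuclideanSpace ℝ (Fin n)) = ‖x‖ • angularPartGrad p l x := by
  have hr := norm_ne_zero_iff.2 hx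
  rw [angularPartGrad, polyGrad_angle hp hx, norm_coe_sphere, ← angularPart_coe (l := l),
    angularPart_angle hp hx, angularPart, angularPartGrad, angle_eq]
  simp only [one_pow, inv_one, div_one, smul_sub, smul_smul]
  congr 2
  rw [one_mul]
  field_simp

lemma norm_sub_proj_le (hx : x ≠ 0) (v : EuclideanSpace ℝ (Fin n)) :
    ‖v - (inner ℝ x v / ‖x‖ ^ 2) • x‖ ≤ ‖v‖ := by
  have hr := norm_ne_zero_iff.2 hx
  refine le_of_sq_le_sq ?_ (norm_nonneg _)
  rw [norm_sub_sq_real, norm_smul, inner_smul_right, mul_pow, Real.norm_eq_abs, sq_abs,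
    real_inner_comm]
  have : 0 ≤ inner ℝ v x ^ 2 / ‖x‖ ^ 2 := by positivity
  have e : ‖v‖ ^ 2 - 2 * (inner ℝ v x / ‖x‖ ^ 2 * inner ℝ v x)
      + (inner ℝ v x / ‖x‖ ^ 2) ^ 2 * ‖x‖ ^ 2 = ‖v‖ ^ 2 - inner ℝ v x ^ 2 / ‖x‖ ^ 2 := by
    field_simp
    ring
  linarith

/-- By Euler's identity the subtracted term is the radial component of `polyGrad p x`, so the
angular gradient is an orthogonal projection and cannot be longer. -/
lemma norm_angularPartGrad_le (hp : p.IsHomogeneous l) (hx : x ≠ 0) :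
    ‖angularPartGrad p l x‖ ≤ ‖polyGrad p (angle x hx : EuclideanSpace ℝ (Fin n))‖ / ‖x‖ := by
  have hr := norm_pos_iff.2 hx
  rw [polyGrad_angle hp hx, angularPartGrad, ← inner_polyGrad hp, norm_smul, norm_smul, norm_mul,
    norm_norm, mul_assoc, mul_div_cancel_left₀ _ hr.ne']
  exact mul_le_mul_of_nonneg_left (norm_sub_proj_le hx _) (norm_nonneg _)

end AngularPart

end

noncomputable section

/-! ### The homogeneous components of a Sobolev function -/

lemma summable_weight {n : ℕ} {s : ℝ} (hs : ((n : ℝ) + 5) / 2 < s) :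
    Summable fun l : ℕ => ((1 + (l : ℝ)) ^ (((n : ℝ) + 4) / 2 - s)) ^ 2 := by
  have h : Summable fun l : ℕ => ((l + 1 : ℕ) : ℝ) ^ ((n : ℝ) + 4 - 2 * s) :=
    (summable_nat_add_iff 1).2 (Real.summable_nat_rpow.2 (by linarith))
  refine h.congr fun l => ?_
  rw [← Real.rpow_natCast, ← Real.rpow_mul (by positivity)]
  push_cast
  rw [add_comm (l : ℝ)]
  congr 1
  ring

lemma summable_mul_and_tsum_le {f g : ℕ → ℝ} (hf : ∀ l, 0 ≤ f l) (hg : ∀ l, 0 ≤ g l)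
    (hf2 : Summable fun l => f l ^ 2) (hg2 : Summable fun l => g l ^ 2) :
    (Summable fun l => f l * g l) ∧
      ∑' l, f l * g l ≤ √(∑' l, f l ^ 2) * √(∑' l, g l ^ 2) := by
  simp only [Real.sqrt_eq_rpow, ← Real.rpow_two] at hf2 hg2 ⊢
  exact ⟨Real.summable_mul_of_Lp_Lq_of_nonneg Real.HolderConjugate.two_two hf hg hf2 hg2,
    Real.inner_le_Lp_mul_Lq_tsum_of_nonneg Real.HolderConjugate.two_two hf hg hf2 hg2⟩

lemma norm_sum_smul_le_sqrt {ι E : Type*} [Fintype ι] [NormedAddCommGroup E] [NormedSpace ℝ E]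
    (a : ι → ℝ) (v : ι → E) :
    ‖∑ m, a m • v m‖ ≤ √(∑ m, a m ^ 2) * √(∑ m, ‖v m‖ ^ 2) := by
  refine (norm_sum_le _ _).trans ?_
  have h := Real.sum_mul_le_sqrt_mul_sqrt Finset.univ (fun m => |a m|) fun m => ‖v m‖
  simpa only [norm_smul, Real.norm_eq_abs, sq_abs] using h

namespace SphericalHarmonicBasis

variable {n : ℕ} (B : SphericalHarmonicBasis n) (a : (l : ℕ) → Fin (B.d l) → ℝ)

/-- The solid harmonic of degree `l` with coefficients `a l`. -/
def component (l : ℕ) : MvPolynomial (Fin n) ℝ := ∑ m, a l m • B.poly l m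

lemma isHomogeneous_component (l : ℕ) : (B.component a l).IsHomogeneous l :=
  MvPolynomial.IsHomogeneous.sum _ _ _ fun m _ => isHomogeneous_smul (B.isHomogeneous_poly l m) _

lemma polyLap_component (l : ℕ) : polyLap (B.component a l) = 0 := by
  simp [component, polyLap_sum, polyLap_smul, polyLap_poly]

lemma polyFun_component (l : ℕ) (x : EuclideanSpace ℝ (Fin n)) :
    polyFun (B.component a l) x = ∑ m, a l m • polyFun (B.poly l m) x := by
  simp [component]

lemma polyGrad_component (l : ℕ) (x : EuclideanSpace ℝ (Fin n)) :
    polyGrad (B.component a l) x = ∑ m, a l m • polyGrad (B.poly l m) x := by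
  ext i
  simp [component]

/-- Cauchy–Schwarz is used twice: over `m`, against the addition theorem and its gradient version,
and over `l`, against the Sobolev weight. The second use is where `s > (n+5)/2` enters. -/
theorem exists_angularFamily (hn : 2 ≤ n) {s : ℝ} (hs : ((n : ℝ) + 5) / 2 < s) :
    ∃ K : ℝ, 0 < K ∧ ∀ (B : SphericalHarmonicBasis n) (c : (l : ℕ) → Fin (B.d l) → ℂ)
      (a : (l : ℕ) → Fin (B.d l) → ℝ), B.MemSobolev s c →
      (∀ l m, c l m = Complex.I ^ l * (a l m : ℂ)) →
      ∃ 𝒬 : AngularFamily n, (∀ l, 𝒬.Q l = angularPart (B.component a l) l) ∧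
        𝒬.bound ≤ K * B.sobolevNorm s c := by
  obtain ⟨C, hC, hB⟩ := exists_harmonic_bounds hn
  set f : ℕ → ℝ := fun l => (1 + (l : ℝ)) ^ (((n : ℝ) + 4) / 2 - s) with hf
  have hf2 : Summable fun l => f l ^ 2 := summable_weight hs
  have hf0 : ∀ l, 0 < f l := fun l => by positivity
  have hS : 0 < ∑' l, f l ^ 2 := hf2.tsum_pos (fun l => by positivity) 0 (pow_pos (hf0 0) 2)
  refine ⟨√C * √(∑' l, f l ^ 2), by positivity, fun B c a hc hca => ?_⟩
  set A : ℕ → ℝ := fun l => √(∑ m, a l m ^ 2) with hA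
  set g : ℕ → ℝ := fun l => (1 + (l : ℝ)) ^ s * A l with hg
  have hterm : ∀ l, B.sobolevTerm s c l = g l ^ 2 := by
    intro l
    have : ∀ m, ‖c l m‖ ^ 2 = a l m ^ 2 := fun m => by simp [hca]
    simp only [sobolevTerm, this, hg, hA, mul_pow]
    rw [Real.sq_sqrt (Finset.sum_nonneg fun m _ => sq_nonneg _), ← Real.rpow_natCast,
      ← Real.rpow_mul (by positivity), mul_comm s]
    norm_num
  have hg2 : Summable fun l => g l ^ 2 := hc.congr hterm
  obtain ⟨h1, h2⟩ := summable_mul_and_tsum_le (fun l => (hf0 l).le)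
    (fun l => by positivity) hf2 hg2
  set b : ℕ → ℝ := fun l => A l * √(C * (1 + (l : ℝ)) ^ (n - 2)) with hb
  -- The exponents `(n-2)/2` of the pointwise bound and `3` of the weight add up to `(n+4)/2`;
  -- inserting `(1+l)^{±s}` separates the square-summable weight `f` from the Sobolev terms `g`.
  have hb3 : ∀ l, b l * (1 + (l : ℝ)) ^ 3 = √C * (f l * g l) := by
    intro l
    have hl : (0 : ℝ) < 1 + l := by positivity
    have e1 : √((1 + (l : ℝ)) ^ (n - 2)) = (1 + (l : ℝ)) ^ (((n : ℝ) - 2) / 2) := by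
      rw [Real.sqrt_eq_rpow, ← Real.rpow_natCast, ← Real.rpow_mul hl.le, Nat.cast_sub hn]
      norm_num
      ring_nf
    have e2 : f l * (1 + (l : ℝ)) ^ s = (1 + (l : ℝ)) ^ (((n : ℝ) - 2) / 2) * (1 + (l : ℝ)) ^ 3 := by
      rw [hf, ← Real.rpow_add hl, ← Real.rpow_natCast _ 3, ← Real.rpow_add hl]
      congr 1
      push_cast
      ring
    simp only [hb, Real.sqrt_mul hC.le, e1, hg]
    linear_combination - √C * A l * e2
  refine ⟨{ Q := fun l => angularPart (B.component a l) l
            G := fun l => angularPartGrad (B.component a l) l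
            b := b
            hasGradientAt := fun l x hx => hasGradientAt_angularPart hx
            Q_le := fun l x hx => ?_
            G_le := fun l x hx => ?_
            inner_G := fun l x hx => inner_angularPartGrad (B.isHomogeneous_component a l) hx
            Q_angle := fun l x hx => angularPart_angle (B.isHomogeneous_component a l) hx
            G_angle := fun l x hx => angularPartGrad_angle (B.isHomogeneous_component a l) hx
            summable := (h1.mul_left _).congr fun l => (hb3 l).symm }, fun l => rfl, ?_⟩
  · rw [← angularPart_angle (B.isHomogeneous_component a l) hx, angularPart_coe,
      polyFun_component, ← Real.norm_eq_abs]
    refine (norm_sum_smul_le_sqrt _ _).trans ?_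
    simp only [Real.norm_eq_abs, sq_abs]
    exact mul_le_mul_of_nonneg_left (Real.sqrt_le_sqrt (hB B l _).1) (Real.sqrt_nonneg _)
  · refine (norm_angularPartGrad_le (B.isHomogeneous_component a l) hx).trans ?_
    rw [polyGrad_component]
    refine div_le_div_of_nonneg_right ((norm_sum_smul_le_sqrt _ _).trans ?_) (norm_nonneg _)
    rw [hb, mul_assoc]
    refine mul_le_mul_of_nonneg_left ((Real.sqrt_le_sqrt (hB B l _).2).trans_eq ?_)
      (Real.sqrt_nonneg _)
    rw [Real.sqrt_mul (by positivity), Real.sqrt_sq (by positivity)]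
  · simp only [AngularFamily.bound]
    rw [tsum_congr hb3, tsum_mul_left, mul_assoc, sobolevNorm, tsum_congr hterm]
    exact mul_le_mul_of_nonneg_left h2 (Real.sqrt_nonneg _)

end SphericalHarmonicBasis

end

noncomputable section

/-! ### Quarter-turn phases -/

/-- The number `cos (l π / 2)`. -/
def quarterCos (l : ℕ) : ℝ := Real.cos (l * (Real.pi / 2))

/-- The number `sin (l π / 2)`. -/
def quarterSin (l : ℕ) : ℝ := Real.sin (l * (Real.pi / 2))

lemma quarterCos_succ (l : ℕ) : quarterCos (l + 1) = -quarterSin l := by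
  rw [quarterCos, quarterSin, ← Real.cos_add_pi_div_two]
  push_cast
  ring_nf

lemma quarterSin_succ (l : ℕ) : quarterSin (l + 1) = quarterCos l := by
  rw [quarterCos, quarterSin, ← Real.sin_add_pi_div_two]
  push_cast
  ring_nf

lemma quarterCos_two_mul (k : ℕ) : quarterCos (2 * k) = (-1) ^ k := by
  rw [quarterCos, ← Real.cos_nat_mul_pi]
  push_cast
  ring_nf

lemma quarterSin_two_mul (k : ℕ) : quarterSin (2 * k) = 0 := by
  rw [quarterSin, ← Real.sin_nat_mul_pi k]
  push_cast
  ring_nf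

lemma I_pow_eq (l : ℕ) : Complex.I ^ l = quarterCos l + Complex.I * quarterSin l := by
  induction l with
  | zero => simp [quarterCos, quarterSin]
  | succ l ih =>
    rw [pow_succ, ih, quarterCos_succ, quarterSin_succ]
    push_cast
    linear_combination (quarterSin l : ℂ) * Complex.I_sq

lemma abs_quarterCos_le (l : ℕ) : |quarterCos l| ≤ 1 * (1 + (l : ℝ)) ^ 2 := by
  have hl : (0 : ℝ) ≤ l := by positivity
  refine (Real.abs_cos_le_one _).trans ?_
  nlinarith

lemma abs_quarterSin_le (l : ℕ) : |quarterSin l| ≤ 1 * (1 + (l : ℝ)) ^ 2 := by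
  have hl : (0 : ℝ) ≤ l := by positivity
  refine (Real.abs_sin_le_one _).trans ?_
  nlinarith

/-! ### Differentiability of Fourier transforms of densities on the sphere -/

lemma norm_cexp_neg_I_mul (t : ℝ) : ‖Complex.exp (-Complex.I * (t : ℂ))‖ = 1 := by
  rw [Complex.norm_exp]; simp

/-- Differentiation under the integral: as `|ξ| = 1`, the derivative of the kernel has norm at most
`1`, and `‖f‖` dominates. -/
lemma differentiable_fourierSphere {n : ℕ} {f : USphere n → ℂ}
    (hf : Integrable f (areaMeasure n)) : Differentiable ℝ (fourierSphere f) := by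
  intro x
  have hcont : ∀ x : EuclideanSpace ℝ (Fin n), Continuous fun ξ : USphere n =>
      Complex.exp (-Complex.I * ((inner ℝ x (ξ : EuclideanSpace ℝ (Fin n)) : ℝ) : ℂ)) := by
    intro x; fun_prop
  have hmeas : ∀ x : EuclideanSpace ℝ (Fin n), AEStronglyMeasurable (fun ξ : USphere n =>
      Complex.exp (-Complex.I * ((inner ℝ x (ξ : EuclideanSpace ℝ (Fin n)) : ℝ) : ℂ)) * f ξ)
      (areaMeasure n) := fun x => (hcont x).aestronglyMeasurable.mul hf.1
  have hint : Integrable (fun ξ : USphere n =>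
      Complex.exp (-Complex.I * ((inner ℝ x (ξ : EuclideanSpace ℝ (Fin n)) : ℝ) : ℂ)) * f ξ)
      (areaMeasure n) := by
    refine hf.mono (hmeas x) (Eventually.of_forall fun ξ => ?_)
    rw [norm_mul, norm_cexp_neg_I_mul, one_mul]
  refine (hasFDerivAt_integral_of_dominated_of_fderiv_le (𝕜 := ℝ) (s := Set.univ)
    (F' := fun x (ξ : USphere n) =>
      (Complex.exp (-Complex.I * ((inner ℝ x (ξ : EuclideanSpace ℝ (Fin n)) : ℝ) : ℂ)) *
        -Complex.I * f ξ) • Complex.ofRealCLM.comp (innerSL ℝ (ξ : EuclideanSpace ℝ (Fin n))))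
    (bound := fun ξ => ‖f ξ‖) Filter.univ_mem (Eventually.of_forall hmeas) hint ?_ ?_ hf.norm
    ?_).differentiableAt
  · refine AEStronglyMeasurable.smul
      (((hcont x).mul continuous_const).aestronglyMeasurable.mul hf.1) ?_
    refine Continuous.aestronglyMeasurable ?_
    fun_prop
  · refine Eventually.of_forall fun ξ x _ => ?_
    refine ContinuousLinearMap.opNorm_le_bound _ (norm_nonneg _) fun v => ?_
    simp only [_root_.smul_apply, ContinuousLinearMap.comp_apply, smul_eq_mul,
      norm_mul, norm_neg, Complex.norm_I, norm_cexp_neg_I_mul, mul_one, one_mul,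
      Complex.ofRealCLM_apply, Complex.norm_real, innerSL_apply_apply]
    refine mul_le_mul_of_nonneg_left ((norm_inner_le_norm _ _).trans_eq ?_) (norm_nonneg _)
    rw [norm_coe_sphere, one_mul]
  · refine Eventually.of_forall fun ξ x _ => ?_
    have h1 : HasFDerivAt (fun x : EuclideanSpace ℝ (Fin n) =>
        ((inner ℝ x (ξ : EuclideanSpace ℝ (Fin n)) : ℝ) : ℂ))
        (Complex.ofRealCLM.comp (innerSL ℝ (ξ : EuclideanSpace ℝ (Fin n)))) x := by
      refine ((Complex.ofRealCLM.comp (innerSL ℝ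
        (ξ : EuclideanSpace ℝ (Fin n)))).hasFDerivAt).congr_of_eventuallyEq ?_
      exact Eventually.of_forall fun y => by simp [real_inner_comm]
    refine (((h1.const_mul (-Complex.I)).cexp).mul_const (f ξ)).congr_fderiv ?_
    ext v
    simp
    ring

namespace SphericalHarmonicBasis

variable {n : ℕ} {B : SphericalHarmonicBasis n} {f : USphere n → ℂ}
  {c : (l : ℕ) → Fin (B.d l) → ℂ} {a : (l : ℕ) → Fin (B.d l) → ℝ}

lemma sum_coeff_mul_Y (hca : ∀ l m, c l m = Complex.I ^ l * (a l m : ℂ)) (l : ℕ) (ξ : USphere n) :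
    ∑ m, c l m * (B.Y l m ξ : ℂ) = Complex.I ^ l *
      (polyFun (B.component a l) (ξ : EuclideanSpace ℝ (Fin n)) : ℂ) := by
  rw [polyFun_component, Complex.ofReal_sum, Finset.mul_sum]
  refine Finset.sum_congr rfl fun m _ => ?_
  rw [hca, Y_eq, smul_eq_mul, Complex.ofReal_mul, mul_assoc]

lemma continuous_partialSum (hca : ∀ l m, c l m = Complex.I ^ l * (a l m : ℂ)) (L : ℕ) :
    Continuous fun ξ => ∑ l ∈ Finset.range L, ∑ m, c l m * (B.Y l m ξ : ℂ) := by
  simp only [sum_coeff_mul_Y hca]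
  exact continuous_finsetSum _ fun l _ =>
    continuous_const.mul (Complex.continuous_ofReal.comp (continuous_polyFun_sphere _))

/-- The area measure is finite, so `L²` convergence implies `L¹` convergence, which a unimodular
kernel preserves. -/
lemma IsExpansion.tendsto_integral (h : B.IsExpansion f c)
    (hca : ∀ l m, c l m = Complex.I ^ l * (a l m : ℂ)) {g : USphere n → ℂ} (hg : Continuous g)
    (hg1 : ∀ ξ, ‖g ξ‖ = 1) :
    Tendsto (fun L => ∫ ξ, g ξ * ∑ l ∈ Finset.range L, ∑ m, c l m * (B.Y l m ξ : ℂ)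
      ∂(areaMeasure n)) atTop (𝓝 (∫ ξ, g ξ * f ξ ∂(areaMeasure n))) := by
  have hS := continuous_partialSum (B := B) hca
  refine tendsto_integral_of_L1' _ (hg.aestronglyMeasurable.mul h.1.1)
    (Eventually.of_forall fun L => integrable_of_continuous_sphere (hg.mul (hS L))) ?_
  have hle : ∀ L, eLpNorm ((fun ξ => g ξ * ∑ l ∈ Finset.range L, ∑ m, c l m * (B.Y l m ξ : ℂ))
      - fun ξ => g ξ * f ξ) 1 (areaMeasure n) ≤
      eLpNorm (fun ξ => f ξ - ∑ l ∈ Finset.range L, ∑ m, c l m * (B.Y l m ξ : ℂ)) 2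
        (areaMeasure n) * areaMeasure n Set.univ ^
          (1 / (1 : ENNReal).toReal - 1 / (2 : ENNReal).toReal) := by
    intro L
    refine le_trans (eLpNorm_mono fun ξ => le_of_eq ?_) (eLpNorm_le_eLpNorm_mul_rpow_measure_univ
      one_le_two (h.1.1.sub (hS L).aestronglyMeasurable))
    rw [Pi.sub_apply, ← mul_sub, norm_mul, hg1, one_mul, norm_sub_rev]
  refine tendsto_of_tendsto_of_tendsto_of_le_of_le tendsto_const_nhds ?_ (fun L => zero_le) hle
  have := ENNReal.Tendsto.mul_const (b := areaMeasure n Set.univ ^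
    (1 / (1 : ENNReal).toReal - 1 / (2 : ENNReal).toReal)) h.2
    (Or.inr (ENNReal.rpow_ne_top_of_nonneg (by norm_num) (measure_ne_top _ _)))
  simpa only [zero_mul] using this

lemma IsExpansion.tendsto_fourierSphere (hn : 2 ≤ n) (h : B.IsExpansion f c)
    (hca : ∀ l m, c l m = Complex.I ^ l * (a l m : ℂ)) (x : EuclideanSpace ℝ (Fin n)) :
    Tendsto (fun L => ((∑ l ∈ Finset.range L, fourierRadial n l ‖x‖ *
      polyFun (B.component a l) x : ℝ) : ℂ)) atTop (𝓝 (fourierSphere f x)) := by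
  have hg : Continuous fun ξ : USphere n =>
      Complex.exp (-Complex.I * ((inner ℝ x (ξ : EuclideanSpace ℝ (Fin n)) : ℝ) : ℂ)) := by
    fun_prop
  refine (h.tendsto_integral hca hg fun ξ => norm_cexp_neg_I_mul _).congr fun L => ?_
  simp only [sum_coeff_mul_Y hca, Finset.mul_sum]
  have hint : ∀ l ∈ Finset.range L, Integrable (fun ξ : USphere n =>
      Complex.exp (-Complex.I * ((inner ℝ x (ξ : EuclideanSpace ℝ (Fin n)) : ℝ) : ℂ)) *
        (Complex.I ^ l * (polyFun (B.component a l) (ξ : EuclideanSpace ℝ (Fin n)) : ℂ)))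
      (areaMeasure n) := fun l _ => integrable_of_continuous_sphere (hg.mul
    (continuous_const.mul (Complex.continuous_ofReal.comp (continuous_polyFun_sphere _))))
  rw [integral_finsetSum _ hint, Complex.ofReal_sum]
  refine Finset.sum_congr rfl fun l _ => ?_
  simp only [mul_left_comm _ (Complex.I ^ l)]
  rw [integral_const_mul, integral_cexp_mul_harmonic hn (B.isHomogeneous_component a l)
    (B.polyLap_component a l), ← mul_assoc, ← mul_pow, mul_neg, Complex.I_mul_I, neg_neg, one_pow,
    one_mul]

lemma IsExpansion.fourierSphere_eq_re (hn : 2 ≤ n) (h : B.IsExpansion f c)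
    (hca : ∀ l m, c l m = Complex.I ^ l * (a l m : ℂ)) (x : EuclideanSpace ℝ (Fin n)) :
    fourierSphere f x = ((fourierSphere f x).re : ℂ) := by
  have him := (Complex.continuous_im.tendsto _).comp (h.tendsto_fourierSphere hn hca x)
  refine Complex.ext rfl ?_
  refine (tendsto_nhds_unique him ?_).trans (Complex.ofReal_im _).symm
  exact tendsto_const_nhds.congr fun L => (Complex.ofReal_im _).symm

/-! ### The real and imaginary parts of the density -/

variable {𝒬 : AngularFamily n}

lemma evenTerm_eq (hQ : ∀ l, 𝒬.Q l = angularPart (B.component a l) l) (ξ : USphere n) (k : ℕ) :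
    B.evenTerm a ξ k = quarterCos (2 * k) * 𝒬.Q (2 * k) (ξ : EuclideanSpace ℝ (Fin n)) := by
  rw [quarterCos_two_mul, hQ, angularPart_coe, polyFun_component, evenTerm, Finset.mul_sum]
  exact Finset.sum_congr rfl fun m _ => by rw [Y_eq, smul_eq_mul, mul_assoc]

lemma oddTerm_eq (hQ : ∀ l, 𝒬.Q l = angularPart (B.component a l) l) (ξ : USphere n) (k : ℕ) :
    B.oddTerm a ξ k
      = quarterSin (2 * k + 1) * 𝒬.Q (2 * k + 1) (ξ : EuclideanSpace ℝ (Fin n)) := by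
  rw [quarterSin_succ, quarterCos_two_mul, hQ, angularPart_coe, polyFun_component, oddTerm,
    Finset.mul_sum]
  exact Finset.sum_congr rfl fun m _ => by rw [Y_eq, smul_eq_mul, mul_assoc]

lemma summable_evenTerm (hQ : ∀ l, 𝒬.Q l = angularPart (B.component a l) l) (ξ : USphere n) :
    Summable (B.evenTerm a ξ) := by
  have h := (AngularFamily.summable_series (𝒬 := 𝒬) (e := fun l _ => quarterCos l)
    (coe_sphere_ne_zero ξ) abs_quarterCos_le).comp_injective
    (mul_right_injective₀ (two_ne_zero (α := ℕ)))
  exact h.congr fun k => (evenTerm_eq hQ ξ k).symm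

lemma summable_oddTerm (hQ : ∀ l, 𝒬.Q l = angularPart (B.component a l) l) (ξ : USphere n) :
    Summable (B.oddTerm a ξ) := by
  have h := (AngularFamily.summable_series (𝒬 := 𝒬) (e := fun l _ => quarterSin l)
    (coe_sphere_ne_zero ξ) abs_quarterSin_le).comp_injective
    ((add_left_injective 1).comp (mul_right_injective₀ (two_ne_zero (α := ℕ))))
  exact h.congr fun k => (oddTerm_eq hQ ξ k).symm

/-- Since `cos (lπ/2)` is `(-1)^{l/2}` for even `l` and `0` for odd `l`, the even part becomes a
series over all degrees. The odd part is treated in the same way with the sine. -/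
lemma evenPart_eq_series (hQ : ∀ l, 𝒬.Q l = angularPart (B.component a l) l) (ξ : USphere n) :
    B.evenPart a ξ = 𝒬.series (fun l _ => quarterCos l) (ξ : EuclideanSpace ℝ (Fin n)) := by
  set q : ℕ → ℝ := fun l => quarterCos l * 𝒬.Q l (ξ : EuclideanSpace ℝ (Fin n)) with hq
  have h0 : ∀ k, q (2 * k + 1) = 0 := fun k => by
    rw [hq]; simp only [quarterCos_succ, quarterSin_two_mul, neg_zero, zero_mul]
  have h1 : B.evenTerm a ξ = fun k => q (2 * k) := funext (evenTerm_eq hQ ξ)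
  have h2 := tsum_even_add_odd (h1 ▸ summable_evenTerm hQ ξ)
    (summable_zero.congr fun k => (h0 k).symm)
  rw [tsum_congr h0, tsum_zero, add_zero] at h2
  rw [evenPart, h1, h2]
  rfl

lemma oddPart_eq_series (hQ : ∀ l, 𝒬.Q l = angularPart (B.component a l) l) (ξ : USphere n) :
    B.oddPart a ξ = 𝒬.series (fun l _ => quarterSin l) (ξ : EuclideanSpace ℝ (Fin n)) := by
  set q : ℕ → ℝ := fun l => quarterSin l * 𝒬.Q l (ξ : EuclideanSpace ℝ (Fin n)) with hq
  have h0 : ∀ k, q (2 * k) = 0 := fun k => by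
    rw [hq]; simp only [quarterSin_two_mul, zero_mul]
  have h1 : B.oddTerm a ξ = fun k => q (2 * k + 1) := funext (oddTerm_eq hQ ξ)
  have h2 := tsum_even_add_odd (summable_zero.congr fun k => (h0 k).symm)
    (h1 ▸ summable_oddTerm hQ ξ)
  rw [tsum_congr h0, tsum_zero, zero_add] at h2
  rw [oddPart, h1, h2]
  rfl

/-- `L²` convergence gives almost everywhere convergence along a subsequence, while the partial sums
converge pointwise everywhere; `i^l = cos (lπ/2) + i sin (lπ/2)` identifies the limit. -/
lemma IsExpansion.ae_eq (h : B.IsExpansion f c)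
    (hca : ∀ l m, c l m = Complex.I ^ l * (a l m : ℂ))
    (hQ : ∀ l, 𝒬.Q l = angularPart (B.component a l) l) :
    ∀ᵐ ξ ∂(areaMeasure n), f ξ = (B.evenPart a ξ : ℂ) + Complex.I * (B.oddPart a ξ : ℂ) := by
  have hS := continuous_partialSum (B := B) hca
  have hm : TendstoInMeasure (areaMeasure n)
      (fun L ξ => ∑ l ∈ Finset.range L, ∑ m, c l m * (B.Y l m ξ : ℂ)) atTop f := by
    refine tendstoInMeasure_of_tendsto_eLpNorm two_ne_zero
      (fun L => (hS L).aestronglyMeasurable) h.1.1 (h.2.congr fun L => ?_)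
    rw [eLpNorm_sub_comm]
    rfl
  obtain ⟨ns, hns, hae⟩ := hm.exists_seq_tendsto_ae
  filter_upwards [hae] with ξ hξ
  refine tendsto_nhds_unique hξ (Tendsto.comp (g := fun L =>
    ∑ l ∈ Finset.range L, ∑ m, c l m * (B.Y l m ξ : ℂ)) ?_ hns.tendsto_atTop)
  have h1 := (AngularFamily.summable_series (𝒬 := 𝒬) (e := fun l _ => quarterCos l)
    (coe_sphere_ne_zero ξ) abs_quarterCos_le).hasSum.tendsto_sum_nat
  have h2 := (AngularFamily.summable_series (𝒬 := 𝒬) (e := fun l _ => quarterSin l)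
    (coe_sphere_ne_zero ξ) abs_quarterSin_le).hasSum.tendsto_sum_nat
  rw [evenPart_eq_series hQ, oddPart_eq_series hQ]
  refine (((Complex.continuous_ofReal.tendsto _).comp h1).add
    (((Complex.continuous_ofReal.tendsto _).comp h2).const_mul Complex.I)).congr fun L => ?_
  simp only [Function.comp_apply, Complex.ofReal_sum, Finset.mul_sum, ← Finset.sum_add_distrib]
  refine Finset.sum_congr rfl fun l _ => ?_
  rw [sum_coeff_mul_Y hca, I_pow_eq, hQ, angularPart_coe]
  push_cast
  ring

lemma homExt_evenPart (hQ : ∀ l, 𝒬.Q l = angularPart (B.component a l) l)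
    {x : EuclideanSpace ℝ (Fin n)} (hx : x ≠ 0) :
    homExt (B.evenPart a) x = 𝒬.series (fun l _ => quarterCos l) x := by
  rw [homExt, dif_neg hx, evenPart_eq_series hQ, AngularFamily.series_angle]

lemma homExt_oddPart (hQ : ∀ l, 𝒬.Q l = angularPart (B.component a l) l)
    {x : EuclideanSpace ℝ (Fin n)} (hx : x ≠ 0) :
    homExt (B.oddPart a) x = 𝒬.series (fun l _ => quarterSin l) x := by
  rw [homExt, dif_neg hx, oddPart_eq_series hQ, AngularFamily.series_angle]

end SphericalHarmonicBasis

end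

noncomputable section

/-! ### Asymptotic expansion of superpositions of Bessel waves -/

/-- The normalized Bessel function attached to spherical harmonics of degree `l`. -/
def sphereWave (n l : ℕ) (r : ℝ) : ℝ := besselWave (sphereOrder n l) r

/-- The derivative of `sphereWave`. -/
def sphereWaveDeriv (n l : ℕ) (r : ℝ) : ℝ := besselWaveDeriv (sphereOrder n l) r

/-- The remainder in the asymptotic expansion of `sphereWave`. -/
def sphereWaveError (n l : ℕ) (r : ℝ) : ℝ :=
  sphereWave n l r - Real.cos (r - besselPhase (sphereOrder n l))

/-- The derivative of `sphereWaveError`. -/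
def sphereWaveErrorDeriv (n l : ℕ) (r : ℝ) : ℝ :=
  sphereWaveDeriv n l r + Real.sin (r - besselPhase (sphereOrder n l))

lemma sphereWave_eq (n l : ℕ) (r : ℝ) :
    sphereWave n l r = quarterCos l * Real.cos (r - Real.pi / 4 * ((n : ℝ) - 1))
      + quarterSin l * Real.sin (r - Real.pi / 4 * ((n : ℝ) - 1)) + sphereWaveError n l r := by
  rw [sphereWaveError, besselPhase_sphereOrder, ← sub_sub,
    Real.cos_sub (r - Real.pi / 4 * ((n : ℝ) - 1)), quarterCos, quarterSin]
  ring

lemma sphereWaveDeriv_eq (n l : ℕ) (r : ℝ) :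
    sphereWaveDeriv n l r = quarterCos l * -Real.sin (r - Real.pi / 4 * ((n : ℝ) - 1))
      + quarterSin l * Real.cos (r - Real.pi / 4 * ((n : ℝ) - 1)) + sphereWaveErrorDeriv n l r := by
  rw [sphereWaveErrorDeriv, besselPhase_sphereOrder, ← sub_sub,
    Real.sin_sub (r - Real.pi / 4 * ((n : ℝ) - 1)), quarterCos,
    quarterSin]
  ring

lemma hasDerivAt_sphereWave {n : ℕ} (hn : 2 ≤ n) (l : ℕ) {r : ℝ} (hr : 0 < r) :
    HasDerivAt (sphereWave n l) (sphereWaveDeriv n l r) r :=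
  hasDerivAt_besselWave (sphereOrder_nonneg hn l) hr

lemma hasDerivAt_sphereWaveError {n : ℕ} (hn : 2 ≤ n) (l : ℕ) {r : ℝ} (hr : 0 < r) :
    HasDerivAt (sphereWaveError n l) (sphereWaveErrorDeriv n l r) r := by
  refine ((hasDerivAt_sphereWave hn l hr).sub
    (((hasDerivAt_id r).sub_const (besselPhase (sphereOrder n l))).cos)).congr_deriv ?_
  simp [sphereWaveErrorDeriv]

/-- Bounds for Bessel waves that are uniform in the argument and polynomial in the degree. -/
structure SphereWaveBound (n : ℕ) (D : ℝ) : Prop where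
  pos : 0 < D
  error : ∀ (l : ℕ) (r : ℝ), 0 < r → |sphereWaveError n l r| ≤ D * (1 + (l : ℝ)) ^ 2
  error_div : ∀ (l : ℕ) (r : ℝ), 0 < r → |sphereWaveError n l r| ≤ D / r * (1 + (l : ℝ)) ^ 2
  errorDeriv : ∀ (l : ℕ) (r : ℝ), 0 < r →
    |sphereWaveErrorDeriv n l r| ≤ D / r * (1 + (l : ℝ)) ^ 2

lemma exists_sphereWaveBound {n : ℕ} (hn : 2 ≤ n) : ∃ D, SphereWaveBound n D := by
  obtain ⟨D, hD, h⟩ := exists_besselWave_bound hn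
  refine ⟨D, hD, fun l r hr => (h l r hr).1, fun l r hr => (h l r hr).2.1.trans_eq ?_,
    fun l r hr => (h l r hr).2.2.trans_eq ?_⟩ <;> ring

namespace SphereWaveBound

variable {n : ℕ} {D : ℝ} {r : ℝ}

lemma errorDeriv_of_pos (h : SphereWaveBound n D) (l : ℕ) (hr : 0 < r) :
    |sphereWaveErrorDeriv n l r| ≤ D * (1 + 1 / r) * (1 + (l : ℝ)) ^ 2 := by
  refine (h.errorDeriv l r hr).trans (mul_le_mul_of_nonneg_right ?_ (by positivity))
  rw [mul_add, mul_one, mul_one_div]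
  linarith [h.pos]

lemma wave (h : SphereWaveBound n D) (l : ℕ) (hr : 0 < r) :
    |sphereWave n l r| ≤ (D + 1) * (1 + (l : ℝ)) ^ 2 := by
  have hl : (0 : ℝ) ≤ l := by positivity
  have e : sphereWave n l r
      = sphereWaveError n l r + Real.cos (r - besselPhase (sphereOrder n l)) := by
    rw [sphereWaveError]; ring
  rw [e, add_mul]
  refine (abs_add_le _ _).trans (add_le_add (h.error l r hr) ((Real.abs_cos_le_one _).trans ?_))
  nlinarith

lemma waveDeriv (h : SphereWaveBound n D) (l : ℕ) (hr : 0 < r) :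
    |sphereWaveDeriv n l r| ≤ (D + 1) * (1 + 1 / r) * (1 + (l : ℝ)) ^ 2 := by
  have hl : (0 : ℝ) ≤ l := by positivity
  have e : sphereWaveDeriv n l r
      = sphereWaveErrorDeriv n l r + -Real.sin (r - besselPhase (sphereOrder n l)) := by
    rw [sphereWaveErrorDeriv]; ring
  rw [e, add_mul, add_mul]
  refine (abs_add_le _ _).trans (add_le_add (h.errorDeriv_of_pos l hr) ?_)
  rw [abs_neg, one_mul]
  refine (Real.abs_sin_le_one _).trans (one_le_mul_of_one_le_of_one_le ?_ (by nlinarith))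
  linarith [one_div_pos.2 hr]

end SphereWaveBound

namespace AngularFamily

variable {n : ℕ} {𝒬 : AngularFamily n} {x : EuclideanSpace ℝ (Fin n)} {D : ℝ}

lemma series_quarter {e f : ℕ → ℝ → ℝ} {p q : ℝ} (hx : x ≠ 0)
    (hef : ∀ l, f l ‖x‖ = quarterCos l * p + quarterSin l * q + e l ‖x‖)
    (he : ∀ l, |e l ‖x‖| ≤ D * (1 + (l : ℝ)) ^ 2) :
    𝒬.series f x = 𝒬.series (fun l _ => quarterCos l) x * p
      + 𝒬.series (fun l _ => quarterSin l) x * q + 𝒬.series e x := by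
  have h1 := (summable_series (𝒬 := 𝒬) (e := fun l _ => quarterCos l) hx
    abs_quarterCos_le).mul_right p
  have h2 := (summable_series (𝒬 := 𝒬) (e := fun l _ => quarterSin l) hx
    abs_quarterSin_le).mul_right q
  simp only [series]
  rw [← tsum_mul_right, ← tsum_mul_right, ← h1.tsum_add h2,
    ← (h1.add h2).tsum_add (summable_series hx he)]
  refine tsum_congr fun l => ?_
  rw [hef]
  ring

lemma gradSeries_quarter {e f : ℕ → ℝ → ℝ} {p q : ℝ} (hx : x ≠ 0)
    (hef : ∀ l, f l ‖x‖ = quarterCos l * p + quarterSin l * q + e l ‖x‖)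
    (he : ∀ l, |e l ‖x‖| ≤ D * (1 + (l : ℝ)) ^ 2) :
    𝒬.gradSeries f x = p • 𝒬.gradSeries (fun l _ => quarterCos l) x
      + q • 𝒬.gradSeries (fun l _ => quarterSin l) x + 𝒬.gradSeries e x := by
  have h1 := (summable_gradSeries (𝒬 := 𝒬) (e := fun l _ => quarterCos l) hx
    abs_quarterCos_le).const_smul p
  have h2 := (summable_gradSeries (𝒬 := 𝒬) (e := fun l _ => quarterSin l) hx
    abs_quarterSin_le).const_smul q
  simp only [gradSeries]
  rw [← tsum_const_smul'', ← tsum_const_smul'', ← h1.tsum_add h2,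
    ← (h1.add h2).tsum_add (summable_gradSeries hx he)]
  refine tsum_congr fun l => ?_
  rw [hef]
  module

lemma hasGradientAt_series_const {c : ℕ → ℝ} (hx : x ≠ 0)
    (hc : ∀ l, |c l| ≤ 1 * (1 + (l : ℝ)) ^ 2) :
    HasGradientAt (𝒬.series fun l _ => c l) (𝒬.gradSeries (fun l _ => c l) x) x := by
  have h := hasGradientAt_series (𝒬 := 𝒬) (e := fun l _ => c l) (e' := fun _ _ => 0) (D := 1)
    (fun l r _ => hasDerivAt_const r _) (fun l r _ => hc l)
    (fun l r hr => by rw [abs_zero]; positivity) hx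
  simpa [series] using h

lemma hasGradientAt_wave (hn : 2 ≤ n) (hD : SphereWaveBound n D) (hx : x ≠ 0) :
    HasGradientAt (𝒬.series (sphereWave n))
    ((‖x‖⁻¹ * 𝒬.series (sphereWaveDeriv n) x) • x + 𝒬.gradSeries (sphereWave n) x) x :=
  hasGradientAt_series (fun l _ hr => hasDerivAt_sphereWave hn l hr) (fun l _ hr => hD.wave l hr)
    (fun l _ hr => hD.waveDeriv l hr) hx

lemma hasGradientAt_waveError (hn : 2 ≤ n) (hD : SphereWaveBound n D) (hx : x ≠ 0) :
    HasGradientAt (𝒬.series (sphereWaveError n))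
    ((‖x‖⁻¹ * 𝒬.series (sphereWaveErrorDeriv n) x) • x + 𝒬.gradSeries (sphereWaveError n) x) x :=
  hasGradientAt_series (fun l _ hr => hasDerivAt_sphereWaveError hn l hr) hD.error
    (fun l _ hr => hD.errorDeriv_of_pos l hr) hx

/-- Two bounds on the same remainder are needed. In the gradient of the first error the tangential
derivative already supplies `1/|x|`, so the bound `D` is used; in the last term the factor `|x|`
removes it, so `D/|x|` is used. The constant `5D` counts the first, third and fourth terms once and
the gradient twice. -/
lemma error_bound (hD : SphereWaveBound n D) (hx : x ≠ 0) {α : ℝ} (hα : 0 ≤ α) :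
    |𝒬.series (sphereWaveError n) x|
      + ‖(‖x‖⁻¹ * 𝒬.series (sphereWaveErrorDeriv n) x) • x + 𝒬.gradSeries (sphereWaveError n) x‖
      + |𝒬.series (sphereWaveErrorDeriv n) x - α / ‖x‖ * 𝒬.series (sphereWave n) x|
      + ‖‖x‖ • 𝒬.gradSeries (sphereWaveError n) x‖
      ≤ (5 * D + α * (D + 1)) * 𝒬.bound / ‖x‖ := by
  have hr : 0 < ‖x‖ := norm_pos_iff.2 hx
  have h1 := abs_series_le (𝒬 := 𝒬) hx fun l => hD.error_div l _ hr
  have h2 := abs_series_le (𝒬 := 𝒬) hx fun l => hD.errorDeriv l _ hr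
  have h3 := abs_series_le (𝒬 := 𝒬) hx fun l => hD.wave l hr
  have h4 := norm_gradSeries_le (𝒬 := 𝒬) hx fun l => hD.error l _ hr
  have h5 := norm_gradSeries_le (𝒬 := 𝒬) hx fun l => hD.error_div l _ hr
  have b1 : ‖(‖x‖⁻¹ * 𝒬.series (sphereWaveErrorDeriv n) x) • x
      + 𝒬.gradSeries (sphereWaveError n) x‖ ≤ D / ‖x‖ * 𝒬.bound + D / ‖x‖ * 𝒬.bound := by
    refine (norm_add_le _ _).trans (add_le_add (le_trans (le_of_eq ?_) h2) h4)
    rw [norm_smul, norm_mul, norm_inv, norm_norm, Real.norm_eq_abs, mul_comm, ← mul_assoc,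
      mul_inv_cancel₀ hr.ne', one_mul]
  have b2 : |𝒬.series (sphereWaveErrorDeriv n) x - α / ‖x‖ * 𝒬.series (sphereWave n) x|
      ≤ D / ‖x‖ * 𝒬.bound + α / ‖x‖ * ((D + 1) * 𝒬.bound) := by
    refine (abs_sub _ _).trans (add_le_add h2 ?_)
    rw [abs_mul, abs_of_nonneg (by positivity)]
    exact mul_le_mul_of_nonneg_left h3 (by positivity)
  have b3 : ‖‖x‖ • 𝒬.gradSeries (sphereWaveError n) x‖ ≤ D / ‖x‖ * 𝒬.bound := by
    rw [norm_smul, norm_norm]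
    refine (mul_le_mul_of_nonneg_left h5 hr.le).trans_eq ?_
    field_simp
  refine (add_le_add (add_le_add (add_le_add h1 b1) b2) b3).trans_eq ?_
  ring

end AngularFamily

/-! ### Gradients split into radial and tangential parts -/

section Polar

variable {n : ℕ} {u : EuclideanSpace ℝ (Fin n) → ℝ} {x v : EuclideanSpace ℝ (Fin n)} {t : ℝ}

lemma radialDeriv_eq (hx : x ≠ 0) (hu : HasGradientAt u ((‖x‖⁻¹ * t) • x + v) x)
    (hv : inner ℝ x v = 0) : radialDeriv u x = t := by
  have hr := norm_ne_zero_iff.2 hx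
  rw [radialDeriv, hu.gradient, inner_smul_left, inner_add_right, inner_smul_right, hv,
    real_inner_self_eq_norm_sq, RCLike.conj_to_real]
  field_simp
  ring

lemma angularGradient_eq (hx : x ≠ 0) (hu : HasGradientAt u ((‖x‖⁻¹ * t) • x + v) x)
    (hv : inner ℝ x v = 0) : angularGradient u x = v := by
  have hr := norm_ne_zero_iff.2 hx
  rw [angularGradient, hu.gradient, inner_add_right, inner_smul_right, hv,
    real_inner_self_eq_norm_sq, add_zero, mul_div_cancel_right₀ _ (pow_ne_zero 2 hr),
    add_sub_cancel_left]

/-- Differentiating the amplitude `r^{-α}` affects only the radial component, through `-α/r`, one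
order below the leading term. -/
lemma hasGradientAt_div_rpow_mul {V : EuclideanSpace ℝ (Fin n) → ℝ} {κ α : ℝ} (hx : x ≠ 0)
    (hV : HasGradientAt V ((‖x‖⁻¹ * t) • x + v) x) :
    HasGradientAt (fun y => κ / ‖y‖ ^ α * V y)
      ((‖x‖⁻¹ * (κ / ‖x‖ ^ α * (t - α / ‖x‖ * V x))) • x + (κ / ‖x‖ ^ α) • v) x := by
  have hr : 0 < ‖x‖ := norm_pos_iff.2 hx
  have h0 : HasDerivAt (fun r : ℝ => κ / r ^ α) (-(κ / ‖x‖ ^ α * (α / ‖x‖))) ‖x‖ := by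
    refine ((hasDerivAt_const ‖x‖ κ).fun_div (Real.hasDerivAt_rpow_const (Or.inl hr.ne'))
      (Real.rpow_pos_of_pos hr α).ne').congr_deriv ?_
    have := (Real.rpow_pos_of_pos hr α).ne'
    rw [Real.rpow_sub_one hr.ne']
    field_simp
    ring
  have h1 := HasDerivAt.comp_hasFDerivAt x h0 (AngularFamily.hasGradientAt_norm hx).hasFDerivAt
  rw [hasGradientAt_iff_hasFDerivAt]
  refine (h1.mul hV.hasFDerivAt).congr_fderiv ?_
  ext w
  simp
  ring

end Polar

lemma SphericalHarmonicBasis.IsExpansion.fourierSphere_eq_series {n : ℕ} (hn : 2 ≤ n)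
    {B : SphericalHarmonicBasis n} {f : USphere n → ℂ} {c : (l : ℕ) → Fin (B.d l) → ℂ}
    {a : (l : ℕ) → Fin (B.d l) → ℝ} (h : B.IsExpansion f c)
    (hca : ∀ l m, c l m = Complex.I ^ l * (a l m : ℂ)) {𝒬 : AngularFamily n}
    (hQ : ∀ l, 𝒬.Q l = angularPart (B.component a l) l) {D : ℝ} (hD : SphereWaveBound n D)
    {x : EuclideanSpace ℝ (Fin n)} (hx : x ≠ 0) :
    (fourierSphere f x).re = 2 * (2 * Real.pi) ^ (((n : ℝ) - 1) / 2) /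
      ‖x‖ ^ (((n : ℝ) - 1) / 2) * 𝒬.series (sphereWave n) x := by
  have hr : 0 < ‖x‖ := norm_pos_iff.2 hx
  have h1 := (Complex.continuous_re.tendsto _).comp (h.tendsto_fourierSphere hn hca x)
  have h2 := (AngularFamily.summable_series (𝒬 := 𝒬) hx
    fun l => hD.wave l hr).hasSum.tendsto_sum_nat.const_mul
      (2 * (2 * Real.pi) ^ (((n : ℝ) - 1) / 2) / ‖x‖ ^ (((n : ℝ) - 1) / 2))
  refine tendsto_nhds_unique h1 (h2.congr fun L => ?_)
  rw [Function.comp_apply, Complex.ofReal_re, Finset.mul_sum]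
  refine Finset.sum_congr rfl fun l _ => ?_
  rw [sphereWave, ← mul_assoc, ← fourierRadial_eq_besselWave l hr, hQ, angularPart, mul_assoc,
    mul_inv_cancel_left₀ (pow_ne_zero l hr.ne')]

theorem proposition2p2 (n : ℕ) (hn : 2 ≤ n) (s : ℝ) (hs : ((n : ℝ) + 5) / 2 < s) :
    ∃ C : ℝ, 0 < C ∧
    ∀ (B : SphericalHarmonicBasis n) (f : USphere n → ℂ)
      (c : (l : ℕ) → Fin (B.d l) → ℂ) (a : (l : ℕ) → Fin (B.d l) → ℝ),
    B.IsExpansion f c → B.MemSobolev s c → (∀ l m, c l m = Complex.I ^ l * (a l m : ℂ)) →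
    -- the series of `f_R` and `f_I` converge to differentiable functions and `f = f_R + i f_I`
    (∀ ξ, Summable (B.evenTerm a ξ) ∧ Summable (B.oddTerm a ξ)) ∧
    (∀ x, x ≠ 0 → DifferentiableAt ℝ (homExt (B.evenPart a)) x ∧
      DifferentiableAt ℝ (homExt (B.oddPart a)) x) ∧
    (∀ᵐ ξ ∂(areaMeasure n), f ξ = (B.evenPart a ξ : ℂ) + Complex.I * (B.oddPart a ξ : ℂ)) ∧
    -- the Fourier transform of `f dS` is a real-valued differentiable function `u`
    ∃ u : EuclideanSpace ℝ (Fin n) → ℝ,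
    (∀ x, fourierSphere f x = (u x : ℂ)) ∧ Differentiable ℝ u ∧
    -- the asymptotic expansions
    ∃ (E₁ E₂ : EuclideanSpace ℝ (Fin n) → ℝ)
      (E₃ : EuclideanSpace ℝ (Fin n) → EuclideanSpace ℝ (Fin n)),
    ∀ (x : EuclideanSpace ℝ (Fin n)) (hx : x ≠ 0),
      u x = 2 * (2 * Real.pi) ^ (((n : ℝ) - 1) / 2) / ‖x‖ ^ (((n : ℝ) - 1) / 2) *
        (B.evenPart a (angle x hx) * Real.cos (‖x‖ - Real.pi / 4 * ((n : ℝ) - 1))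
          + B.oddPart a (angle x hx) * Real.sin (‖x‖ - Real.pi / 4 * ((n : ℝ) - 1))
          + E₁ x) ∧
      radialDeriv u x =
        2 * (2 * Real.pi) ^ (((n : ℝ) - 1) / 2) / ‖x‖ ^ (((n : ℝ) - 1) / 2) *
        (-(B.evenPart a (angle x hx)) * Real.sin (‖x‖ - Real.pi / 4 * ((n : ℝ) - 1))
          + B.oddPart a (angle x hx) * Real.cos (‖x‖ - Real.pi / 4 * ((n : ℝ) - 1))
          + E₂ x) ∧
      angularGradient u x =
        (2 * (2 * Real.pi) ^ (((n : ℝ) - 1) / 2) / ‖x‖ ^ (((n : ℝ) + 1) / 2)) •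
        (Real.cos (‖x‖ - Real.pi / 4 * ((n : ℝ) - 1)) •
            sphereGradient (B.evenPart a) (angle x hx)
          + Real.sin (‖x‖ - Real.pi / 4 * ((n : ℝ) - 1)) •
            sphereGradient (B.oddPart a) (angle x hx)
          + E₃ x) ∧
      DifferentiableAt ℝ E₁ x ∧
      |E₁ x| + ‖gradient E₁ x‖ + |E₂ x| + ‖E₃ x‖ ≤ C * B.sobolevNorm s c / ‖x‖ := by
  obtain ⟨D, hD⟩ := exists_sphereWaveBound hn
  obtain ⟨K, hK, hfam⟩ := SphericalHarmonicBasis.exists_angularFamily hn hs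
  have hD0 := hD.pos
  have hn' : (2 : ℝ) ≤ n := by exact_mod_cast hn
  set α : ℝ := ((n : ℝ) - 1) / 2 with hα
  have hα0 : 0 ≤ α := by rw [hα]; linarith
  -- `D` and `α` depend only on `n`, and `K` only on `n` and `s`.
  refine ⟨(5 * D + α * (D + 1)) * K, by positivity, fun B f c a hf hc hca => ?_⟩
  obtain ⟨𝒬, hQ, hbound⟩ := hfam B c a hc hca
  have hR : ∀ x, x ≠ 0 → HasGradientAt (homExt (B.evenPart a))
      (𝒬.gradSeries (fun l _ => quarterCos l) x) x := fun x hx => by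
    refine (AngularFamily.hasGradientAt_series_const hx
      abs_quarterCos_le).congr_of_eventuallyEq ?_
    filter_upwards [isOpen_ne.mem_nhds hx] with y hy
    exact SphericalHarmonicBasis.homExt_evenPart hQ hy
  have hI : ∀ x, x ≠ 0 → HasGradientAt (homExt (B.oddPart a))
      (𝒬.gradSeries (fun l _ => quarterSin l) x) x := fun x hx => by
    refine (AngularFamily.hasGradientAt_series_const hx
      abs_quarterSin_le).congr_of_eventuallyEq ?_
    filter_upwards [isOpen_ne.mem_nhds hx] with y hy
    exact SphericalHarmonicBasis.homExt_oddPart hQ hy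
  refine ⟨fun ξ => ⟨SphericalHarmonicBasis.summable_evenTerm hQ ξ,
    SphericalHarmonicBasis.summable_oddTerm hQ ξ⟩,
    fun x hx => ⟨(hR x hx).differentiableAt, (hI x hx).differentiableAt⟩, hf.ae_eq hca hQ,
    fun x => (fourierSphere f x).re, hf.fourierSphere_eq_re hn hca,
    Complex.reCLM.differentiable.comp
      (differentiable_fourierSphere (hf.1.integrable one_le_two)),
    -- The second error includes the derivative of the amplitude. The third carries the factor `|x|`
    -- because the gradients of functions homogeneous of degree `0` scale like `1/|x|`, which is
    -- also the extra power in the angular amplitude.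
    𝒬.series (sphereWaveError n),
    fun x => 𝒬.series (sphereWaveErrorDeriv n) x - α / ‖x‖ * 𝒬.series (sphereWave n) x,
    fun x => ‖x‖ • 𝒬.gradSeries (sphereWaveError n) x, fun x hx => ?_⟩
  have hr : 0 < ‖x‖ := norm_pos_iff.2 hx
  have hev : B.evenPart a (angle x hx) = 𝒬.series (fun l _ => quarterCos l) x := by
    rw [SphericalHarmonicBasis.evenPart_eq_series hQ, AngularFamily.series_angle]
  have hodd : B.oddPart a (angle x hx) = 𝒬.series (fun l _ => quarterSin l) x := by
    rw [SphericalHarmonicBasis.oddPart_eq_series hQ, AngularFamily.series_angle]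
  have hinner := AngularFamily.inner_gradSeries (𝒬 := 𝒬) hx fun l => hD.wave l hr
  have hu := (hasGradientAt_div_rpow_mul (κ := 2 * (2 * Real.pi) ^ α) (α := α) hx
    (AngularFamily.hasGradientAt_wave (𝒬 := 𝒬) hn hD hx)).congr_of_eventuallyEq
    (f₁ := fun x => (fourierSphere f x).re) (by
      filter_upwards [isOpen_ne.mem_nhds hx] with y hy
      exact hf.fourierSphere_eq_series hn hca hQ hD hy)
  have hv : inner ℝ x ((2 * (2 * Real.pi) ^ α / ‖x‖ ^ α) • 𝒬.gradSeries (sphereWave n) x) = 0 := by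
    rw [inner_smul_right, hinner, mul_zero]
  have hE := AngularFamily.hasGradientAt_waveError (𝒬 := 𝒬) hn hD hx
  refine ⟨?_, ?_, ?_, hE.differentiableAt, ?_⟩
  · rw [hev, hodd, ← AngularFamily.series_quarter hx (fun l => sphereWave_eq n l _)
      fun l => hD.error l _ hr]
    exact hf.fourierSphere_eq_series hn hca hQ hD hx
  · rw [radialDeriv_eq hx hu hv, hev, hodd, AngularFamily.series_quarter (𝒬 := 𝒬) hx
      (fun l => sphereWaveDeriv_eq n l _) fun l => hD.errorDeriv l _ hr]
    ring
  · have e1 : sphereGradient (B.evenPart a) (angle x hx)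
        = ‖x‖ • 𝒬.gradSeries (fun l _ => quarterCos l) x := by
      rw [sphereGradient, (hR _ (coe_sphere_ne_zero _)).gradient, AngularFamily.gradSeries_angle]
    have e2 : sphereGradient (B.oddPart a) (angle x hx)
        = ‖x‖ • 𝒬.gradSeries (fun l _ => quarterSin l) x := by
      rw [sphereGradient, (hI _ (coe_sphere_ne_zero _)).gradient, AngularFamily.gradSeries_angle]
    have e3 : ‖x‖ ^ (((n : ℝ) + 1) / 2) = ‖x‖ ^ α * ‖x‖ := by
      rw [← Real.rpow_add_one hr.ne', hα]
      congr 1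
      ring
    rw [angularGradient_eq hx hu hv, e1, e2, e3, AngularFamily.gradSeries_quarter (𝒬 := 𝒬) hx
      (fun l => sphereWave_eq n l _) fun l => hD.error l _ hr, smul_comm _ ‖x‖, smul_comm _ ‖x‖,
      ← smul_add, ← smul_add, smul_smul, ← div_div, div_mul_cancel₀ _ hr.ne']
  · rw [hE.gradient]
    refine (AngularFamily.error_bound hD hx hα0).trans
      (div_le_div_of_nonneg_right ?_ hr.le)
    rw [mul_assoc _ K]
    exact mul_le_mul_of_nonneg_left hbound (by positivity)

end
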